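/- Let $d\in\mathbb N$, $L_1>1$ and $L_2>0$. There is a constant $C$ depending only on $L_1,L_2,d$ such that the following holds. Let $k\ge 2$, and let $\pi,\rho$ be probability measures supported on $[0,1]^d$ with Lebesgue densities (also denoted $\pi,\rho$) in $C^k([0,1]^d)$ such that $$\|\pi\|_{C^k([0,1]^d)}\le L_1,\quad \|\rho\|_{C^k([0,1]^d)}\le L_1,\quad \inf_{[0,1]^d}\pi\ge L_2,\quad \inf_{[0,1]^d}\rho\ge L_2 .$$ Here $\|f\|_{C^k(S)}=\sup_{n\le k}\sup_{x\in S}\|D^nf(x)\|$, with the operator norm of multilinear maps. Let $T:[0,1]^d\to[0,1]^d$ be the Knothe--Rosenblatt map from $\pi$ to $\rho$: for $j=1,\dots,d$, $$T_j(x_1,\dots,x_j)=F_{\rho,j}\big(T_1(x),\dots,T_{j-1}(x),\,\cdot\,\big)^{-1}\big(F_{\pi,j}(x_1,\dots,x_j)\big),$$ where $F_{\mu,j}(x_1,\dots,x_{j-1},\cdot)$ is the distribution function on $[0,1]$ of the $j$-th coordinate under $\mu$ conditioned on the first $j-1$ coordinates being $x_1,\dots,x_{j-1}$. Let $f^\Delta:[0,1]^d\times[0,1]\to\mathbb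 R^d$ be the straight-line velocity field of $T$, i.e. $$f^\Delta\big((1-t)x+tT(x),\,t\big)=T(x)-x,\qquad x\in[0,1]^d,\ t\in[0,1].$$ Let $r\in\mathbb R$ and let $g=(g_1,\dots,g_d)\in C^2([0,1]^d\times[0,1],\mathbb R^d)$ satisfy $g_j(x,t)=h_j(x,t)\,x_j(1-x_j)$ with $h_j\in C^2([0,1]^d\times[0,1],\mathbb R)$ for all $j$, and $\|g\|_{C^2([0,1]^d\times[0,1])}\le r$. For a velocity field $f$ on $[0,1]^d\times[0,1]$ let $X_f(x,t)\in[0,1]^d$ denote its flow map, $X_f(x,t)=x+\int_0^t f(X_f(x,s),s)\,ds$ for $x\in[0,1]^d$, $t\in[0,1]$. Then $f^\Delta(\cdot,t)\in C^1([0,1]^d)$ for all $t\in[0,1]$, the norm below is finite, the flow maps of $f^\Delta$ and of $g$ exist and are unique on $[0,1]^d\times[0,1]$, $X_g(\cdot,1)_\sharp\pi$ and $X_{f^\Delta}(\cdot,1)_\sharp\pi$ are probability measures, and $$\mathrm{KL}\big(X_g(\cdot,1)_\sharp\pi\,\big\|\,X_{f^\Delta}(\cdot,1)_\sharp\pi\big)\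 \le\ C\,\|f^\Delta-g\|_{C^1}^2,\qquad \|f^\Delta-g\|_{C^1}:=\sup_{t\in[0,1]}\|f^\Delta(\cdot,t)-g(\cdot,t)\|_{C^1([0,1]^d)} .$$ The constant $C$ does not depend on $k$, $r$, $\pi$, $\rho$ or $g$. -/

import Mathlib

open MeasureTheory Set
open scoped ENNReal NNReal

namespace KRFlow

noncomputable section

/-- `ℝ^d` with the Euclidean norm. -/
abbrev E (d : ℕ) : Type := EuclideanSpace ℝ (Fin d)

/-- The unit cube `[0,1]^d`. -/
def cube (d : ℕ) : Set (E d) := {x | ∀ i, x i ∈ Icc (0 : ℝ) 1}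

/-- The space-time cylinder `[0,1]^d × [0,1]` inside `ℝ^d × ℝ` with its Euclidean norm. -/
def cylinder (d : ℕ) : Set (WithLp 2 (E d × ℝ)) :=
  {z | z.fst ∈ cube d ∧ z.snd ∈ Icc (0 : ℝ) 1}

/-- The (extended) `C^k` norm on `S`: `sup_{n ≤ k} sup_{x ∈ S} ‖D^n f(x)‖`, where `D^n` is the
Fréchet derivative (one-sided at boundary points of `S`) and `‖·‖` is the norm of multilinear
maps. It is only used for functions that are `C^k` on `S`. -/
def cNorm {X Y : Type*} [NormedAddCommGroup X] [NormedSpace ℝ X]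
    [NormedAddCommGroup Y] [NormedSpace ℝ Y] (k : ℕ) (S : Set X) (f : X → Y) : ℝ≥0∞ :=
  ⨆ (n : ℕ) (_ : n ≤ k) (x : X) (_ : x ∈ S), ‖iteratedFDerivWithin ℝ n f S x‖ₑ

/-- The probability measure `μ` has Lebesgue density `p` on `[0,1]^d` and vanishes outside,
`p ∈ C^k([0,1]^d)`, `‖p‖_{C^k} ≤ L₁` and `p ≥ L₂` on `[0,1]^d`.
(For `L₂ > 0` the support of such a `μ` is exactly `[0,1]^d`.) -/
structure RegularDensity {d : ℕ} (k : ℕ) (L₁ L₂ : ℝ) (μ : Measure (E d)) (p : E d → ℝ) :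
    Prop where
  isProbabilityMeasure : IsProbabilityMeasure μ
  eq_withDensity : μ = (volume.restrict (cube d)).withDensity (fun x => ENNReal.ofReal (p x))
  contDiffOn : ContDiffOn ℝ k p (cube d)
  norm_le : cNorm k (cube d) p ≤ ENNReal.ofReal L₁
  lower_bound : ∀ x ∈ cube d, L₂ ≤ p x

/-! ### The Knothe–Rosenblatt map (coordinates are numbered from `0`) -/

/-- `(x_0, …, x_{k-1}, t_k, …, t_{d-1})`. -/
def splice {d : ℕ} (k : ℕ) (x t : E d) : E d :=
  WithLp.toLp 2 fun i => if (i : ℕ) < k then x i else t i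

/-- `x` with its `i`-th coordinate replaced by `s`. -/
def setCoord {d : ℕ} (x : E d) (i : Fin d) (s : ℝ) : E d :=
  WithLp.toLp 2 (Function.update (WithLp.ofLp x) i s)

/-- The marginal density of the first `k` coordinates,
`∫_{[0,1]^{d-k}} p(x_0, …, x_{k-1}, t_k, …, t_{d-1}) d(t_k, …, t_{d-1})`. The integral is written
over all of `[0,1]^d`: the integrand does not depend on `t_0, …, t_{k-1}`, each of which
ranges over an interval of length one. -/
def marginal {d : ℕ} (p : E d → ℝ) (k : ℕ) (x : E d) : ℝ :=
  ∫ t in cube d, p (splice k x t)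

/-- The density at `s` of the `i`-th coordinate conditioned on the preceding ones being
`x_0, …, x_{i-1}`. -/
def condDensity {d : ℕ} (p : E d → ℝ) (i : Fin d) (x : E d) (s : ℝ) : ℝ :=
  marginal p (i + 1) (setCoord x i s) / marginal p i x

/-- The distribution function of the `i`-th coordinate conditioned on the preceding ones being
`x_0, …, x_{i-1}`. -/
def condCDF {d : ℕ} (p : E d → ℝ) (i : Fin d) (x : E d) (s : ℝ) : ℝ :=
  ∫ τ in (0 : ℝ)..s, condDensity p i x τ

/-- The recursion for the first `k` components of the Knothe–Rosenblatt map from the density `p`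
to the density `q`:
`T_k(x) = F_{q,k}(T_0(x), …, T_{k-1}(x), ·)⁻¹ (F_{p,k}(x_0, …, x_{k-1}, x_k))`,
the inverse being taken on `[0,1]`. Components not yet computed are set to `0`. -/
def krPartial {d : ℕ} (p q : E d → ℝ) : ℕ → E d → E d
  | 0, _ => 0
  | k + 1, x =>
    if h : k < d then
      setCoord (krPartial p q k x) ⟨k, h⟩
        (Function.invFunOn (condCDF q ⟨k, h⟩ (krPartial p q k x)) (Icc (0 : ℝ) 1)
          (condCDF p ⟨k, h⟩ x (x ⟨k, h⟩)))
    else krPartial p q k x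

/-- The Knothe–Rosenblatt map `T` on `[0,1]^d` from the density `p` to the density `q`. -/
def krMap {d : ℕ} (p q : E d → ℝ) (x : E d) : E d := krPartial p q d x

/-! ### Displacement interpolation and its velocity field -/

/-- The displacement interpolation `T_t(x) = (1 - t) x + t T(x)`. -/
def interp {d : ℕ} (T : E d → E d) (t : ℝ) (x : E d) : E d := (1 - t) • x + t • T x

/-- The straight-line velocity field of `T` on `[0,1]^d × [0,1]`, determined by
`f(T_t(x), t) = T(x) - x`: at `(y, t)` it is `T(x) - x` where `x ∈ [0,1]^d` and `T_t(x) = y`. -/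
def straightVelocity {d : ℕ} (T : E d → E d) (y : E d) (t : ℝ) : E d :=
  T (Function.invFunOn (interp T t) (cube d) y) - Function.invFunOn (interp T t) (cube d) y

/-- The velocity field `f^Δ` whose flow is the displacement interpolation of the
Knothe–Rosenblatt map from `p` to `q`. -/
def krVelocity {d : ℕ} (p q : E d → ℝ) : E d → ℝ → E d := straightVelocity (krMap p q)

/-! ### Flows of velocity fields on `[0,1]^d × [0,1]` -/

/-- `γ : [0,1] → [0,1]^d` solves `γ(t) = x + ∫_0^t f(γ(s), s) ds`. -/
structure IsTrajectory {d : ℕ} (f : E d → ℝ → E d) (x : E d) (γ : ℝ → E d) : Prop where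
  continuousOn : ContinuousOn γ (Icc 0 1)
  mem_cube : ∀ t ∈ Icc (0 : ℝ) 1, γ t ∈ cube d
  eq_integral : ∀ t ∈ Icc (0 : ℝ) 1, γ t = x + ∫ s in (0 : ℝ)..t, f (γ s) s

/-- From every point of `[0,1]^d` there is exactly one trajectory of `f` on the time
interval `[0,1]`. -/
def WellPosed {d : ℕ} (f : E d → ℝ → E d) : Prop :=
  ∀ x ∈ cube d, (∃ γ, IsTrajectory f x γ) ∧
    ∀ γ₁ γ₂, IsTrajectory f x γ₁ → IsTrajectory f x γ₂ → EqOn γ₁ γ₂ (Icc 0 1)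

/-- The flow map `X_f(x, t)`: the trajectory of `f` starting at `x`. -/
def flowMap {d : ℕ} (f : E d → ℝ → E d) (x : E d) : ℝ → E d :=
  Classical.epsilon (IsTrajectory f x)

/-- The time-one distribution `X_f(·, 1)_♯ μ`. -/
def pushforward {d : ℕ} (f : E d → ℝ → E d) (μ : Measure (E d)) : Measure (E d) :=
  μ.map (fun x => flowMap f x 1)

/-! ### The ansatz class and the distance of velocity fields -/

/-- The ansatz class `C^k_ansatz(r)`: fields on `[0,1]^d × [0,1]` with components
`g_j(x,t) = h_j(x,t) x_j (1 - x_j)`, `h_j ∈ C^k([0,1]^d × [0,1])`, that are of class `C²`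
with `‖g‖_{C²([0,1]^d × [0,1])} ≤ r`. -/
structure InAnsatz {d : ℕ} (k : ℕ) (r : ℝ) (g : E d → ℝ → E d) : Prop where
  factor : ∃ h : Fin d → WithLp 2 (E d × ℝ) → ℝ,
    (∀ j, ContDiffOn ℝ k (h j) (cylinder d)) ∧
    ∀ z ∈ cylinder d, ∀ j, g z.fst z.snd j = h j z * (z.fst j * (1 - z.fst j))
  contDiffOn : ContDiffOn ℝ 2 (fun z : WithLp 2 (E d × ℝ) => g z.fst z.snd) (cylinder d)
  norm_le : cNorm 2 (cylinder d) (fun z : WithLp 2 (E d × ℝ) => g z.fst z.snd)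
    ≤ ENNReal.ofReal r

/-- `‖f - g‖_{C^1([0,1]^d)}` for time-dependent fields: the supremum over `t ∈ [0,1]` of the
spatial norms `‖f(·,t) - g(·,t)‖_{C^1([0,1]^d)}`. -/
def c1Dist {d : ℕ} (f g : E d → ℝ → E d) : ℝ≥0∞ :=
  ⨆ (t : ℝ) (_ : t ∈ Icc (0 : ℝ) 1), cNorm 1 (cube d) (fun x => f x t - g x t)

end

end KRFlow

namespace KRFlow

/-! ### The cube -/

/-! Write `T` for the Knothe–Rosenblatt map, `T_t` for its interpolants, `X` for the flow of `g`,
and `δ` for the `C¹` distance of the two fields. The time-one flow of the straight-line field is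
`T`, so its pushforward of `π` is `ρ` (`pushforward_krVelocity`). The pushforward under `X` has
density `p(x) / |det DX(x)|` at the point `X(x,1)`, and `p = det DT · (q ∘ T)`. Hence the log-ratio
of the two densities there is `log (det DT(x) / |det DX(x)|) + log (q(T x) / q(X(x,1)))`. If this is
at most `ε` in absolute value everywhere, the divergence is at most `2 ε²`, because the integrand of
KL vanishes to second order at ratio one (`klDiv_le_of_le_mul`). It remains to prove `ε ≤ C δ`.

The second term follows from Grönwall's inequality, `|X - T_t| ≤ C δ`, and from the Lipschitz and
lower bounds on `q`. For the first term, Liouville's formula writes both log-determinants as time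
integrals of divergences along trajectories (`IsTangentField.exists_hasFDerivWithinAt_flowMap`). At
a common point the divergences differ by at most `d δ`; passing from the trajectory of `g` to the
straight line then requires the divergence of the straight-line field to be Lipschitz in space,
although the field itself is only shown to be `C¹`. Triangularity resolves this: the divergence
involves only the diagonal entries `∂_i T_i`, which are quotients of conditional densities at `x`
and at `T x`, hence Lipschitz with constants in `L₁, L₂` (`abs_jac_krMap_sub_le`,
`IsTriangular.abs_trace_sub_le`).

Uniformity comes from the class `IsTriangular c K`, stable under inversion, composition and
interpolation with controlled constants; `T` belongs to it as `R_q⁻¹ ∘ R_p` for the Rosenblatt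
transforms `R_p, R_q` (`exists_isTriangular_krMap`). Every Grönwall constant in the final bound is
taken from the straight-line field, never from `g`. -/

theorem abs_apply_le_norm {d : ℕ} (x : E d) (i : Fin d) : |x i| ≤ ‖x‖ := by
  simpa using PiLp.norm_apply_le x i

theorem sum_smul_single {d : ℕ} (x : E d) : ∑ i, x i • EuclideanSpace.single i (1 : ℝ) = x := by
  ext j
  simp [Pi.single_apply]

theorem norm_le_sum_abs {d : ℕ} (x : E d) : ‖x‖ ≤ ∑ i, |x i| := by
  conv_lhs => rw [← sum_smul_single x]
  refine (norm_sum_le _ _).trans (Finset.sum_le_sum fun i _ => ?_)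
  simp [norm_smul]

theorem norm_le_of_abs_apply_le {d : ℕ} {x : E d} {c : ℝ} (h : ∀ i, |x i| ≤ c) : ‖x‖ ≤ d * c := by
  refine (norm_le_sum_abs x).trans ((Finset.sum_le_sum fun i _ => h i).trans_eq ?_)
  simp

theorem convex_cube (d : ℕ) : Convex ℝ (cube d) := by
  intro x hx y hy a b ha hb hab i
  exact convex_Icc (0 : ℝ) 1 (hx i) (hy i) ha hb hab

theorem cube_eq_preimage (d : ℕ) :
    cube d = WithLp.ofLp ⁻¹' (Set.univ.pi fun _ : Fin d => Icc (0 : ℝ) 1) := by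
  ext x
  simp only [cube, Set.mem_ofPred_eq, mem_preimage, Set.mem_univ_pi]

theorem isClosed_cube (d : ℕ) : IsClosed (cube d) := by
  rw [cube_eq_preimage]
  exact (isClosed_set_pi fun _ _ => isClosed_Icc).preimage (PiLp.continuous_ofLp 2 _)

theorem norm_le_of_mem_cube {d : ℕ} {x : E d} (hx : x ∈ cube d) : ‖x‖ ≤ d := by
  have := norm_le_of_abs_apply_le (x := x) (c := 1) fun i => by
    rw [abs_of_nonneg (hx i).1]; exact (hx i).2
  simpa using this

theorem isCompact_cube (d : ℕ) : IsCompact (cube d) :=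
  Metric.isCompact_of_isClosed_isBounded (isClosed_cube d)
    (isBounded_iff_forall_norm_le.2 ⟨d, fun _ hx => norm_le_of_mem_cube hx⟩)

theorem measurableSet_cube (d : ℕ) : MeasurableSet (cube d) := (isClosed_cube d).measurableSet

theorem interior_cube_nonempty (d : ℕ) : (interior (cube d)).Nonempty := by
  have hopen : IsOpen (WithLp.ofLp ⁻¹' (Set.univ.pi fun _ : Fin d => Ioo (0 : ℝ) 1) : Set (E d)) :=
    (isOpen_set_pi Set.finite_univ fun _ _ => isOpen_Ioo).preimage (PiLp.continuous_ofLp 2 _)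
  refine ⟨WithLp.toLp 2 fun _ => 1 / 2, ?_⟩
  refine interior_maximal ?_ hopen ?_
  · intro x hx i
    exact Ioo_subset_Icc_self (hx i (mem_univ i))
  · intro i _
    norm_num

theorem uniqueDiffOn_cube (d : ℕ) : UniqueDiffOn ℝ (cube d) :=
  uniqueDiffOn_convex (convex_cube d) (interior_cube_nonempty d)

theorem zero_mem_cube (d : ℕ) : (0 : E d) ∈ cube d := fun i => by simp

/-! ### Replacing a coordinate -/

theorem setCoord_apply {d : ℕ} (x : E d) (i j : Fin d) (s : ℝ) :
    setCoord x i s j = if j = i then s else x j := by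
  simp [setCoord, Function.update_apply]

@[simp] theorem setCoord_self {d : ℕ} (x : E d) (i : Fin d) (s : ℝ) : setCoord x i s i = s := by
  simp [setCoord_apply]

theorem setCoord_of_ne {d : ℕ} (x : E d) {i j : Fin d} (h : j ≠ i) (s : ℝ) :
    setCoord x i s j = x j := by
  simp [setCoord_apply, h]

@[simp] theorem setCoord_eq {d : ℕ} (x : E d) (i : Fin d) : setCoord x i (x i) = x := by
  ext j
  rw [setCoord_apply]
  split_ifs with h
  · rw [h]
  · rfl

theorem setCoord_mem_cube {d : ℕ} {x : E d} (hx : x ∈ cube d) (i : Fin d) {s : ℝ}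
    (hs : s ∈ Icc (0 : ℝ) 1) : setCoord x i s ∈ cube d := by
  intro j
  rw [setCoord_apply]
  split_ifs
  exacts [hs, hx j]

theorem setCoord_eq_add {d : ℕ} (x : E d) (i : Fin d) (s : ℝ) :
    setCoord x i s = x + (s - x i) • EuclideanSpace.single i (1 : ℝ) := by
  ext j
  rw [setCoord_apply]
  by_cases h : j = i
  · subst h; simp
  · simp [h]

theorem hasDerivAt_setCoord {d : ℕ} (x : E d) (i : Fin d) (s : ℝ) :
    HasDerivAt (setCoord x i) (EuclideanSpace.single i (1 : ℝ)) s := by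
  have h : setCoord x i = fun s => x + (s - x i) • EuclideanSpace.single i (1 : ℝ) := by
    funext s; exact setCoord_eq_add x i s
  rw [h]
  have := (((hasDerivAt_id s).sub_const (x i)).smul_const
    (EuclideanSpace.single i (1 : ℝ))).const_add x
  simpa using this

theorem continuous_setCoord {d : ℕ} (i : Fin d) :
    Continuous fun z : E d × ℝ => setCoord z.1 i z.2 := by
  simp_rw [setCoord_eq_add]
  fun_prop

/-! ### The coordinatewise clamp -/

/-- The coordinatewise projection onto the box `[a, b]^d`. -/
noncomputable def boxClamp {d : ℕ} (a b : ℝ) (x : E d) : E d :=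
  WithLp.toLp 2 fun i => max a (min b (x i))

theorem boxClamp_apply {d : ℕ} (a b : ℝ) (x : E d) (i : Fin d) :
    boxClamp a b x i = max a (min b (x i)) := rfl

theorem abs_boxClamp_sub_le {d : ℕ} (a b : ℝ) (x y : E d) (i : Fin d) :
    |boxClamp a b x i - boxClamp a b y i| ≤ |x i - y i| := by
  rw [boxClamp_apply, boxClamp_apply]
  refine (abs_max_sub_max_le_max _ _ _ _).trans (max_le (by simp) ?_)
  refine (abs_min_sub_min_le_max _ _ _ _).trans (max_le (by simp) le_rfl)

/-- Precomposing with the clamp extends a field on a box to all of space while keeping its Lipschitz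
constant and its sup bound. This makes global existence available without a continuation argument.
-/
theorem lipschitzWith_boxClamp {d : ℕ} (a b : ℝ) : LipschitzWith 1 (boxClamp (d := d) a b) := by
  refine LipschitzWith.of_dist_le_mul fun x y => ?_
  rw [NNReal.coe_one, one_mul, EuclideanSpace.dist_eq, EuclideanSpace.dist_eq]
  refine Real.sqrt_le_sqrt (Finset.sum_le_sum fun i _ => ?_)
  rw [Real.dist_eq, Real.dist_eq]
  exact pow_le_pow_left₀ (abs_nonneg _) (abs_boxClamp_sub_le a b x y i) 2

theorem boxClamp_mem_cube {d : ℕ} (x : E d) : boxClamp 0 1 x ∈ cube d := fun _ =>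
  ⟨le_max_left _ _, max_le zero_le_one (min_le_left _ _)⟩

theorem boxClamp_of_mem_cube {d : ℕ} {x : E d} (hx : x ∈ cube d) : boxClamp 0 1 x = x := by
  ext i
  rw [boxClamp_apply, min_eq_right (hx i).2, max_eq_right (hx i).1]

theorem boxClamp_of_abs_le {d : ℕ} {x : E d} {R : ℝ} (h : ∀ i, |x i| ≤ R) :
    boxClamp (-R) R x = x := by
  ext i
  rw [boxClamp_apply, min_eq_right (abs_le.1 (h i)).2, max_eq_right (abs_le.1 (h i)).1]

theorem norm_boxClamp_le {d : ℕ} {R : ℝ} (hR : 0 ≤ R) (x : E d) : ‖boxClamp (-R) R x‖ ≤ d * R := by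
  refine norm_le_of_abs_apply_le fun _ => abs_le.2 ⟨le_max_left _ _, ?_⟩
  exact max_le (by linarith) (min_le_left _ _)

/-! ### Differentiable functions on compact convex sets -/

theorem exists_norm_fderivWithin_le {X Y : Type*} [NormedAddCommGroup X] [NormedSpace ℝ X]
    [NormedAddCommGroup Y] [NormedSpace ℝ Y] {S : Set X} (hS : IsCompact S)
    (hu : UniqueDiffOn ℝ S) {f : X → Y} (hf : ContDiffOn ℝ 1 f S) :
    ∃ K : ℝ≥0, ∀ x ∈ S, ‖fderivWithin ℝ f S x‖ ≤ K := by
  obtain ⟨K, hK⟩ := hS.exists_bound_of_continuousOn (hf.continuousOn_fderivWithin hu le_rfl)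
  exact ⟨K.toNNReal, fun x hx => (hK x hx).trans (Real.le_coe_toNNReal K)⟩

theorem exists_lipschitzOnWith {X Y : Type*} [NormedAddCommGroup X] [NormedSpace ℝ X]
    [NormedAddCommGroup Y] [NormedSpace ℝ Y] {S : Set X} (hS : IsCompact S) (hc : Convex ℝ S)
    (hu : UniqueDiffOn ℝ S) {f : X → Y} (hf : ContDiffOn ℝ 1 f S) :
    ∃ K : ℝ≥0, LipschitzOnWith K f S := by
  obtain ⟨K, hK⟩ := exists_norm_fderivWithin_le hS hu hf
  exact ⟨K, hc.lipschitzOnWith_of_nnnorm_fderivWithin_le (hf.differentiableOn one_ne_zero) hK⟩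

/-- The first-order Taylor estimate on a convex set for a function with Lipschitz derivative. -/
theorem norm_sub_sub_fderivWithin_le {X Y : Type*} [NormedAddCommGroup X] [NormedSpace ℝ X]
    [NormedAddCommGroup Y] [NormedSpace ℝ Y] {S : Set X} (hc : Convex ℝ S) {f : X → Y}
    (hf : DifferentiableOn ℝ f S) {K : ℝ≥0} (hK : LipschitzOnWith K (fderivWithin ℝ f S) S)
    {x y : X} (hx : x ∈ S) (hy : y ∈ S) :
    ‖f y - f x - fderivWithin ℝ f S x (y - x)‖ ≤ K * ‖y - x‖ * ‖y - x‖ := by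
  have hsub : segment ℝ x y ⊆ S := hc.segment_subset hx hy
  refine (convex_segment x y).norm_image_sub_le_of_norm_hasFDerivWithin_le'
    (fun z hz => ((hf z (hsub hz)).hasFDerivWithinAt).mono hsub) (fun z hz => ?_)
    (left_mem_segment ℝ x y) (right_mem_segment ℝ x y)
  have h1 := hK.dist_le_mul z (hsub hz) x hx
  rw [dist_eq_norm, dist_eq_norm] at h1
  refine h1.trans (mul_le_mul_of_nonneg_left ?_ K.2)
  exact norm_sub_le_of_mem_segment hz

/-- Differentiability of the flow map and of averages of densities is obtained by exhibiting a
quadratic remainder. -/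
theorem hasFDerivWithinAt_of_norm_sub_sub_le {X Y : Type*} [NormedAddCommGroup X]
    [NormedSpace ℝ X] [NormedAddCommGroup Y] [NormedSpace ℝ Y] {S : Set X} {f : X → Y}
    {f' : X →L[ℝ] Y} {x : X} {C : ℝ}
    (h : ∀ y ∈ S, ‖f y - f x - f' (y - x)‖ ≤ C * (‖y - x‖ * ‖y - x‖)) :
    HasFDerivWithinAt f f' S x := by
  rw [hasFDerivWithinAt_iff_isLittleO]
  have hO : (fun y => f y - f x - f' (y - x)) =O[nhdsWithin x S]
      fun y => ‖y - x‖ * ‖y - x‖ := by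
    refine Asymptotics.IsBigO.of_bound C ?_
    filter_upwards [self_mem_nhdsWithin] with y hy
    simpa using h y hy
  refine hO.trans_isLittleO ?_
  have h1 : (fun y => ‖y - x‖) =o[nhdsWithin x S] fun _ => (1 : ℝ) := by
    rw [Asymptotics.isLittleO_one_iff]
    have : Continuous fun y : X => ‖y - x‖ := by fun_prop
    simpa using (this.tendsto x).mono_left nhdsWithin_le_nhds
  have h2 := h1.mul_isBigO (Asymptotics.isBigO_refl (fun y : X => ‖y - x‖) _)
  simpa using h2

end KRFlow

namespace KRFlow

/-! ### Trajectories in differential form -/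

/-- A curve in the cube whose velocity at each time `t ∈ [0,1]` is `f (γ t) t`. -/
structure IsSolution {d : ℕ} (f : E d → ℝ → E d) (x : E d) (γ : ℝ → E d) : Prop where
  initial : γ 0 = x
  mem_cube : ∀ t ∈ Icc (0 : ℝ) 1, γ t ∈ cube d
  hasDerivWithinAt : ∀ t ∈ Icc (0 : ℝ) 1, HasDerivWithinAt γ (f (γ t) t) (Icc 0 1) t

theorem _root_.HasDerivWithinAt.Ici_of_Icc {F : Type*} [NormedAddCommGroup F] [NormedSpace ℝ F]
    {γ : ℝ → F} {v : F} {a b t : ℝ} (h : HasDerivWithinAt γ v (Icc a b) t) (ht : t ∈ Ico a b) :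
    HasDerivWithinAt γ v (Ici t) t :=
  h.mono_of_mem_nhdsWithin (Icc_mem_nhdsGE_of_mem ht)

theorem _root_.HasDerivWithinAt.Iic_of_Icc {F : Type*} [NormedAddCommGroup F] [NormedSpace ℝ F]
    {γ : ℝ → F} {v : F} {a b t : ℝ} (h : HasDerivWithinAt γ v (Icc a b) t) (ht : t ∈ Ioc a b) :
    HasDerivWithinAt γ v (Iic t) t :=
  h.mono_of_mem_nhdsWithin (Icc_mem_nhdsLE_of_mem ht)

theorem IsSolution.continuousOn {d : ℕ} {f : E d → ℝ → E d} {x : E d} {γ : ℝ → E d}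
    (h : IsSolution f x γ) : ContinuousOn γ (Icc 0 1) := fun t ht =>
  (h.hasDerivWithinAt t ht).continuousWithinAt

theorem continuousOn_swap {d : ℕ} {f : E d → ℝ → E d}
    (hf : ContinuousOn (fun z : E d × ℝ => f z.1 z.2) (cube d ×ˢ Icc 0 1)) :
    ContinuousOn (Function.uncurry fun t x => f x t) (Icc 0 1 ×ˢ cube d) :=
  hf.comp continuous_swap.continuousOn fun _ hz => ⟨hz.2, hz.1⟩

theorem IsTrajectory.isSolution {d : ℕ} {f : E d → ℝ → E d}
    (hf : ContinuousOn (fun z : E d × ℝ => f z.1 z.2) (cube d ×ˢ Icc 0 1)) {x : E d} {γ : ℝ → E d}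
    (h : IsTrajectory f x γ) : IsSolution f x γ where
  initial := by simpa using h.eq_integral 0 (by simp)
  mem_cube := h.mem_cube
  hasDerivWithinAt t ht := by
    have := ODE.hasDerivWithinAt_picard_Icc (f := fun t x => f x t) (t₀ := 0) (by simp)
      (continuousOn_swap hf) h.continuousOn h.mem_cube x ht
    exact this.congr (fun s hs => h.eq_integral s hs) (h.eq_integral t ht)

theorem IsSolution.isTrajectory {d : ℕ} {f : E d → ℝ → E d}
    (hf : ContinuousOn (fun z : E d × ℝ => f z.1 z.2) (cube d ×ˢ Icc 0 1)) {x : E d} {γ : ℝ → E d}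
    (h : IsSolution f x γ) : IsTrajectory f x γ where
  continuousOn := h.continuousOn
  mem_cube := h.mem_cube
  eq_integral t ht := by
    have hsub : uIcc 0 t ⊆ Icc (0 : ℝ) 1 := by
      rw [uIcc_of_le ht.1]; exact Icc_subset_Icc_right ht.2
    have := ODE.picard_eq_of_hasDerivAt (f := fun t x => f x t) (t₀ := 0) (t := t) (u := cube d)
      (α := γ) ((continuousOn_swap hf).mono (prod_mono hsub le_rfl))
      (fun s hs => (h.hasDerivWithinAt s (hsub hs)).mono hsub) fun s hs => h.mem_cube s (hsub hs)
    rw [ODE.picard_apply, h.initial] at this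
    exact this.symm

theorem IsSolution.eqOn {d : ℕ} {f : E d → ℝ → E d} {K : ℝ≥0}
    (hK : ∀ t ∈ Icc (0 : ℝ) 1, LipschitzOnWith K (fun x => f x t) (cube d)) {x : E d}
    {γ₁ γ₂ : ℝ → E d} (h₁ : IsSolution f x γ₁) (h₂ : IsSolution f x γ₂) :
    EqOn γ₁ γ₂ (Icc 0 1) :=
  ODE_solution_unique_of_mem_Icc_right (v := fun t x => f x t) (s := fun _ => cube d)
    (fun t ht => hK t (Ico_subset_Icc_self ht)) h₁.continuousOn
    (fun t ht => (h₁.hasDerivWithinAt t (Ico_subset_Icc_self ht)).Ici_of_Icc ht)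
    (fun t ht => h₁.mem_cube t (Ico_subset_Icc_self ht)) h₂.continuousOn
    (fun t ht => (h₂.hasDerivWithinAt t (Ico_subset_Icc_self ht)).Ici_of_Icc ht)
    (fun t ht => h₂.mem_cube t (Ico_subset_Icc_self ht)) (h₁.initial.trans h₂.initial.symm)

/-- Uniqueness backwards in time; it yields injectivity of the time-one flow. -/
theorem IsSolution.eqOn_of_eq_at_one {d : ℕ} {f : E d → ℝ → E d} {K : ℝ≥0}
    (hK : ∀ t ∈ Icc (0 : ℝ) 1, LipschitzOnWith K (fun x => f x t) (cube d)) {x₁ x₂ : E d}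
    {γ₁ γ₂ : ℝ → E d} (h₁ : IsSolution f x₁ γ₁) (h₂ : IsSolution f x₂ γ₂) (h : γ₁ 1 = γ₂ 1) :
    EqOn γ₁ γ₂ (Icc 0 1) :=
  ODE_solution_unique_of_mem_Icc_left (v := fun t x => f x t) (s := fun _ => cube d)
    (fun t ht => hK t (Ioc_subset_Icc_self ht)) h₁.continuousOn
    (fun t ht => (h₁.hasDerivWithinAt t (Ioc_subset_Icc_self ht)).Iic_of_Icc ht)
    (fun t ht => h₁.mem_cube t (Ioc_subset_Icc_self ht)) h₂.continuousOn
    (fun t ht => (h₂.hasDerivWithinAt t (Ioc_subset_Icc_self ht)).Iic_of_Icc ht)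
    (fun t ht => h₂.mem_cube t (Ioc_subset_Icc_self ht)) h

theorem wellPosed_of_isSolution {d : ℕ} {f : E d → ℝ → E d}
    (hf : ContinuousOn (fun z : E d × ℝ => f z.1 z.2) (cube d ×ˢ Icc 0 1)) {K : ℝ≥0}
    (hK : ∀ t ∈ Icc (0 : ℝ) 1, LipschitzOnWith K (fun x => f x t) (cube d))
    (hex : ∀ x ∈ cube d, ∃ γ, IsSolution f x γ) : WellPosed f := fun x hx =>
  ⟨(hex x hx).imp fun _ h => h.isTrajectory hf, fun _ _ h₁ h₂ =>
    (h₁.isSolution hf).eqOn hK (h₂.isSolution hf)⟩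

theorem WellPosed.isTrajectory_flowMap {d : ℕ} {f : E d → ℝ → E d} (h : WellPosed f) {x : E d}
    (hx : x ∈ cube d) : IsTrajectory f x (flowMap f x) :=
  Classical.epsilon_spec (h x hx).1

/-! ### Global existence -/

/-- A bounded, Lipschitz time-dependent vector field has global solutions on `[0,1]`. -/
theorem exists_solution_of_lipschitz_of_bounded {F : Type*} [NormedAddCommGroup F]
    [NormedSpace ℝ F] [CompleteSpace F] {v : ℝ → F → F} {K L : ℝ≥0}
    (hK : ∀ t ∈ Icc (0 : ℝ) 1, LipschitzWith K (v t))
    (hc : ∀ x, ContinuousOn (fun t => v t x) (Icc 0 1))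
    (hL : ∀ t ∈ Icc (0 : ℝ) 1, ∀ x, ‖v t x‖ ≤ L) (x : F) :
    ∃ γ : ℝ → F, γ 0 = x ∧
      ∀ t ∈ Icc (0 : ℝ) 1, HasDerivWithinAt γ (v t (γ t)) (Icc 0 1) t := by
  -- With speed at most `L` and a time interval of length one, a ball of radius `L` around the
  -- initial point already contains the solution.
  have hp : IsPicardLindelof v (⟨0, by simp⟩ : Icc (0 : ℝ) 1) x L 0 L K :=
    { lipschitzOnWith := fun t ht => (hK t ht).lipschitzOnWith
      continuousOn := fun y _ => hc y
      norm_le := fun t ht y _ => hL t ht y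
      mul_max_le := by simp }
  exact hp.exists_eq_forall_mem_Icc_hasDerivWithinAt₀

/-- A linear equation `m' = A(t) m` with continuous coefficients has global solutions on
`[0,1]`. -/
theorem exists_linear_solution {d : ℕ} {A : ℝ → E d →L[ℝ] E d} (hA : ContinuousOn A (Icc 0 1))
    (x : E d) : ∃ m : ℝ → E d, m 0 = x ∧
      ∀ t ∈ Icc (0 : ℝ) 1, HasDerivWithinAt m (A t (m t)) (Icc 0 1) t := by
  obtain ⟨K, hK⟩ := isCompact_Icc.exists_bound_of_continuousOn hA
  have hK0 : 0 ≤ K := (norm_nonneg _).trans (hK 0 (by simp))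
  -- This is Grönwall's a priori bound, which also holds for the clamped equation since clamping
  -- does not increase norms. The clamp therefore never acts on the solution.
  set R : ℝ := ‖x‖ * Real.exp K with hR
  have hR0 : 0 ≤ R := by positivity
  obtain ⟨m, hm0, hm⟩ := exists_solution_of_lipschitz_of_bounded
    (v := fun t y => A t (boxClamp (-R) R y)) (K := K.toNNReal) (L := (K * (d * R)).toNNReal)
    (fun t ht => by
      have h1 : LipschitzWith K.toNNReal (A t) := by
        refine (A t).lipschitz.weaken ?_
        rw [← NNReal.coe_le_coe, coe_nnnorm]
        exact (hK t ht).trans (Real.le_coe_toNNReal K)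
      have h2 := h1.comp (lipschitzWith_boxClamp (-R) R)
      rwa [mul_one] at h2)
    (fun y => hA.clm_apply continuousOn_const)
    (fun t ht y => by
      refine ((A t).le_opNorm _).trans (le_trans ?_ (Real.le_coe_toNNReal _))
      exact mul_le_mul (hK t ht) (norm_boxClamp_le hR0 y) (norm_nonneg _) hK0) x
  have hcl : ∀ y : E d, ‖boxClamp (-R) R y‖ ≤ ‖y‖ := fun y => by
    have h0 : boxClamp (-R) R (0 : E d) = 0 := boxClamp_of_abs_le fun i => by simpa using hR0
    simpa [h0, dist_eq_norm] using (lipschitzWith_boxClamp (d := d) (-R) R).dist_le_mul y 0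
  have hbound : ∀ t ∈ Icc (0 : ℝ) 1, ‖m t‖ ≤ R := by
    intro t ht
    have h := norm_le_gronwallBound_of_norm_deriv_right_le (δ := ‖x‖) (K := K) (ε := 0)
      (fun t ht => (hm t ht).continuousWithinAt)
      (fun t ht => (hm t (Ico_subset_Icc_self ht)).Ici_of_Icc ht) (by rw [hm0])
      (fun t ht => by
        rw [add_zero]
        refine ((A t).le_opNorm _).trans ?_
        exact mul_le_mul (hK t (Ico_subset_Icc_self ht)) (hcl _) (norm_nonneg _) hK0) t ht
    rw [gronwallBound_ε0, sub_zero] at h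
    refine h.trans (mul_le_mul_of_nonneg_left (Real.exp_le_exp.2 ?_) (norm_nonneg x))
    exact mul_le_of_le_one_right hK0 ht.2
  refine ⟨m, hm0, fun t ht => ?_⟩
  have := hm t ht
  rwa [boxClamp_of_abs_le fun i => (abs_apply_le_norm _ i).trans (hbound t ht)] at this

end KRFlow

namespace KRFlow

/-! ### Vector fields tangent to the faces of the cube -/

/-- A `C²` vector field on `[0,1]^d × [0,1]` tangent to the faces of the cube. -/
structure IsTangentField {d : ℕ} (g : E d → ℝ → E d) : Prop where
  contDiffOn : ContDiffOn ℝ 2 (fun z : E d × ℝ => g z.1 z.2) (cube d ×ˢ Icc 0 1)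
  tangent : ∀ x ∈ cube d, ∀ t ∈ Icc (0 : ℝ) 1, ∀ i, x i = 0 ∨ x i = 1 → g x t i = 0

theorem uniqueDiffOn_cylinder (d : ℕ) : UniqueDiffOn ℝ (cube d ×ˢ Icc (0 : ℝ) 1) :=
  (uniqueDiffOn_cube d).prod (uniqueDiffOn_Icc zero_lt_one)

theorem isCompact_cylinder (d : ℕ) : IsCompact (cube d ×ˢ Icc (0 : ℝ) 1) :=
  (isCompact_cube d).prod isCompact_Icc

theorem convex_cylinder (d : ℕ) : Convex ℝ (cube d ×ˢ Icc (0 : ℝ) 1) :=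
  (convex_cube d).prod (convex_Icc 0 1)

/-- The factor `x_j (1 - x_j)` vanishes on the faces. Only this tangency and the `C²` regularity
enter the sequel; the change from the Euclidean to the sup norm on space-time is harmless for both.
-/
theorem InAnsatz.isTangentField {d k : ℕ} {r : ℝ} {g : E d → ℝ → E d} (h : InAnsatz k r g) :
    IsTangentField g where
  contDiffOn := by
    have he : ContDiff ℝ 2 (WithLp.prodContinuousLinearEquiv 2 ℝ (E d) ℝ).symm :=
      (WithLp.prodContinuousLinearEquiv 2 ℝ (E d) ℝ).symm.contDiff
    exact h.contDiffOn.comp he.contDiffOn fun z hz => hz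
  tangent x hx t ht i hi := by
    obtain ⟨b, -, hb⟩ := h.factor
    have := hb (WithLp.toLp 2 (x, t)) ⟨hx, ht⟩ i
    rcases hi with hi | hi <;> simpa [hi] using this

namespace IsTangentField

variable {d : ℕ} {g : E d → ℝ → E d}

theorem continuousOn (h : IsTangentField g) :
    ContinuousOn (fun z : E d × ℝ => g z.1 z.2) (cube d ×ˢ Icc 0 1) :=
  h.contDiffOn.continuousOn

theorem hasFDerivWithinAt (h : IsTangentField g) {x : E d} (hx : x ∈ cube d) {t : ℝ}
    (ht : t ∈ Icc (0 : ℝ) 1) :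
    HasFDerivWithinAt (fun y => g y t)
      ((fderivWithin ℝ (fun z : E d × ℝ => g z.1 z.2) (cube d ×ˢ Icc 0 1) (x, t)).comp
        (ContinuousLinearMap.inl ℝ (E d) ℝ)) (cube d) x := by
  have h1 := (h.contDiffOn.differentiableOn two_ne_zero (x, t) ⟨hx, ht⟩).hasFDerivWithinAt
  exact HasFDerivWithinAt.comp (f := fun y => (y, t)) (t := cube d ×ˢ Icc (0 : ℝ) 1) x h1
    (hasFDerivAt_prodMk_left x t).hasFDerivWithinAt fun y hy => ⟨hy, ht⟩

theorem differentiableOn (h : IsTangentField g) {t : ℝ} (ht : t ∈ Icc (0 : ℝ) 1) :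
    DifferentiableOn ℝ (fun y => g y t) (cube d) := fun _ hx =>
  (h.hasFDerivWithinAt hx ht).differentiableWithinAt

theorem fderivWithin_eq (h : IsTangentField g) {x : E d} (hx : x ∈ cube d) {t : ℝ}
    (ht : t ∈ Icc (0 : ℝ) 1) :
    fderivWithin ℝ (fun y => g y t) (cube d) x =
      (fderivWithin ℝ (fun z : E d × ℝ => g z.1 z.2) (cube d ×ˢ Icc 0 1) (x, t)).comp
        (ContinuousLinearMap.inl ℝ (E d) ℝ) :=
  (h.hasFDerivWithinAt hx ht).fderivWithin (uniqueDiffOn_cube d x hx)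

theorem norm_comp_inl_le {F G H : Type*} [NormedAddCommGroup F] [NormedSpace ℝ F]
    [NormedAddCommGroup G] [NormedSpace ℝ G] [NormedAddCommGroup H] [NormedSpace ℝ H]
    (A : F × G →L[ℝ] H) : ‖A.comp (ContinuousLinearMap.inl ℝ F G)‖ ≤ ‖A‖ :=
  ContinuousLinearMap.opNorm_le_bound _ (norm_nonneg _) fun v => by
    simpa using A.le_opNorm (v, 0)

theorem continuousOn_fderivWithin (h : IsTangentField g) :
    ContinuousOn (fun z : E d × ℝ => fderivWithin ℝ (fun y => g y z.2) (cube d) z.1)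
      (cube d ×ˢ Icc 0 1) := by
  have h1 := h.contDiffOn.continuousOn_fderivWithin (uniqueDiffOn_cylinder d) one_le_two
  exact (h1.clm_comp continuousOn_const).congr fun z hz => h.fderivWithin_eq hz.1 hz.2

theorem exists_norm_fderivWithin_le (h : IsTangentField g) :
    ∃ K : ℝ≥0, ∀ t ∈ Icc (0 : ℝ) 1, ∀ x ∈ cube d,
      ‖fderivWithin ℝ (fun y => g y t) (cube d) x‖ ≤ K := by
  obtain ⟨K, hK⟩ := (isCompact_cylinder d).exists_bound_of_continuousOn h.continuousOn_fderivWithin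
  exact ⟨K.toNNReal, fun t ht x hx => (hK (x, t) ⟨hx, ht⟩).trans (Real.le_coe_toNNReal K)⟩

theorem exists_lipschitzOnWith (h : IsTangentField g) :
    ∃ K : ℝ≥0, ∀ t ∈ Icc (0 : ℝ) 1, LipschitzOnWith K (fun x => g x t) (cube d) := by
  obtain ⟨K, hK⟩ := h.exists_norm_fderivWithin_le
  exact ⟨K, fun t ht => (convex_cube d).lipschitzOnWith_of_nnnorm_fderivWithin_le
    (h.differentiableOn ht) (hK t ht)⟩

/-- This constant depends on `g`. It serves only to show that the flow is differentiable and does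
not reach the final estimate. -/
theorem exists_lipschitzOnWith_fderivWithin (h : IsTangentField g) :
    ∃ K : ℝ≥0, ∀ t ∈ Icc (0 : ℝ) 1,
      LipschitzOnWith K (fderivWithin ℝ (fun y => g y t) (cube d)) (cube d) := by
  obtain ⟨K, hK⟩ := KRFlow.exists_lipschitzOnWith (isCompact_cylinder d) (convex_cylinder d)
    (uniqueDiffOn_cylinder d)
    (h.contDiffOn.fderivWithin (m := 1) (uniqueDiffOn_cylinder d) (by norm_num))
  refine ⟨K, fun t ht => LipschitzOnWith.of_dist_le_mul fun x hx y hy => ?_⟩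
  rw [h.fderivWithin_eq hx ht, h.fderivWithin_eq hy ht, dist_eq_norm,
    ← ContinuousLinearMap.sub_comp]
  refine (norm_comp_inl_le _).trans ?_
  have := hK.dist_le_mul (x, t) ⟨hx, ht⟩ (y, t) ⟨hy, ht⟩
  rwa [dist_eq_norm, Prod.dist_eq, dist_self, max_eq_left dist_nonneg] at this

/-- The time reversal of a tangent field. -/
theorem reverse (h : IsTangentField g) : IsTangentField fun x t => -g x (1 - t) where
  contDiffOn := by
    have h1 : ContDiff ℝ 2 fun z : E d × ℝ => (z.1, 1 - z.2) := by fun_prop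
    refine (h.contDiffOn.comp h1.contDiffOn fun z hz => ⟨hz.1, ?_⟩).neg
    have := hz.2
    constructor <;> linarith [this.1, this.2]
  tangent x hx t ht i hi := by
    have := h.tangent x hx (1 - t) ⟨by linarith [ht.2], by linarith [ht.1]⟩ i hi
    simp [this]

/-- A solution that moves along the clamped field stays in the cube. -/
theorem mem_cube_of_clamped (h : IsTangentField g) {γ : ℝ → E d} (h0 : γ 0 ∈ cube d)
    (hγ : ∀ t ∈ Icc (0 : ℝ) 1, HasDerivWithinAt γ (g (boxClamp 0 1 (γ t)) t) (Icc 0 1) t) :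
    ∀ t ∈ Icc (0 : ℝ) 1, γ t ∈ cube d := by
  have hi : ∀ i, ∀ t ∈ Icc (0 : ℝ) 1,
      HasDerivWithinAt (fun s => γ s i) (g (boxClamp 0 1 (γ t)) t i) (Icc 0 1) t := fun i t ht =>
    ((EuclideanSpace.proj i : E d →L[ℝ] ℝ).hasFDerivAt.comp_hasDerivWithinAt t (hγ t ht))
  intro t ht i
  have hB : ∀ ε : ℝ, ∀ x, HasDerivAt (fun s : ℝ => ε * (1 + s)) ε x := fun ε x => by
    simpa using ((hasDerivAt_id x).const_add 1).const_mul ε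
  constructor
  · refine le_of_forall_pos_le_add fun ε hε => ?_
    -- Comparison with the barrier `ε / 2 * (1 + s)`, of slope `ε / 2 > 0`. When the curve touches
    -- it, the coordinate is nonpositive, so the clamped point lies on a face and the velocity
    -- component is zero, strictly below the slope. The upper face is symmetric.
    have key := image_le_of_deriv_right_lt_deriv_boundary (f := fun s => -γ s i)
      (f' := fun s => -g (boxClamp 0 1 (γ s)) s i) (a := 0) (b := 1)
      (B := fun s => ε / 2 * (1 + s)) (B' := fun _ => ε / 2)
      (fun s hs => (hi i s hs).neg.continuousWithinAt)
      (fun s hs => (hi i s (Ico_subset_Icc_self hs)).neg.Ici_of_Icc hs)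
      (by have := (h0 i).1; norm_num; linarith) (hB _)
      (fun s hs heq => by
        have hs1 : 0 ≤ s := hs.1
        have hneg : γ s i ≤ 0 := by
          have : 0 ≤ ε / 2 * (1 + s) := by positivity
          linarith
        rw [h.tangent _ (boxClamp_mem_cube _) s (Ico_subset_Icc_self hs) i
          (Or.inl (by rw [boxClamp_apply]; exact max_eq_left ((min_le_right _ _).trans hneg)))]
        linarith) ht
    have ht1 : t ≤ 1 := ht.2
    simp only at key
    nlinarith
  · refine le_of_forall_pos_le_add fun ε hε => ?_
    have key := image_le_of_deriv_right_lt_deriv_boundary (f := fun s => γ s i - 1)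
      (f' := fun s => g (boxClamp 0 1 (γ s)) s i) (a := 0) (b := 1)
      (B := fun s => ε / 2 * (1 + s)) (B' := fun _ => ε / 2)
      (fun s hs => ((hi i s hs).sub_const 1).continuousWithinAt)
      (fun s hs => ((hi i s (Ico_subset_Icc_self hs)).sub_const 1).Ici_of_Icc hs)
      (by have := (h0 i).2; norm_num; linarith) (hB _)
      (fun s hs heq => by
        have hs1 : 0 ≤ s := hs.1
        have hpos : 1 ≤ γ s i := by
          have : 0 ≤ ε / 2 * (1 + s) := by positivity
          linarith
        rw [h.tangent _ (boxClamp_mem_cube _) s (Ico_subset_Icc_self hs) i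
          (Or.inr (by rw [boxClamp_apply, min_eq_left hpos]; exact max_eq_right zero_le_one))]
        linarith) ht
    have ht1 : t ≤ 1 := ht.2
    simp only at key
    nlinarith

theorem exists_isSolution (h : IsTangentField g) {x : E d} (hx : x ∈ cube d) :
    ∃ γ, IsSolution g x γ := by
  obtain ⟨K, hK⟩ := h.exists_lipschitzOnWith
  obtain ⟨L, hL⟩ := (isCompact_cylinder d).exists_bound_of_continuousOn h.continuousOn
  obtain ⟨γ, hγ0, hγ⟩ := exists_solution_of_lipschitz_of_bounded
    (v := fun t y => g (boxClamp 0 1 y) t) (K := K) (L := L.toNNReal)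
    (fun t ht => by
      have := (hK t ht).comp (lipschitzWith_boxClamp 0 1).lipschitzOnWith
        (fun y _ => boxClamp_mem_cube y : MapsTo _ univ _)
      rw [lipschitzOnWith_univ, mul_one] at this
      exact this)
    (fun y => h.continuousOn.comp (f := fun t => (boxClamp 0 1 y, t)) (by fun_prop)
      fun t ht => ⟨boxClamp_mem_cube y, ht⟩)
    (fun t ht y => (hL (boxClamp 0 1 y, t) ⟨boxClamp_mem_cube y, ht⟩).trans
      (Real.le_coe_toNNReal L)) x
  have hmem := h.mem_cube_of_clamped (hγ0 ▸ hx) hγ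
  refine ⟨γ, hγ0, hmem, fun t ht => ?_⟩
  have := hγ t ht
  rwa [boxClamp_of_mem_cube (hmem t ht)] at this

theorem wellPosed (h : IsTangentField g) : WellPosed g := by
  obtain ⟨K, hK⟩ := h.exists_lipschitzOnWith
  exact wellPosed_of_isSolution h.continuousOn hK fun x hx => h.exists_isSolution hx

theorem isSolution_flowMap (h : IsTangentField g) {x : E d} (hx : x ∈ cube d) :
    IsSolution g x (flowMap g x) :=
  (h.wellPosed.isTrajectory_flowMap hx).isSolution h.continuousOn

/-- Surjectivity by time reversal: the reversed field is again tangent, and its trajectory from `z`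
ends at a preimage of `z`. The density of the pushforward on the whole cube can then be computed by
change of variables. -/
theorem bijOn_flowMap (h : IsTangentField g) :
    BijOn (fun x => flowMap g x 1) (cube d) (cube d) := by
  obtain ⟨K, hK⟩ := h.exists_lipschitzOnWith
  refine ⟨fun x hx => (h.isSolution_flowMap hx).mem_cube 1 (by simp), fun x hx y hy hxy => ?_,
    fun z hz => ?_⟩
  · have h1 := h.isSolution_flowMap hx
    have h2 := h.isSolution_flowMap hy
    have := h1.eqOn_of_eq_at_one hK h2 hxy (show (0 : ℝ) ∈ Icc (0 : ℝ) 1 by simp)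
    rwa [h1.initial, h2.initial] at this
  · obtain ⟨η, hη⟩ := h.reverse.exists_isSolution hz
    have hrev : MapsTo (fun t : ℝ => 1 - t) (Icc 0 1) (Icc 0 1) := fun t ht =>
      ⟨by linarith [ht.2], by linarith [ht.1]⟩
    have h1 : IsSolution g (η 1) fun t => η (1 - t) :=
      { initial := by simp
        mem_cube := fun t ht => hη.mem_cube _ (hrev ht)
        hasDerivWithinAt := fun t ht => by
          have := (hη.hasDerivWithinAt _ (hrev ht)).scomp t
            (((hasDerivAt_id t).const_sub 1).hasDerivWithinAt (s := Icc 0 1)) hrev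
          simpa [Function.comp_def] using this }
    have hm : η 1 ∈ cube d := hη.mem_cube 1 (by simp)
    refine ⟨η 1, hm, ?_⟩
    have := (h.isSolution_flowMap hm).eqOn hK h1 (show (1 : ℝ) ∈ Icc (0 : ℝ) 1 by simp)
    simpa [hη.initial] using this

end IsTangentField

end KRFlow

namespace KRFlow

/-! ### Matrices of linear maps, trace and determinant -/

/-- The matrix of a linear endomorphism of `ℝ^d` in the standard basis. -/
noncomputable def jac {d : ℕ} (A : E d →L[ℝ] E d) : Matrix (Fin d) (Fin d) ℝ :=
  Matrix.of fun i j => A (EuclideanSpace.single j 1) i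

theorem jac_apply {d : ℕ} (A : E d →L[ℝ] E d) (i j : Fin d) :
    jac A i j = A (EuclideanSpace.single j 1) i := rfl

theorem apply_eq_sum_jac {d : ℕ} (A : E d →L[ℝ] E d) (v : E d) (i : Fin d) :
    A v i = ∑ j, jac A i j * v j := by
  conv_lhs => rw [← sum_smul_single v, map_sum]
  simp [jac_apply, mul_comm]

theorem jac_comp {d : ℕ} (A B : E d →L[ℝ] E d) : jac (A.comp B) = jac A * jac B := by
  ext i j
  rw [jac_apply, ContinuousLinearMap.comp_apply, apply_eq_sum_jac, Matrix.mul_apply]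
  rfl

theorem jac_sub {d : ℕ} (A B : E d →L[ℝ] E d) : jac (A - B) = jac A - jac B := rfl

theorem jac_id {d : ℕ} : jac (ContinuousLinearMap.id ℝ (E d)) = 1 := by
  ext i j
  simp [jac_apply, Matrix.one_apply]

theorem det_jac {d : ℕ} (A : E d →L[ℝ] E d) : (jac A).det = A.det := by
  have h : jac A = LinearMap.toMatrix (EuclideanSpace.basisFun (Fin d) ℝ).toBasis
      (EuclideanSpace.basisFun (Fin d) ℝ).toBasis (A : E d →ₗ[ℝ] E d) := by
    ext i j
    simp [jac_apply, LinearMap.toMatrix_apply]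
  rw [h, LinearMap.det_toMatrix]

theorem abs_jac_le {d : ℕ} (A : E d →L[ℝ] E d) (i j : Fin d) : |jac A i j| ≤ ‖A‖ := by
  rw [jac_apply]
  refine (abs_apply_le_norm _ i).trans ((A.le_opNorm _).trans_eq ?_)
  simp

theorem abs_trace_jac_le {d : ℕ} (A : E d →L[ℝ] E d) : |(jac A).trace| ≤ d * ‖A‖ := by
  rw [Matrix.trace]
  refine (Finset.abs_sum_le_sum_abs _ _).trans
    ((Finset.sum_le_sum fun i _ => abs_jac_le A i i).trans_eq ?_)
  simp

/-- By Cramer's rule the `k`-th summand is the `k`-th diagonal entry of `adj M * A * M`, and the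
trace is cyclic. This is Jacobi's formula in a form needing no invertibility of `M`. -/
theorem _root_.Matrix.sum_det_updateCol_mul {n : Type*} [Fintype n] [DecidableEq n]
    {R : Type*} [CommRing R] (A M : Matrix n n R) :
    ∑ k, (M.updateCol k fun i => (A * M) i k).det = A.trace * M.det := by
  have h : ∀ k, (M.updateCol k fun i => (A * M) i k).det = (M.adjugate * (A * M)) k k := by
    intro k
    rw [← Matrix.cramer_apply, Matrix.cramer_eq_adjugate_mulVec]
    rfl
  simp_rw [h]
  change (M.adjugate * (A * M)).trace = _
  rw [Matrix.trace_mul_comm, Matrix.mul_assoc, Matrix.mul_adjugate, Matrix.mul_smul,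
    Matrix.trace_smul, mul_one, smul_eq_mul, mul_comm]

theorem _root_.Matrix.hasDerivWithinAt_det {n : Type*} [Fintype n] [DecidableEq n]
    {M : ℝ → Matrix n n ℝ} {M' : Matrix n n ℝ} {S : Set ℝ} {t : ℝ}
    (h : ∀ i j, HasDerivWithinAt (fun s => M s i j) (M' i j) S t) :
    HasDerivWithinAt (fun s => (M s).det)
      (∑ k, ((M t).updateCol k fun i => M' i k).det) S t := by
  have h1 : ∀ σ : Equiv.Perm n, HasDerivWithinAt (fun s => ∏ i, M s (σ i) i)
      (∑ k, ∏ i, ((M t).updateCol k fun i => M' i k) (σ i) i) S t := by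
    intro σ
    have h2 := HasDerivWithinAt.fun_finsetProd (u := Finset.univ) (f := fun i s => M s (σ i) i)
      fun i _ => h (σ i) i
    refine h2.congr_deriv (Finset.sum_congr rfl fun k _ => ?_)
    rw [← Finset.mul_prod_erase Finset.univ _ (Finset.mem_univ k), mul_comm, smul_eq_mul]
    simp only [Matrix.updateCol_self]
    congr 1
    refine Finset.prod_congr rfl fun i hi => ?_
    rw [Matrix.updateCol_ne (Finset.ne_of_mem_erase hi)]
  simp_rw [Matrix.det_apply]
  rw [Finset.sum_comm]
  simp_rw [← Finset.smul_sum]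
  exact HasDerivWithinAt.fun_sum fun σ _ => (h1 σ).const_smul (Equiv.Perm.sign σ)

/-! ### The variational equation -/

/-- The columns are the solutions started from the basis vectors. -/
theorem exists_fundamental_solution {d : ℕ} {A : ℝ → E d →L[ℝ] E d}
    (hA : ContinuousOn A (Icc 0 1)) :
    ∃ M : ℝ → E d →L[ℝ] E d, M 0 = ContinuousLinearMap.id ℝ (E d) ∧
      ∀ t ∈ Icc (0 : ℝ) 1, HasDerivWithinAt M ((A t).comp (M t)) (Icc 0 1) t := by
  choose m hm0 hm using fun j : Fin d => exists_linear_solution hA (EuclideanSpace.single j 1)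
  refine ⟨fun t => ∑ j, (EuclideanSpace.proj j : E d →L[ℝ] ℝ).smulRight (m j t), ?_,
    fun t ht => ?_⟩
  · ext v i
    simp [hm0, Pi.single_apply]
  · have h1 : ∀ j ∈ (Finset.univ : Finset (Fin d)), HasDerivWithinAt
        (fun t => (EuclideanSpace.proj j : E d →L[ℝ] ℝ).smulRight (m j t))
        ((EuclideanSpace.proj j : E d →L[ℝ] ℝ).smulRight (A t (m j t))) (Icc 0 1) t := fun j _ =>
      (ContinuousLinearMap.smulRightL ℝ (E d) (E d)
        (EuclideanSpace.proj j : E d →L[ℝ] ℝ)).hasFDerivAt.comp_hasDerivWithinAt t (hm j t ht)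
    refine (HasDerivWithinAt.fun_sum h1).congr_deriv ?_
    ext v i
    simp

/-- The upper bound is Grönwall's inequality; the lower one is the same bound for `t ↦ u (1 - t)`.
No sign information on `u` is needed. -/
theorem abs_bounds_of_hasDerivWithinAt {u a : ℝ → ℝ} {η : ℝ}
    (hu : ∀ t ∈ Icc (0 : ℝ) 1, HasDerivWithinAt u (a t * u t) (Icc 0 1) t)
    (ha : ∀ t ∈ Icc (0 : ℝ) 1, |a t| ≤ η) :
    |u 0| * Real.exp (-η) ≤ |u 1| ∧ |u 1| ≤ |u 0| * Real.exp η := by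
  have key : ∀ {u a : ℝ → ℝ},
      (∀ t ∈ Icc (0 : ℝ) 1, HasDerivWithinAt u (a t * u t) (Icc 0 1) t) →
      (∀ t ∈ Icc (0 : ℝ) 1, |a t| ≤ η) → |u 1| ≤ |u 0| * Real.exp η := by
    intro u a hu ha
    have h := norm_le_gronwallBound_of_norm_deriv_right_le (δ := |u 0|) (K := η) (ε := 0)
      (fun t ht => (hu t ht).continuousWithinAt)
      (fun t ht => (hu t (Ico_subset_Icc_self ht)).Ici_of_Icc ht) le_rfl
      (fun t ht => by
        rw [add_zero, norm_mul]
        exact mul_le_mul_of_nonneg_right (ha t (Ico_subset_Icc_self ht)) (norm_nonneg _))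
      1 (by simp)
    rwa [gronwallBound_ε0, sub_zero, mul_one] at h
  refine ⟨?_, key hu ha⟩
  have hrev : MapsTo (fun t : ℝ => 1 - t) (Icc 0 1) (Icc 0 1) := fun t ht =>
    ⟨by linarith [ht.2], by linarith [ht.1]⟩
  have h := key (u := fun t => u (1 - t)) (a := fun t => -a (1 - t))
    (fun t ht => by
      have := (hu _ (hrev ht)).scomp t
        (((hasDerivAt_id t).const_sub 1).hasDerivWithinAt (s := Icc 0 1)) hrev
      simpa [Function.comp_def] using this)
    fun t ht => by simpa using ha _ (hrev ht)
  simp only [sub_self, sub_zero] at h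
  rw [Real.exp_neg, ← div_eq_mul_inv, div_le_iff₀ (Real.exp_pos _)]
  exact h

/-- For zero initial error the Grönwall bound is linear in the defect `ε`, without a separate case
`K = 0`. -/
theorem gronwallBound_zero_le {K ε t : ℝ} (hK : 0 ≤ K) (hε : 0 ≤ ε) (ht : t ∈ Icc (0 : ℝ) 1) :
    gronwallBound 0 K ε t ≤ ε * Real.exp K := by
  rcases hK.eq_or_lt with rfl | hpos
  · simpa [gronwallBound_K0] using mul_le_of_le_one_right hε ht.2
  · have h1 : Real.exp K - 1 ≤ K * Real.exp K := by
      have h2 := Real.add_one_le_exp (-K)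
      have h3 : Real.exp (-K) * Real.exp K = 1 := by rw [← Real.exp_add]; simp
      nlinarith [Real.exp_pos K]
    have h4 : Real.exp (K * t) ≤ Real.exp K := Real.exp_le_exp.2 (mul_le_of_le_one_right hK ht.2)
    simp only [gronwallBound_of_K_ne_0 hpos.ne']
    rw [zero_mul, zero_add, div_mul_eq_mul_div, div_le_iff₀ hpos]
    nlinarith

/-- The time-one flow map of a tangent field is differentiable, with Jacobian determinant
controlled by the divergence along the trajectory (Liouville's formula). -/
theorem IsTangentField.exists_hasFDerivWithinAt_flowMap {d : ℕ} {g : E d → ℝ → E d}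
    (h : IsTangentField g) {x : E d} (hx : x ∈ cube d) :
    ∃ M : E d →L[ℝ] E d, HasFDerivWithinAt (fun y => flowMap g y 1) M (cube d) x ∧
      ∀ (Λ θ : ℝ → ℝ) (η : ℝ), (∀ t ∈ Icc (0 : ℝ) 1, HasDerivWithinAt Λ (θ t) (Icc 0 1) t) →
        (∀ t ∈ Icc (0 : ℝ) 1,
          |(jac (fderivWithin ℝ (fun y => g y t) (cube d) (flowMap g x t))).trace - θ t| ≤ η) →
        Real.exp (Λ 1 - Λ 0 - η) ≤ |M.det| ∧ |M.det| ≤ Real.exp (Λ 1 - Λ 0 + η) := by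
  have hγ := h.isSolution_flowMap hx
  set A : ℝ → E d →L[ℝ] E d := fun t =>
    fderivWithin ℝ (fun y => g y t) (cube d) (flowMap g x t) with hAdef
  have hA : ContinuousOn A (Icc 0 1) :=
    h.continuousOn_fderivWithin.comp (f := fun t => (flowMap g x t, t))
      (hγ.continuousOn.prodMk continuousOn_id) fun t ht => ⟨hγ.mem_cube t ht, ht⟩
  obtain ⟨M, hM0, hM⟩ := exists_fundamental_solution hA
  obtain ⟨K, hK⟩ := h.exists_norm_fderivWithin_le
  have hlip : ∀ t ∈ Icc (0 : ℝ) 1, LipschitzOnWith K (fun x => g x t) (cube d) := fun t ht =>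
    (convex_cube d).lipschitzOnWith_of_nnnorm_fderivWithin_le (h.differentiableOn ht) (hK t ht)
  obtain ⟨K₂, hK₂⟩ := h.exists_lipschitzOnWith_fderivWithin
  refine ⟨M 1, ?_, fun Λ θ η hΛ hη => ?_⟩
  · have hflow : ∀ y ∈ cube d, ∀ t ∈ Icc (0 : ℝ) 1,
        ‖flowMap g y t - flowMap g x t‖ ≤ Real.exp K * ‖y - x‖ := by
      intro y hy t ht
      have hy' := h.isSolution_flowMap hy
      have := dist_le_of_trajectories_ODE_of_mem (v := fun t x => g x t) (s := fun _ => cube d)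
        (fun t ht => hlip t (Ico_subset_Icc_self ht)) hy'.continuousOn
        (fun t ht => (hy'.hasDerivWithinAt t (Ico_subset_Icc_self ht)).Ici_of_Icc ht)
        (fun t ht => hy'.mem_cube t (Ico_subset_Icc_self ht)) hγ.continuousOn
        (fun t ht => (hγ.hasDerivWithinAt t (Ico_subset_Icc_self ht)).Ici_of_Icc ht)
        (fun t ht => hγ.mem_cube t (Ico_subset_Icc_self ht))
        (le_of_eq (by rw [hy'.initial, hγ.initial])) t ht
      rw [dist_eq_norm, sub_zero, dist_eq_norm, mul_comm] at this
      refine this.trans (mul_le_mul_of_nonneg_right (Real.exp_le_exp.2 ?_) (norm_nonneg _))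
      exact mul_le_of_le_one_right K.2 ht.2
    set c : ℝ := K₂ * Real.exp K * Real.exp K with hc
    -- The remainder `w = X(y) - X(x) - M (y - x)` solves `w' = A w` plus the first-order Taylor
    -- error of `g`, which is `O(‖y - x‖²)` by `hflow`. It starts at zero, so Grönwall keeps it
    -- quadratic.
    have hquad : ∀ y ∈ cube d, ‖flowMap g y 1 - flowMap g x 1 - M 1 (y - x)‖ ≤
        c * Real.exp K * (‖y - x‖ * ‖y - x‖) := by
      intro y hy
      have hy' := h.isSolution_flowMap hy
      have hw : ∀ t ∈ Icc (0 : ℝ) 1, HasDerivWithinAt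
          (fun t => flowMap g y t - flowMap g x t - M t (y - x))
          (g (flowMap g y t) t - g (flowMap g x t) t - A t (M t (y - x))) (Icc 0 1) t :=
        fun t ht => ((hy'.hasDerivWithinAt t ht).sub (hγ.hasDerivWithinAt t ht)).sub <| by
          simpa using (hM t ht).clm_apply (hasDerivWithinAt_const t (Icc (0 : ℝ) 1) (y - x))
      have hg := norm_le_gronwallBound_of_norm_deriv_right_le (δ := 0) (K := K)
        (ε := c * (‖y - x‖ * ‖y - x‖))
        (fun t ht => (hw t ht).continuousWithinAt)
        (fun t ht => (hw t (Ico_subset_Icc_self ht)).Ici_of_Icc ht)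
        (by simp [hy'.initial, hγ.initial, hM0])
        (fun t ht => by
          have ht' := Ico_subset_Icc_self ht
          have e : g (flowMap g y t) t - g (flowMap g x t) t - A t (M t (y - x)) =
              (g (flowMap g y t) t - g (flowMap g x t) t
                - A t (flowMap g y t - flowMap g x t)) +
              A t (flowMap g y t - flowMap g x t - M t (y - x)) := by
            rw [map_sub (A t) (flowMap g y t - flowMap g x t)]; abel
          rw [e]
          refine (norm_add_le _ _).trans ?_
          have h1 := norm_sub_sub_fderivWithin_le (convex_cube d) (h.differentiableOn ht')
            (hK₂ t ht') (hγ.mem_cube t ht') (hy'.mem_cube t ht')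
          have h2 := (A t).le_of_opNorm_le (hK t ht' _ (hγ.mem_cube t ht'))
            (flowMap g y t - flowMap g x t - M t (y - x))
          have h3 := hflow y hy t ht'
          have h4 : (K₂ : ℝ) * ‖flowMap g y t - flowMap g x t‖ * ‖flowMap g y t - flowMap g x t‖ ≤
              K₂ * (Real.exp K * ‖y - x‖) * (Real.exp K * ‖y - x‖) := by gcongr
          have h5 : K₂ * (Real.exp K * ‖y - x‖) * (Real.exp K * ‖y - x‖) =
              c * (‖y - x‖ * ‖y - x‖) := by rw [hc]; ring
          linarith) 1 (by simp)
      refine hg.trans ?_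
      rw [sub_zero]
      have := gronwallBound_zero_le K.coe_nonneg (ε := c * (‖y - x‖ * ‖y - x‖)) (by positivity)
        (show (1 : ℝ) ∈ Icc (0 : ℝ) 1 by simp)
      refine this.trans_eq (by ring)
    exact hasFDerivWithinAt_of_norm_sub_sub_le hquad
  · have hdet : ∀ t ∈ Icc (0 : ℝ) 1, HasDerivWithinAt (fun s => (jac (M s)).det)
        ((jac (A t)).trace * (jac (M t)).det) (Icc 0 1) t := by
      intro t ht
      rw [← Matrix.sum_det_updateCol_mul, ← jac_comp]
      refine Matrix.hasDerivWithinAt_det fun i j => ?_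
      have h1 := (hM t ht).clm_apply (hasDerivWithinAt_const t (Icc (0 : ℝ) 1)
        (EuclideanSpace.single j (1 : ℝ)))
      have h2 := (EuclideanSpace.proj i : E d →L[ℝ] ℝ).hasFDerivAt.comp_hasDerivWithinAt t h1
      simpa [jac_apply, Function.comp_def] using h2
    -- Integrating factor: dividing the determinant by `exp (Λ - Λ 0)` replaces its growth rate, the
    -- trace, by trace minus `θ`, of size at most `η`. A reference evolution can thus be compared
    -- with directly, without integrating the divergence.
    have hu : ∀ t ∈ Icc (0 : ℝ) 1, HasDerivWithinAt
        (fun s => (jac (M s)).det * Real.exp (-(Λ s - Λ 0)))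
        (((jac (A t)).trace - θ t) * ((jac (M t)).det * Real.exp (-(Λ t - Λ 0))))
        (Icc 0 1) t := by
      intro t ht
      have := (hdet t ht).mul ((hΛ t ht).sub_const (Λ 0)).neg.exp
      refine this.congr_deriv ?_
      simp only [Pi.neg_apply]
      ring
    obtain ⟨h1, h2⟩ := abs_bounds_of_hasDerivWithinAt hu hη
    have h0 : |(jac (M 0)).det * Real.exp (-(Λ 0 - Λ 0))| = 1 := by simp [hM0, jac_id]
    rw [h0, one_mul, abs_mul, Real.abs_exp, det_jac, Real.exp_neg (Λ 1 - Λ 0),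
      ← div_eq_mul_inv] at h1 h2
    rw [le_div_iff₀ (Real.exp_pos _), ← Real.exp_add] at h1
    rw [div_le_iff₀ (Real.exp_pos _), ← Real.exp_add] at h2
    rw [show Λ 1 - Λ 0 - η = -η + (Λ 1 - Λ 0) by ring, add_comm (Λ 1 - Λ 0) η]
    exact ⟨h1, h2⟩

end KRFlow

namespace KRFlow

/-! ### Splicing of coordinates and forward substitution. -/

theorem splice_apply {d : ℕ} (k : ℕ) (x t : E d) (i : Fin d) :
    splice k x t i = if (i : ℕ) < k then x i else t i := rfl

theorem splice_mem_cube {d : ℕ} (k : ℕ) {x t : E d} (hx : x ∈ cube d) (ht : t ∈ cube d) :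
    splice k x t ∈ cube d := fun i => by
  rw [splice_apply]
  split_ifs
  exacts [hx i, ht i]

theorem contDiffOn_one_of_hasFDerivWithinAt {X Y : Type*} [NormedAddCommGroup X]
    [NormedSpace ℝ X] [NormedAddCommGroup Y] [NormedSpace ℝ Y] {S : Set X}
    (hu : UniqueDiffOn ℝ S) {f : X → Y} {f' : X → X →L[ℝ] Y}
    (h : ∀ x ∈ S, HasFDerivWithinAt f (f' x) S x) (hc : ContinuousOn f' S) :
    ContDiffOn ℝ 1 f S := by
  rw [show (1 : WithTop ℕ∞) = 0 + 1 by norm_num, contDiffOn_succ_iff_fderivWithin hu]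
  refine ⟨fun x hx => (h x hx).differentiableWithinAt, by simp, ?_⟩
  rw [contDiffOn_zero]
  exact hc.congr fun x hx => (h x hx).fderivWithin (hu x hx)

/-- Forward substitution: a quantitative estimate for triangular systems. -/
theorem exists_forward_substitution (d : ℕ) {c : ℝ} (hc : 0 < c) {K : ℝ} (hK : 0 ≤ K) :
    ∃ A : ℝ, 0 ≤ A ∧ ∀ (v : E d) (N : ℝ), 0 ≤ N →
      (∀ i : Fin d, c * |v i| ≤ N + K * ‖splice i v 0‖) → ‖v‖ ≤ A * N := by
  have key : ∀ k : ℕ, ∃ A : ℝ, 0 ≤ A ∧ ∀ (v : E d) (N : ℝ), 0 ≤ N →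
      (∀ i : Fin d, c * |v i| ≤ N + K * ‖splice i v 0‖) →
        ∀ i : Fin d, (i : ℕ) < k → |v i| ≤ A * N := by
    intro k
    induction k with
    | zero => exact ⟨0, le_rfl, fun v N _ _ i hi => absurd hi (Nat.not_lt_zero _)⟩
    | succ k ih =>
      obtain ⟨A, hA0, hA⟩ := ih
      -- The second entry bounds the new coordinate: the earlier ones are at most `A * N` each, so
      -- the spliced vector has norm at most `d * (A * N)`.
      refine ⟨max A ((1 + K * (d * A)) / c), le_max_of_le_left hA0, fun v N hN h i hi => ?_⟩
      rcases Nat.lt_succ_iff_lt_or_eq.1 hi with hlt | heq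
      · exact (hA v N hN h i hlt).trans (mul_le_mul_of_nonneg_right (le_max_left _ _) hN)
      · refine le_trans ?_ (mul_le_mul_of_nonneg_right (le_max_right _ _) hN)
        rw [div_mul_eq_mul_div, le_div_iff₀ hc, mul_comm]
        refine (h i).trans ?_
        have h1 : ‖splice (i : ℕ) v 0‖ ≤ d * (A * N) := by
          refine norm_le_of_abs_apply_le fun j => ?_
          rw [splice_apply]
          split_ifs with hj
          · exact hA v N hN h j (by omega)
          · simpa using mul_nonneg hA0 hN
        nlinarith
  obtain ⟨A, hA0, hA⟩ := key d
  refine ⟨d * A, by positivity, fun v N hN h => ?_⟩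
  have := norm_le_of_abs_apply_le fun i => hA v N hN h i i.2
  rwa [← mul_assoc] at this

/-! ### Triangular maps of the cube -/

/-- A triangular `C¹` map of the cube that preserves its faces, with derivative bounded by `K`
and diagonal of the derivative bounded below by `c > 0`. -/
structure IsTriangular {d : ℕ} (c K : ℝ) (S : E d → E d) : Prop where
  pos : 0 < c
  contDiffOn : ContDiffOn ℝ 1 S (cube d)
  norm_le : ∀ x ∈ cube d, ‖fderivWithin ℝ S (cube d) x‖ ≤ K
  congr : ∀ x ∈ cube d, ∀ y ∈ cube d, ∀ i, (∀ j ≤ i, x j = y j) → S x i = S y i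
  zero : ∀ x ∈ cube d, ∀ i, x i = 0 → S x i = 0
  one : ∀ x ∈ cube d, ∀ i, x i = 1 → S x i = 1
  le_diag : ∀ x ∈ cube d, ∀ i, c ≤ jac (fderivWithin ℝ S (cube d) x) i i

namespace IsTriangular

variable {d : ℕ} {c K : ℝ} {S : E d → E d}

theorem nonneg (h : IsTriangular c K S) : 0 ≤ K :=
  (norm_nonneg _).trans (h.norm_le 0 (zero_mem_cube d))

theorem differentiableOn (h : IsTriangular c K S) : DifferentiableOn ℝ S (cube d) :=
  h.contDiffOn.differentiableOn one_ne_zero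

theorem hasFDerivWithinAt (h : IsTriangular c K S) {x : E d} (hx : x ∈ cube d) :
    HasFDerivWithinAt S (fderivWithin ℝ S (cube d) x) (cube d) x :=
  (h.differentiableOn x hx).hasFDerivWithinAt

theorem continuousOn_fderivWithin (h : IsTriangular c K S) :
    ContinuousOn (fderivWithin ℝ S (cube d)) (cube d) :=
  h.contDiffOn.continuousOn_fderivWithin (uniqueDiffOn_cube d) le_rfl

theorem norm_sub_le (h : IsTriangular c K S) {x y : E d} (hx : x ∈ cube d) (hy : y ∈ cube d) :
    ‖S x - S y‖ ≤ K * ‖x - y‖ :=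
  (convex_cube d).norm_image_sub_le_of_norm_fderivWithin_le h.differentiableOn
    (fun z hz => h.norm_le z hz) hy hx

theorem hasDerivWithinAt_setCoord {f : E d → E d} (hf : DifferentiableOn ℝ f (cube d))
    {x : E d} (hx : x ∈ cube d) (i j : Fin d) {s : ℝ} (hs : s ∈ Icc (0 : ℝ) 1) :
    HasDerivWithinAt (fun s => f (setCoord x j s) i)
      (jac (fderivWithin ℝ f (cube d) (setCoord x j s)) i j) (Icc 0 1) s := by
  have h1 := ((hf _ (setCoord_mem_cube hx j hs)).hasFDerivWithinAt).comp_hasDerivWithinAt s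
    (hasDerivAt_setCoord x j s).hasDerivWithinAt fun t ht => setCoord_mem_cube hx j ht
  exact (EuclideanSpace.proj i : E d →L[ℝ] ℝ).hasFDerivAt.comp_hasDerivWithinAt s h1

theorem jac_eq_of_hasDerivWithinAt {f : E d → E d} (hf : DifferentiableOn ℝ f (cube d))
    {x : E d} (hx : x ∈ cube d) (i j : Fin d) {a : ℝ}
    (h : HasDerivWithinAt (fun s => f (setCoord x j s) i) a (Icc 0 1) (x j)) :
    jac (fderivWithin ℝ f (cube d) x) i j = a := by
  have h1 := hasDerivWithinAt_setCoord hf hx i j (hx j)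
  rw [setCoord_eq] at h1
  exact (uniqueDiffOn_Icc zero_lt_one (x j) (hx j)).eq_deriv _ h1 h

theorem jac_eq_zero (h : IsTriangular c K S) {x : E d} (hx : x ∈ cube d) {i j : Fin d}
    (hij : i < j) : jac (fderivWithin ℝ S (cube d) x) i j = 0 := by
  refine jac_eq_of_hasDerivWithinAt h.differentiableOn hx i j ?_
  refine (hasDerivWithinAt_const (x j) (Icc (0 : ℝ) 1) (S x i)).congr (fun s hs => ?_) ?_
  · refine h.congr _ (setCoord_mem_cube hx j hs) _ hx _ fun l hl => setCoord_of_ne _ ?_ _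
    exact (hl.trans_lt hij).ne
  · rw [setCoord_eq]

theorem isLowerTriangular_jac (h : IsTriangular c K S) {x : E d} (hx : x ∈ cube d) :
    (jac (fderivWithin ℝ S (cube d) x)).IsLowerTriangular := fun _ _ hij =>
  h.jac_eq_zero hx hij

theorem det_eq (h : IsTriangular c K S) {x : E d} (hx : x ∈ cube d) :
    (fderivWithin ℝ S (cube d) x).det = ∏ i, jac (fderivWithin ℝ S (cube d) x) i i := by
  rw [← det_jac, Matrix.det_of_isLowerTriangular _ (h.isLowerTriangular_jac hx)]

theorem det_pos (h : IsTriangular c K S) {x : E d} (hx : x ∈ cube d) :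
    0 < (fderivWithin ℝ S (cube d) x).det := by
  rw [h.det_eq hx]
  exact Finset.prod_pos fun i _ => h.pos.trans_le (h.le_diag x hx i)

theorem mul_sub_le (h : IsTriangular c K S) {x : E d} (hx : x ∈ cube d) (i : Fin d) {s t : ℝ}
    (hs : s ∈ Icc (0 : ℝ) 1) (ht : t ∈ Icc (0 : ℝ) 1) (hst : s ≤ t) :
    c * (t - s) ≤ S (setCoord x i t) i - S (setCoord x i s) i := by
  have hd : ∀ s ∈ Icc (0 : ℝ) 1, HasDerivWithinAt (fun s => S (setCoord x i s) i)
      (jac (fderivWithin ℝ S (cube d) (setCoord x i s)) i i) (Icc 0 1) s := fun s hs =>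
    hasDerivWithinAt_setCoord h.differentiableOn hx i i hs
  have hd' : ∀ s ∈ interior (Icc (0 : ℝ) 1), HasDerivAt (fun s => S (setCoord x i s) i)
      (jac (fderivWithin ℝ S (cube d) (setCoord x i s)) i i) s := fun s hs =>
    (hd s (interior_subset hs)).hasDerivAt (mem_interior_iff_mem_nhds.1 hs)
  refine (convex_Icc (0 : ℝ) 1).mul_sub_le_image_sub_of_le_deriv
    (fun s hs => (hd s hs).continuousWithinAt)
    (fun s hs => (hd' s hs).differentiableAt.differentiableWithinAt) (fun s hs => ?_)
    s hs t ht hst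
  rw [(hd' s hs).deriv]
  exact h.le_diag _ (setCoord_mem_cube hx i (interior_subset hs)) i

theorem mul_abs_sub_le (h : IsTriangular c K S) {x : E d} (hx : x ∈ cube d) (i : Fin d) {s t : ℝ}
    (hs : s ∈ Icc (0 : ℝ) 1) (ht : t ∈ Icc (0 : ℝ) 1) :
    c * |t - s| ≤ |S (setCoord x i t) i - S (setCoord x i s) i| := by
  rcases le_total s t with hst | hst
  · rw [abs_of_nonneg (sub_nonneg.2 hst)]
    exact (h.mul_sub_le hx i hs ht hst).trans (le_abs_self _)
  · rw [abs_sub_comm, abs_sub_comm (S _ i), abs_of_nonneg (sub_nonneg.2 hst)]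
    exact (h.mul_sub_le hx i ht hs hst).trans (le_abs_self _)

/-- Each component is increasing in its own coordinate and takes the values 0 and 1 at the ends. -/
theorem mapsTo (h : IsTriangular c K S) : MapsTo S (cube d) (cube d) := by
  intro x hx i
  have h0 : S (setCoord x i 0) i = 0 :=
    h.zero _ (setCoord_mem_cube hx i (by simp)) i (setCoord_self x i 0)
  have h1 : S (setCoord x i 1) i = 1 :=
    h.one _ (setCoord_mem_cube hx i (by simp)) i (setCoord_self x i 1)
  have h2 := h.mul_sub_le hx i (s := 0) (by simp) (hx i) (hx i).1
  have h3 := h.mul_sub_le hx i (t := 1) (hx i) (by simp) (hx i).2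
  rw [setCoord_eq] at h2 h3
  have h4 := mul_nonneg h.pos.le (sub_nonneg.2 (hx i).1)
  have h5 := mul_nonneg h.pos.le (sub_nonneg.2 (hx i).2)
  constructor <;> linarith

/-- The basic comparison estimate for one coordinate. -/
theorem mul_abs_apply_sub_le (h : IsTriangular c K S) {x y : E d} (hx : x ∈ cube d)
    (hy : y ∈ cube d) (i : Fin d) :
    c * |x i - y i| ≤ |S x i - S y i| + |S (splice i x y) i - S y i| := by
  have h1 := h.mul_abs_sub_le hx i (hy i) (hx i)
  rw [setCoord_eq] at h1
  have h2 : S (setCoord x i (y i)) i = S (splice i x y) i := by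
    refine h.congr _ (setCoord_mem_cube hx i (hy i)) _ (splice_mem_cube i hx hy) i fun j hj => ?_
    rw [setCoord_apply, splice_apply]
    rcases hj.eq_or_lt with rfl | hlt
    · simp
    · rw [if_neg hlt.ne, if_pos (show (j : ℕ) < i from hlt)]
  rw [h2] at h1
  refine h1.trans ?_
  rw [abs_sub_comm (S (splice i x y) i)]
  exact abs_sub_le _ _ _

/-- Strong induction: once the earlier coordinates agree, splicing does not change the `i`-th
component, and the comparison estimate leaves only `|S x i - S y i| = 0`. Stated coordinate by
coordinate, it also shows that the inverse is triangular. -/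
theorem eq_of_apply_eq (h : IsTriangular c K S) {x y : E d} (hx : x ∈ cube d) (hy : y ∈ cube d)
    (i : Fin d) (hxy : ∀ j ≤ i, S x j = S y j) : x i = y i := by
  induction i using WellFoundedLT.induction with
  | ind i ih =>
    have h1 := h.mul_abs_apply_sub_le hx hy i
    have h2 : S (splice i x y) i = S y i := by
      refine h.congr _ (splice_mem_cube i hx hy) _ hy i fun j hj => ?_
      rw [splice_apply]
      split_ifs with hji
      · exact ih j hji fun l hl => hxy l (hl.trans hj)
      · rfl
    rw [h2, hxy i le_rfl, sub_self, abs_zero, add_zero] at h1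
    have h3 : |x i - y i| ≤ 0 := nonpos_of_mul_nonpos_right h1 h.pos
    exact sub_eq_zero.1 (abs_nonpos_iff.1 h3)

theorem injOn (h : IsTriangular c K S) : InjOn S (cube d) := fun x hx y hy hxy => by
  ext i
  exact h.eq_of_apply_eq hx hy i fun j _ => by rw [hxy]

theorem eq_of_apply_eq_of_setCoord (h : IsTriangular c K S) {x : E d} (hx : x ∈ cube d)
    (i : Fin d) {s : ℝ} (hs : s ∈ Icc (0 : ℝ) 1) (hS : S x i = S (setCoord x i s) i) :
    x i = s := by
  have h1 := h.mul_abs_sub_le hx i hs (hx i)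
  rw [setCoord_eq, hS, sub_self, abs_zero] at h1
  exact sub_eq_zero.1 (abs_nonpos_iff.1 (nonpos_of_mul_nonpos_right h1 h.pos))

/-- The equations are solved one coordinate at a time by the intermediate value theorem; adjusting
coordinate `k` leaves the components already matched unchanged. -/
theorem surjOn (h : IsTriangular c K S) : SurjOn S (cube d) (cube d) := by
  intro z hz
  have key : ∀ k : ℕ, ∃ x ∈ cube d, ∀ i : Fin d, (i : ℕ) < k → S x i = z i := by
    intro k
    induction k with
    | zero => exact ⟨0, zero_mem_cube d, fun i hi => absurd hi (Nat.not_lt_zero _)⟩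
    | succ k ih =>
      obtain ⟨x, hx, hxz⟩ := ih
      by_cases hk : k < d
      · set i : Fin d := ⟨k, hk⟩ with hi
        have hcont : ContinuousOn (fun s => S (setCoord x i s) i) (Icc 0 1) := fun s hs =>
          (hasDerivWithinAt_setCoord h.differentiableOn hx i i hs).continuousWithinAt
        have h0 : S (setCoord x i 0) i = 0 :=
          h.zero _ (setCoord_mem_cube hx i (by simp)) i (setCoord_self x i 0)
        have h1 : S (setCoord x i 1) i = 1 :=
          h.one _ (setCoord_mem_cube hx i (by simp)) i (setCoord_self x i 1)
        obtain ⟨s, hs, hsz⟩ := intermediate_value_Icc zero_le_one hcont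
          (show z i ∈ Icc _ _ by rw [h0, h1]; exact hz i)
        refine ⟨setCoord x i s, setCoord_mem_cube hx i hs, fun j hj => ?_⟩
        rcases Nat.lt_succ_iff_lt_or_eq.1 hj with hlt | heq
        · rw [← hxz j hlt]
          refine h.congr _ (setCoord_mem_cube hx i hs) _ hx _ fun l hl => setCoord_of_ne _ ?_ _
          intro hli
          have : (l : ℕ) ≤ j := hl
          rw [hli] at this
          simp only [hi] at this
          omega
        · have : j = i := Fin.ext heq
          rw [this]
          exact hsz
      · exact ⟨x, hx, fun j _ => hxz j (by omega)⟩
  obtain ⟨x, hx, hxz⟩ := key d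
  exact ⟨x, hx, by ext i; exact hxz i i.2⟩

theorem bijOn (h : IsTriangular c K S) : BijOn S (cube d) (cube d) :=
  ⟨h.mapsTo, h.injOn, h.surjOn⟩

theorem splice_sub (k : ℕ) (x y : E d) : splice k x y - y = splice k (x - y) 0 := by
  ext i
  simp only [PiLp.sub_apply, splice_apply]
  split_ifs <;> simp

/-- Diagonals of lower triangular matrices multiply. Every diagonal derivative below is computed
through this. -/
theorem diag_comp (h : IsTriangular c K S) {x : E d} (hx : x ∈ cube d)
    {B : E d →L[ℝ] E d} (hB : ∀ i j, i < j → jac B i j = 0) (i : Fin d) :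
    jac (B.comp (fderivWithin ℝ S (cube d) x)) i i =
      jac B i i * jac (fderivWithin ℝ S (cube d) x) i i := by
  rw [jac_comp, Matrix.mul_apply, Finset.sum_eq_single i]
  · intro j _ hj
    rcases lt_or_gt_of_ne hj with hlt | hgt
    · rw [h.jac_eq_zero hx hlt, mul_zero]
    · rw [hB i j hgt, zero_mul]
  · simp

end IsTriangular

/-- A triangular map expands distances by a factor depending only on the constants. -/
theorem IsTriangular.exists_norm_sub_le (d : ℕ) {c : ℝ} (hc : 0 < c) {K : ℝ} (hK : 0 ≤ K) :
    ∃ A : ℝ, 0 ≤ A ∧ ∀ S : E d → E d, IsTriangular c K S →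
      (∀ x ∈ cube d, ∀ y ∈ cube d, ‖x - y‖ ≤ A * ‖S x - S y‖) ∧
      ∀ x ∈ cube d, ∀ v, ‖v‖ ≤ A * ‖fderivWithin ℝ S (cube d) x v‖ := by
  obtain ⟨A, hA0, hA⟩ := exists_forward_substitution d hc hK
  refine ⟨A, hA0, fun S h => ⟨fun x hx y hy => ?_, fun x hx v => ?_⟩⟩
  · refine hA _ _ (norm_nonneg _) fun i => ?_
    refine (h.mul_abs_apply_sub_le hx hy i).trans (add_le_add ?_ ?_)
    · exact abs_apply_le_norm (S x - S y) i
    · rw [← IsTriangular.splice_sub]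
      exact (abs_apply_le_norm (S (splice i x y) - S y) i).trans
        (h.norm_sub_le (splice_mem_cube i hx hy) hy)
  · refine hA _ _ (norm_nonneg _) fun i => ?_
    set B := fderivWithin ℝ S (cube d) x with hB
    have h1 : B v i = jac B i i * v i + B (splice i v 0) i := by
      rw [apply_eq_sum_jac, apply_eq_sum_jac, ← Finset.add_sum_erase _ _ (Finset.mem_univ i)]
      congr 1
      rw [← Finset.add_sum_erase Finset.univ _ (Finset.mem_univ i)]
      have h0 : splice (i : ℕ) v 0 i = 0 := by simp [splice_apply]
      rw [h0, mul_zero, zero_add]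
      refine Finset.sum_congr rfl fun j hj => ?_
      rw [splice_apply]
      rcases lt_or_gt_of_ne (Finset.ne_of_mem_erase hj) with hlt | hgt
      · rw [if_pos (show (j : ℕ) < i from hlt)]
      · rw [hB, h.jac_eq_zero hx hgt, zero_mul, zero_mul]
    have h2 : c * |v i| ≤ |jac B i i * v i| := by
      rw [abs_mul]
      exact mul_le_mul_of_nonneg_right ((h.le_diag x hx i).trans (le_abs_self _)) (abs_nonneg _)
    have h3 : jac B i i * v i = B v i - B (splice i v 0) i := by rw [h1]; ring
    rw [h3] at h2
    refine h2.trans ((abs_sub _ _).trans (add_le_add (abs_apply_le_norm _ i) ?_))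
    exact (abs_apply_le_norm _ i).trans (B.le_of_opNorm_le (h.norm_le x hx) _)

namespace IsTriangular

variable {d : ℕ} {c K : ℝ} {S : E d → E d}

/-- The inverse of a triangular map of the cube. -/
theorem exists_inverse (d : ℕ) {c : ℝ} (hc : 0 < c) {K : ℝ} (hK : 0 ≤ K) :
    ∃ K' : ℝ, ∀ S : E d → E d, IsTriangular c K S →
      IsTriangular (1 / (K + 1)) K' (Function.invFunOn S (cube d)) := by
  obtain ⟨A, hA0, hA⟩ := exists_norm_sub_le d hc hK
  refine ⟨A, fun S h => ?_⟩
  obtain ⟨hA1, hA2⟩ := hA S h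
  set R := Function.invFunOn S (cube d) with hR
  have hRm : MapsTo R (cube d) (cube d) := h.surjOn.mapsTo_invFunOn
  have hSR : ∀ y ∈ cube d, S (R y) = y := h.surjOn.rightInvOn_invFunOn
  have hRlip : LipschitzOnWith A.toNNReal R (cube d) :=
    LipschitzOnWith.of_dist_le_mul fun y hy z hz => by
      have := hA1 _ (hRm hy) _ (hRm hz)
      rwa [hSR y hy, hSR z hz, ← dist_eq_norm, ← dist_eq_norm,
        ← Real.coe_toNNReal A hA0] at this
  have hder : ∀ y ∈ cube d, HasFDerivWithinAt R
      (fderivWithin ℝ S (cube d) (R y)).inverse (cube d) y := by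
    intro y hy
    have hdet := (h.det_pos (hRm hy)).ne'
    set e := (fderivWithin ℝ S (cube d) (R y)).toContinuousLinearEquivOfDetNeZero hdet with he
    have he' : (e : E d →L[ℝ] E d) = fderivWithin ℝ S (cube d) (R y) := by simp [he]
    rw [← he', ContinuousLinearMap.inverse_equiv]
    refine HasFDerivWithinAt.of_local_left_inverse (f := S) (t := cube d) ?_
      (by rw [he']; exact h.hasFDerivWithinAt (hRm hy)) hy ?_
    · exact tendsto_nhdsWithin_iff.2 ⟨hRlip.continuousOn y hy,
        Filter.eventually_of_mem self_mem_nhdsWithin hRm⟩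
    · exact Filter.eventually_of_mem self_mem_nhdsWithin hSR
  have hcont : ContinuousOn (fun y => (fderivWithin ℝ S (cube d) (R y)).inverse) (cube d) := by
    intro y hy
    have hdet := (h.det_pos (hRm hy)).ne'
    set e := (fderivWithin ℝ S (cube d) (R y)).toContinuousLinearEquivOfDetNeZero hdet with he
    have he' : (e : E d →L[ℝ] E d) = fderivWithin ℝ S (cube d) (R y) := by simp [he]
    have h1 : ContinuousAt ContinuousLinearMap.inverse (fderivWithin ℝ S (cube d) (R y)) := by
      rw [← he']
      exact (contDiffAt_map_inverse (𝕜 := ℝ) (n := 0) e).continuousAt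
    exact ContinuousAt.comp_continuousWithinAt (f := fun y => fderivWithin ℝ S (cube d) (R y)) h1
      ((h.continuousOn_fderivWithin.comp hRlip.continuousOn hRm) y hy)
  have hdiff : DifferentiableOn ℝ R (cube d) := fun y hy => (hder y hy).differentiableWithinAt
  have hcomp : ∀ y ∈ cube d, (fderivWithin ℝ S (cube d) (R y)).comp
      (fderivWithin ℝ R (cube d) y) = ContinuousLinearMap.id ℝ (E d) := by
    intro y hy
    have h1 := (h.hasFDerivWithinAt (hRm hy)).comp y (hdiff y hy).hasFDerivWithinAt hRm
    have h2 : HasFDerivWithinAt (S ∘ R) (ContinuousLinearMap.id ℝ (E d)) (cube d) y :=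
      (hasFDerivWithinAt_id y _).congr (fun z hz => hSR z hz) (hSR y hy)
    exact (uniqueDiffOn_cube d y hy).eq h1 h2
  have hcongr : ∀ x ∈ cube d, ∀ y ∈ cube d, ∀ i, (∀ j ≤ i, x j = y j) → R x i = R y i := by
    intro x hx y hy i hxy
    refine h.eq_of_apply_eq (hRm hx) (hRm hy) i fun j hj => ?_
    rw [hSR x hx, hSR y hy, hxy j hj]
  have hface : ∀ s ∈ Icc (0 : ℝ) 1, (∀ x ∈ cube d, ∀ i, x i = s → S x i = s) →
      ∀ y ∈ cube d, ∀ i, y i = s → R y i = s := by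
    intro s hs hS y hy i hi
    refine h.eq_of_apply_eq_of_setCoord (hRm hy) i hs ?_
    rw [hSR y hy, hi, hS _ (setCoord_mem_cube (hRm hy) i hs) i (setCoord_self _ _ _)]
  exact
    { pos := by positivity
      contDiffOn := contDiffOn_one_of_hasFDerivWithinAt (uniqueDiffOn_cube d) hder hcont
      norm_le := fun y hy => ContinuousLinearMap.opNorm_le_bound _ hA0 fun v => by
        refine (hA2 _ (hRm hy) _).trans_eq ?_
        rw [← ContinuousLinearMap.comp_apply, hcomp y hy, ContinuousLinearMap.id_apply]
      congr := hcongr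
      zero := hface 0 (by simp) h.zero
      one := hface 1 (by simp) h.one
      le_diag := fun y hy i => by
        have hlow : ∀ i j, i < j → jac (fderivWithin ℝ R (cube d) y) i j = 0 := fun i j hij => by
          refine jac_eq_of_hasDerivWithinAt hdiff hy i j ?_
          refine (hasDerivWithinAt_const (y j) (Icc (0 : ℝ) 1) (R y i)).congr (fun s hs => ?_) ?_
          · exact hcongr _ (setCoord_mem_cube hy j hs) _ hy _ fun l hl =>
              setCoord_of_ne _ (hl.trans_lt hij).ne _
          · rw [setCoord_eq]
        have h1 : jac (fderivWithin ℝ S (cube d) (R y)) i i *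
            jac (fderivWithin ℝ R (cube d) y) i i = 1 := by
          have h2 := congrArg (fun B => jac B i i) (hcomp y hy)
          simp only [jac_id, Matrix.one_apply_eq] at h2
          rw [← h2, jac_comp, Matrix.mul_apply, Finset.sum_eq_single i]
          · intro j _ hj
            rcases lt_or_gt_of_ne hj with hlt | hgt
            · rw [hlow j i hlt, mul_zero]
            · rw [h.jac_eq_zero (hRm hy) hgt, zero_mul]
          · simp
        have h3 := h.pos.trans_le (h.le_diag _ (hRm hy) i)
        have h4 : jac (fderivWithin ℝ S (cube d) (R y)) i i ≤ K :=
          (le_abs_self _).trans ((abs_jac_le _ i i).trans (h.norm_le _ (hRm hy)))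
        -- The diagonal entry of the inverse is the reciprocal of one in `(0, K]`; the bound with `K
        -- + 1` keeps the constant positive even for `K = 0`.
        rw [eq_div_of_mul_eq h3.ne' ((mul_comm _ _).trans h1)]
        exact one_div_le_one_div_of_le h3 (by linarith) }

theorem comp {c' K' : ℝ} {S' : E d → E d} (h : IsTriangular c K S) (h' : IsTriangular c' K' S') :
    IsTriangular (c * c') (K * K') (S ∘ S') := by
  have hf : ∀ x ∈ cube d, fderivWithin ℝ (S ∘ S') (cube d) x =
      (fderivWithin ℝ S (cube d) (S' x)).comp (fderivWithin ℝ S' (cube d) x) := fun x hx =>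
    ((h.hasFDerivWithinAt (h'.mapsTo hx)).comp x (h'.hasFDerivWithinAt hx) h'.mapsTo).fderivWithin
      (uniqueDiffOn_cube d x hx)
  exact
    { pos := mul_pos h.pos h'.pos
      contDiffOn := h.contDiffOn.comp h'.contDiffOn h'.mapsTo
      norm_le := fun x hx => by
        rw [hf x hx]
        exact (ContinuousLinearMap.opNorm_comp_le _ _).trans (mul_le_mul
          (h.norm_le _ (h'.mapsTo hx)) (h'.norm_le x hx) (norm_nonneg _) h.nonneg)
      congr := fun x hx y hy i hxy => h.congr _ (h'.mapsTo hx) _ (h'.mapsTo hy) i fun j hj =>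
        h'.congr x hx y hy j fun l hl => hxy l (hl.trans hj)
      zero := fun x hx i hi => h.zero _ (h'.mapsTo hx) i (h'.zero x hx i hi)
      one := fun x hx i hi => h.one _ (h'.mapsTo hx) i (h'.one x hx i hi)
      le_diag := fun x hx i => by
        rw [hf x hx, h'.diag_comp hx fun i j hij => h.jac_eq_zero (h'.mapsTo hx) hij]
        exact mul_le_mul (h.le_diag _ (h'.mapsTo hx) i) (h'.le_diag x hx i) h'.pos.le
          (h.pos.le.trans (h.le_diag _ (h'.mapsTo hx) i)) }

theorem hasFDerivWithinAt_interp (h : IsTriangular c K S) (t : ℝ) {x : E d} (hx : x ∈ cube d) :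
    HasFDerivWithinAt (interp S t) ((1 - t) • ContinuousLinearMap.id ℝ (E d) +
      t • fderivWithin ℝ S (cube d) x) (cube d) x :=
  ((hasFDerivWithinAt_id x _).const_smul (1 - t)).add ((h.hasFDerivWithinAt hx).const_smul t)

theorem jac_interp (h : IsTriangular c K S) (t : ℝ) {x : E d} (hx : x ∈ cube d) (i : Fin d) :
    jac (fderivWithin ℝ (interp S t) (cube d) x) i i =
      1 + t * (jac (fderivWithin ℝ S (cube d) x) i i - 1) := by
  rw [(h.hasFDerivWithinAt_interp t hx).fderivWithin (uniqueDiffOn_cube d x hx)]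
  simp [jac_apply]
  ring

/-- On the diagonal, a convex combination of 1 and a number at least `c` stays above `min 1 c`. So
all interpolants are bijections of the cube with constants uniform in `t`, which makes the
straight-line field well defined. -/
theorem interp (h : IsTriangular c K S) {t : ℝ} (ht : t ∈ Icc (0 : ℝ) 1) :
    IsTriangular (min 1 c) (1 + K) (interp S t) where
  pos := lt_min zero_lt_one h.pos
  contDiffOn := by
    have : ContDiffOn ℝ 1 (fun x : E d => x) (cube d) := contDiffOn_id
    exact (this.const_smul (1 - t)).add (h.contDiffOn.const_smul t)
  norm_le x hx := by
    rw [(h.hasFDerivWithinAt_interp t hx).fderivWithin (uniqueDiffOn_cube d x hx)]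
    refine (norm_add_le _ _).trans (add_le_add ?_ ?_)
    · rw [norm_smul, Real.norm_of_nonneg (sub_nonneg.2 ht.2)]
      exact mul_le_one₀ (by linarith [ht.1]) (norm_nonneg _) ContinuousLinearMap.norm_id_le
    · rw [norm_smul, Real.norm_of_nonneg ht.1]
      exact (mul_le_of_le_one_left (norm_nonneg _) ht.2).trans (h.norm_le x hx)
  congr x hx y hy i hxy := by
    simp only [KRFlow.interp, PiLp.add_apply, PiLp.smul_apply]
    rw [hxy i le_rfl, h.congr x hx y hy i hxy]
  zero x hx i hi := by simp [KRFlow.interp, hi, h.zero x hx i hi]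
  one x hx i hi := by simp [KRFlow.interp, hi, h.one x hx i hi]
  le_diag x hx i := by
    rw [h.jac_interp t hx]
    have h1 := h.le_diag x hx i
    have h2 := min_le_left 1 c
    have h3 := min_le_right 1 c
    have ht0 := ht.1
    have ht1 := ht.2
    nlinarith

end IsTriangular

end KRFlow

namespace KRFlow

/-! ### Lebesgue measure on the cube -/

theorem measurePreserving_ofLp_cube (d : ℕ) :
    MeasurePreserving (WithLp.ofLp : E d → Fin d → ℝ) (volume.restrict (cube d))
      (Measure.pi fun _ => volume.restrict (Icc (0 : ℝ) 1)) := by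
  have h := (PiLp.volume_preserving_ofLp (Fin d)).restrict_preimage
    (MeasurableSet.univ_pi fun _ : Fin d => measurableSet_Icc (a := (0 : ℝ)) (b := 1))
  rwa [← cube_eq_preimage, volume_pi, Measure.restrict_pi_pi] at h

instance isProbabilityMeasure_Icc : IsProbabilityMeasure (volume.restrict (Icc (0 : ℝ) 1)) :=
  ⟨by simp⟩

instance isProbabilityMeasure_cube (d : ℕ) : IsProbabilityMeasure (volume.restrict (cube d)) := by
  constructor
  rw [← preimage_univ (f := (WithLp.ofLp : E d → Fin d → ℝ)),
    (measurePreserving_ofLp_cube d).measure_preimage MeasurableSet.univ.nullMeasurableSet]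
  exact measure_univ

/-- Resampling one coordinate independently does not change a product of probability measures. This
replaces an explicit splitting of the cube when marginals are integrated. -/
theorem measurePreserving_update {ι : Type*} [Fintype ι] [DecidableEq ι] {X : ι → Type*}
    [∀ i, MeasurableSpace (X i)] (ν : ∀ i, Measure (X i)) [∀ i, IsProbabilityMeasure (ν i)]
    (i : ι) : MeasurePreserving (fun z : X i × (∀ j, X j) => Function.update z.2 i z.1)
      ((ν i).prod (Measure.pi ν)) (Measure.pi ν) := by
  have hm : Measurable (fun z : X i × (∀ j, X j) => Function.update z.2 i z.1) := by
    rw [measurable_pi_iff]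
    intro j
    by_cases h : j = i
    · subst h
      simpa using measurable_fst
    · simpa [h, Function.comp_def] using (measurable_pi_apply j).comp measurable_snd
  refine ⟨hm, (Measure.pi_eq fun s hs => ?_).symm⟩
  rw [Measure.map_apply hm (MeasurableSet.univ_pi hs)]
  have hpre : (fun z : X i × (∀ j, X j) => Function.update z.2 i z.1) ⁻¹' univ.pi s =
      s i ×ˢ univ.pi (Function.update s i univ) := by
    ext z
    simp only [mem_preimage, Set.mem_univ_pi, mem_prod]
    constructor
    · intro h
      refine ⟨by simpa using h i, fun j => ?_⟩
      by_cases hj : j = i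
      · subst hj; simp
      · simpa [hj] using h j
    · rintro ⟨h1, h2⟩ j
      by_cases hj : j = i
      · subst hj; simpa using h1
      · simpa [hj] using h2 j
  rw [hpre, Measure.prod_prod, Measure.pi_pi, ← Finset.mul_prod_erase _ _ (Finset.mem_univ i),
    ← Finset.mul_prod_erase Finset.univ (fun j => ν j (s j)) (Finset.mem_univ i)]
  simp only [Function.update_self, measure_univ, one_mul]
  congr 1
  refine Finset.prod_congr rfl fun j hj => ?_
  rw [Function.update_of_ne (Finset.ne_of_mem_erase hj)]

theorem measurePreserving_setCoord {d : ℕ} (i : Fin d) :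
    MeasurePreserving (fun z : ℝ × E d => setCoord z.2 i z.1)
      ((volume.restrict (Icc (0 : ℝ) 1)).prod (volume.restrict (cube d)))
      (volume.restrict (cube d)) := by
  have h1 := (MeasurePreserving.id (volume.restrict (Icc (0 : ℝ) 1))).prod
    (measurePreserving_ofLp_cube d)
  have h2 := measurePreserving_update (fun _ : Fin d => volume.restrict (Icc (0 : ℝ) 1)) i
  have h3 : MeasurePreserving (WithLp.toLp 2 : (Fin d → ℝ) → E d)
      (Measure.pi fun _ => volume.restrict (Icc (0 : ℝ) 1)) (volume.restrict (cube d)) :=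
    (measurePreserving_ofLp_cube d).symm (MeasurableEquiv.toLp 2 (Fin d → ℝ)).symm
  exact h3.comp (h2.comp h1)

/-! ### Averages of a density over families of contractions of the cube -/

theorem continuous_comp_boxClamp {d : ℕ} {Y : Type*} [TopologicalSpace Y] {f : E d → Y}
    (hf : ContinuousOn f (cube d)) : Continuous fun x => f (boxClamp 0 1 x) :=
  hf.comp_continuous (lipschitzWith_boxClamp 0 1).continuous boxClamp_mem_cube

theorem integrable_of_continuousOn_cube {d : ℕ} {Y : Type*} [NormedAddCommGroup Y]
    {f : E d → Y} (hf : ContinuousOn f (cube d)) : Integrable f (volume.restrict (cube d)) :=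
  hf.integrableOn_compact (isCompact_cube d)

theorem integrable_comp_of_continuousOn_cube {d : ℕ} {Y : Type*} [NormedAddCommGroup Y]
    [SecondCountableTopologyEither (E d) Y]
    {Ω : Type*} [TopologicalSpace Ω] [MeasurableSpace Ω] [OpensMeasurableSpace Ω]
    {μ : Measure Ω} [IsFiniteMeasure μ] {f : E d → Y} (hf : ContinuousOn f (cube d)) {φ : Ω → E d}
    (hφ : Continuous φ) (hm : ∀ᵐ ω ∂μ, φ ω ∈ cube d) : Integrable (fun ω => f (φ ω)) μ := by
  obtain ⟨C, hC⟩ := (isCompact_cube d).exists_bound_of_continuousOn hf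
  refine Integrable.of_bound ?_ C (hm.mono fun ω hω => hC _ hω)
  have h1 : AEStronglyMeasurable (fun ω => f (boxClamp 0 1 (φ ω))) μ :=
    ((continuous_comp_boxClamp hf).stronglyMeasurable.comp_measurable
      hφ.measurable).aestronglyMeasurable
  exact h1.congr (hm.mono fun ω hω => by simp only [boxClamp_of_mem_cube hω])

/-- The quadratic Taylor remainder of `p` is uniform on the cube, so it survives integration and
gives the derivative of the average. Since the linear parts are contractions, the first-derivative
bound `L` passes through unchanged; the Lipschitz constant of the derivative is used only
qualitatively. -/
theorem contDiffOn_average {d : ℕ} {Ω : Type*} [TopologicalSpace Ω] [MeasurableSpace Ω]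
    [OpensMeasurableSpace Ω] {μ : Measure Ω} [IsProbabilityMeasure μ]
    {p : E d → ℝ} (hp : ContDiffOn ℝ 2 p (cube d)) {L : ℝ}
    (hL : ∀ x ∈ cube d, ‖fderivWithin ℝ p (cube d) x‖ ≤ L)
    {A : Ω → E d →L[ℝ] E d} {b : Ω → E d} (hA : Continuous A) (hb : Continuous b)
    (hA1 : ∀ᵐ ω ∂μ, ‖A ω‖ ≤ 1) (hm : ∀ᵐ ω ∂μ, ∀ x ∈ cube d, A ω x + b ω ∈ cube d) :
    ContDiffOn ℝ 1 (fun x => ∫ ω, p (A ω x + b ω) ∂μ) (cube d) ∧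
      ∀ x ∈ cube d, ‖fderivWithin ℝ (fun x => ∫ ω, p (A ω x + b ω) ∂μ) (cube d) x‖ ≤ L := by
  have hp1 : ContDiffOn ℝ 1 (fderivWithin ℝ p (cube d)) (cube d) :=
    hp.fderivWithin (uniqueDiffOn_cube d) (by norm_num)
  obtain ⟨K, hK⟩ := exists_lipschitzOnWith (isCompact_cube d) (convex_cube d)
    (uniqueDiffOn_cube d) hp1
  have hφ : ∀ x : E d, Continuous fun ω => A ω x + b ω := fun x =>
    (hA.clm_apply continuous_const).add hb
  have hint : ∀ x ∈ cube d, Integrable (fun ω => p (A ω x + b ω)) μ := fun x hx =>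
    integrable_comp_of_continuousOn_cube hp.continuousOn (hφ x) (hm.mono fun ω hω => hω x hx)
  have hint' : ∀ x ∈ cube d, Integrable
      (fun ω => (fderivWithin ℝ p (cube d) (A ω x + b ω)).comp (A ω)) μ := by
    intro x hx
    have h1 : Integrable (fun ω => fderivWithin ℝ p (cube d) (A ω x + b ω)) μ :=
      integrable_comp_of_continuousOn_cube hp1.continuousOn (hφ x) (hm.mono fun ω hω => hω x hx)
    refine Integrable.of_bound (C := L) ?_ ?_
    · exact (ContinuousLinearMap.compL ℝ (E d) (E d) ℝ).continuous₂.comp_aestronglyMeasurable₂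
        h1.aestronglyMeasurable hA.aestronglyMeasurable
    · filter_upwards [hm, hA1] with ω hω hω1
      refine (ContinuousLinearMap.opNorm_comp_le _ _).trans ?_
      exact (mul_le_of_le_one_right (norm_nonneg _) hω1).trans (hL _ (hω x hx))
  have hsub : ∀ ω (x y : E d), A ω y + b ω - (A ω x + b ω) = A ω (y - x) := fun ω x y => by
    rw [map_sub]; abel
  have hder : ∀ x ∈ cube d, HasFDerivWithinAt (fun x => ∫ ω, p (A ω x + b ω) ∂μ)
      (∫ ω, (fderivWithin ℝ p (cube d) (A ω x + b ω)).comp (A ω) ∂μ) (cube d) x := by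
    intro x hx
    refine hasFDerivWithinAt_of_norm_sub_sub_le (C := K) fun y hy => ?_
    have e : ∫ ω, (p (A ω y + b ω) - p (A ω x + b ω) -
        (fderivWithin ℝ p (cube d) (A ω x + b ω)).comp (A ω) (y - x)) ∂μ =
        ∫ ω, p (A ω y + b ω) ∂μ - ∫ ω, p (A ω x + b ω) ∂μ -
          (∫ ω, (fderivWithin ℝ p (cube d) (A ω x + b ω)).comp (A ω) ∂μ) (y - x) := by
      rw [integral_sub (f := fun ω => p (A ω y + b ω) - p (A ω x + b ω))
        ((hint y hy).sub (hint x hx)) ((hint' x hx).apply_continuousLinearMap _),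
        integral_sub (hint y hy) (hint x hx), ContinuousLinearMap.integral_apply (hint' x hx)]
    rw [← e]
    refine (norm_integral_le_of_norm_le_const (C := K * (‖y - x‖ * ‖y - x‖)) ?_).trans_eq
      (by simp)
    filter_upwards [hm, hA1] with ω hω hω1
    have h1 := norm_sub_sub_fderivWithin_le (convex_cube d) (hp.differentiableOn two_ne_zero) hK
      (hω x hx) (hω y hy)
    rw [hsub] at h1
    have h2 : ‖A ω (y - x)‖ ≤ ‖y - x‖ := by simpa using (A ω).le_of_opNorm_le hω1 (y - x)
    refine h1.trans ?_
    rw [mul_assoc]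
    gcongr
  have hbound : ∀ x ∈ cube d,
      ‖∫ ω, (fderivWithin ℝ p (cube d) (A ω x + b ω)).comp (A ω) ∂μ‖ ≤ L := by
    intro x hx
    refine (norm_integral_le_of_norm_le_const (C := L) ?_).trans_eq (by simp)
    filter_upwards [hm, hA1] with ω hω hω1
    refine (ContinuousLinearMap.opNorm_comp_le _ _).trans ?_
    exact (mul_le_of_le_one_right (norm_nonneg _) hω1).trans (hL _ (hω x hx))
  refine ⟨contDiffOn_one_of_hasFDerivWithinAt (uniqueDiffOn_cube d) hder ?_, fun x hx => ?_⟩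
  · have : LipschitzOnWith K (fun x => ∫ ω, (fderivWithin ℝ p (cube d) (A ω x + b ω)).comp (A ω) ∂μ)
        (cube d) := by
      refine LipschitzOnWith.of_dist_le_mul fun x hx y hy => ?_
      rw [dist_eq_norm, ← integral_sub (hint' x hx) (hint' y hy)]
      refine (norm_integral_le_of_norm_le_const (C := K * dist x y) ?_).trans_eq (by simp)
      filter_upwards [hm, hA1] with ω hω hω1
      rw [← ContinuousLinearMap.sub_comp]
      refine (ContinuousLinearMap.opNorm_comp_le _ _).trans
        ((mul_le_of_le_one_right (norm_nonneg _) hω1).trans ?_)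
      have h1 := hK.dist_le_mul _ (hω x hx) _ (hω y hy)
      rw [dist_eq_norm, dist_eq_norm, hsub] at h1
      refine h1.trans (mul_le_mul_of_nonneg_left ?_ K.2)
      rw [dist_eq_norm]
      simpa using (A ω).le_of_opNorm_le hω1 (x - y)
    exact this.continuousOn
  · rw [(hder x hx).fderivWithin (uniqueDiffOn_cube d x hx)]
    exact hbound x hx

/-! ### Diagonal maps -/

/-- The diagonal linear map with entries `a`. -/
noncomputable def diagMap {d : ℕ} (a : Fin d → ℝ) : E d →L[ℝ] E d :=
  LinearMap.toContinuousLinearMap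
    { toFun := fun x => WithLp.toLp 2 fun i => a i * x i
      map_add' := fun x y => by ext i; simp [mul_add]
      map_smul' := fun c x => by ext i; simp; ring }

theorem diagMap_apply {d : ℕ} (a : Fin d → ℝ) (x : E d) (i : Fin d) :
    diagMap a x i = a i * x i := rfl

theorem norm_diagMap_le {d : ℕ} {a : Fin d → ℝ} (ha : ∀ i, |a i| ≤ 1) : ‖diagMap a‖ ≤ 1 := by
  refine ContinuousLinearMap.opNorm_le_bound _ zero_le_one fun x => ?_
  rw [one_mul, EuclideanSpace.norm_eq, EuclideanSpace.norm_eq]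
  refine Real.sqrt_le_sqrt (Finset.sum_le_sum fun i _ => pow_le_pow_left₀ (norm_nonneg _) ?_ 2)
  rw [diagMap_apply, norm_mul]
  exact mul_le_of_le_one_left (norm_nonneg _) (ha i)

theorem continuous_diagMap {d : ℕ} {Ω : Type*} [TopologicalSpace Ω] {a : Ω → Fin d → ℝ}
    (ha : Continuous a) : Continuous fun ω => diagMap (a ω) := by
  rw [continuous_clm_apply]
  intro x
  refine (PiLp.continuous_toLp 2 _).comp (continuous_pi fun i => ?_)
  exact ((continuous_apply i).comp ha).mul continuous_const

end KRFlow

namespace KRFlow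

/-! ### Regular densities and their marginals -/

/-- The bounds on a probability density on the cube that the estimates depend on. -/
structure IsGoodDensity {d : ℕ} (L₁ L₂ : ℝ) (p : E d → ℝ) : Prop where
  pos : 0 < L₂
  contDiffOn : ContDiffOn ℝ 2 p (cube d)
  le : ∀ x ∈ cube d, p x ≤ L₁
  norm_fderivWithin_le : ∀ x ∈ cube d, ‖fderivWithin ℝ p (cube d) x‖ ≤ L₁
  ge : ∀ x ∈ cube d, L₂ ≤ p x
  integral_eq : ∫ x in cube d, p x = 1

theorem enorm_iteratedFDerivWithin_le_cNorm {X Y : Type*} [NormedAddCommGroup X] [NormedSpace ℝ X]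
    [NormedAddCommGroup Y] [NormedSpace ℝ Y] {n k : ℕ} (hn : n ≤ k) {S : Set X} (f : X → Y)
    {x : X} (hx : x ∈ S) : ‖iteratedFDerivWithin ℝ n f S x‖ₑ ≤ cNorm k S f :=
  le_iSup₂_of_le n hn
    (le_iSup₂ (f := fun x (_ : x ∈ S) => ‖iteratedFDerivWithin ℝ n f S x‖ₑ) x hx)

theorem norm_le_of_cNorm_le {X Y : Type*} [NormedAddCommGroup X] [NormedSpace ℝ X]
    [NormedAddCommGroup Y] [NormedSpace ℝ Y] {k : ℕ} {S : Set X} {f : X → Y} {C : ℝ} (hC : 0 ≤ C)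
    (h : cNorm k S f ≤ ENNReal.ofReal C) {x : X} (hx : x ∈ S) : ‖f x‖ ≤ C := by
  have h1 : ‖iteratedFDerivWithin ℝ 0 f S x‖ₑ ≤ ENNReal.ofReal C :=
    (enorm_iteratedFDerivWithin_le_cNorm (Nat.zero_le k) f hx).trans h
  rw [← ofReal_norm, ENNReal.ofReal_le_ofReal_iff hC, norm_iteratedFDerivWithin_zero] at h1
  exact h1

theorem norm_fderivWithin_le_of_cNorm_le {X Y : Type*} [NormedAddCommGroup X] [NormedSpace ℝ X]
    [NormedAddCommGroup Y] [NormedSpace ℝ Y] {k : ℕ} (hk : 1 ≤ k) {S : Set X}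
    (hS : UniqueDiffOn ℝ S) {f : X → Y} {C : ℝ} (hC : 0 ≤ C)
    (h : cNorm k S f ≤ ENNReal.ofReal C) {x : X} (hx : x ∈ S) : ‖fderivWithin ℝ f S x‖ ≤ C := by
  have h1 : ‖iteratedFDerivWithin ℝ 1 f S x‖ₑ ≤ ENNReal.ofReal C :=
    (enorm_iteratedFDerivWithin_le_cNorm hk f hx).trans h
  rw [← ofReal_norm, ENNReal.ofReal_le_ofReal_iff hC, norm_iteratedFDerivWithin_one f (hS x hx)]
    at h1
  exact h1

theorem RegularDensity.isGoodDensity {d k : ℕ} {L₁ L₂ : ℝ} {μ : Measure (E d)} {p : E d → ℝ}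
    (h : RegularDensity k L₁ L₂ μ p) (hk : 2 ≤ k) (hL₁ : 0 ≤ L₁) (hL₂ : 0 < L₂) :
    IsGoodDensity L₁ L₂ p where
  pos := hL₂
  contDiffOn := h.contDiffOn.of_le (by exact_mod_cast hk)
  le x hx := (le_abs_self _).trans (norm_le_of_cNorm_le hL₁ h.norm_le hx)
  norm_fderivWithin_le x hx := norm_fderivWithin_le_of_cNorm_le (one_le_two.trans hk)
    (uniqueDiffOn_cube d) hL₁ h.norm_le hx
  ge := h.lower_bound
  integral_eq := by
    have h1 : μ univ = 1 := h.isProbabilityMeasure.measure_univ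
    rw [h.eq_withDensity, withDensity_apply _ MeasurableSet.univ, Measure.restrict_univ] at h1
    rw [integral_eq_lintegral_of_nonneg_ae, h1, ENNReal.toReal_one]
    · exact (ae_restrict_mem (measurableSet_cube d)).mono fun x hx =>
        hL₂.le.trans (h.lower_bound x hx)
    · exact (integrable_of_continuousOn_cube h.contDiffOn.continuousOn).aestronglyMeasurable

/-- Affine form in `x` with linear part of norm at most one, which makes marginals an instance of
`contDiffOn_average`. -/
theorem splice_eq_diagMap {d : ℕ} (k : ℕ) (x t : E d) :
    splice k x t = diagMap (fun i => if (i : ℕ) < k then 1 else 0) x +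
      diagMap (fun i => if (i : ℕ) < k then 0 else 1) t := by
  ext i
  simp only [PiLp.add_apply, diagMap_apply, splice_apply]
  split_ifs <;> simp

theorem splice_congr {d : ℕ} {k : ℕ} {x y : E d} (h : ∀ i : Fin d, (i : ℕ) < k → x i = y i)
    (t : E d) : splice k x t = splice k y t := by
  ext i
  simp only [splice_apply]
  split_ifs with hi
  exacts [h i hi, rfl]

theorem marginal_congr {d : ℕ} (p : E d → ℝ) {k : ℕ} {x y : E d}
    (h : ∀ i : Fin d, (i : ℕ) < k → x i = y i) : marginal p k x = marginal p k y := by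
  simp only [marginal, splice_congr h]

theorem condDensity_congr {d : ℕ} (p : E d → ℝ) {i : Fin d} {x y : E d}
    (h : ∀ j < i, x j = y j) (s : ℝ) : condDensity p i x s = condDensity p i y s := by
  rw [condDensity, condDensity, marginal_congr p (k := i) fun j hj => h j hj,
    marginal_congr p (k := i + 1) (x := setCoord x i s) (y := setCoord y i s)]
  intro j hj
  rw [setCoord_apply, setCoord_apply]
  split_ifs with hji
  · rfl
  · exact h j (lt_of_le_of_ne (Nat.lt_succ_iff.1 hj) hji)

theorem condCDF_congr {d : ℕ} (p : E d → ℝ) {i : Fin d} {x y : E d}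
    (h : ∀ j < i, x j = y j) (s : ℝ) : condCDF p i x s = condCDF p i y s := by
  simp only [condCDF, condDensity_congr p h]

/-- The map `(x_0, …, x_{i-1}, u x_i, t_{i+1}, …)`, as an affine function of `x`. -/
theorem splice_setCoord_mul_eq {d : ℕ} (i : Fin d) (x t : E d) (u : ℝ) :
    splice (i + 1) (setCoord x i (x i * u)) t =
      diagMap (fun j => if (j : ℕ) < i then 1 else if j = i then u else 0) x +
      diagMap (fun j => if (j : ℕ) < i + 1 then 0 else 1) t := by
  ext j
  simp only [PiLp.add_apply, diagMap_apply, splice_apply, setCoord_apply]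
  rcases lt_trichotomy j i with h | h | h
  · have h1 : (j : ℕ) < i := h
    rw [if_pos (by omega), if_neg h.ne, if_pos h1, if_pos (by omega)]
    ring
  · subst h
    simp [mul_comm]
  · have h1 : (i : ℕ) < j := h
    rw [if_neg (by omega), if_neg (by omega), if_neg h.ne', if_neg (by omega)]
    ring

/-- The average of `p` over the conditional box: up to the factor `x_i`, the numerator of the
conditional distribution function at `x_i`. -/
noncomputable def innerMean {d : ℕ} (p : E d → ℝ) (i : Fin d) (x : E d) : ℝ :=
  ∫ ω : ℝ × E d, p (splice (i + 1) (setCoord x i (x i * ω.1)) ω.2)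
    ∂(volume.restrict (Icc (0 : ℝ) 1)).prod (volume.restrict (cube d))

theorem ae_mem_cylinder (d : ℕ) :
    ∀ᵐ ω ∂(volume.restrict (Icc (0 : ℝ) 1)).prod (volume.restrict (cube d)),
      ω.1 ∈ Icc (0 : ℝ) 1 ∧ ω.2 ∈ cube d := by
  rw [Measure.prod_restrict]
  exact ae_restrict_mem (measurableSet_Icc.prod (measurableSet_cube d))

theorem splice_setCoord_mem_cube {d : ℕ} (i : Fin d) {x t : E d} {u : ℝ} (hx : x ∈ cube d)
    (hu : u ∈ Icc (0 : ℝ) 1) (ht : t ∈ cube d) :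
    splice (i + 1) (setCoord x i (x i * u)) t ∈ cube d :=
  splice_mem_cube _ (setCoord_mem_cube hx i
    ⟨mul_nonneg (hx i).1 hu.1, mul_le_one₀ (hx i).2 hu.1 hu.2⟩) ht

theorem continuous_splice {d : ℕ} (k : ℕ) (x : E d) : Continuous fun t => splice k x t := by
  simp_rw [splice_eq_diagMap]
  fun_prop

theorem continuous_splice_setCoord {d : ℕ} (i : Fin d) (x : E d) :
    Continuous fun ω : ℝ × E d => splice (i + 1) (setCoord x i (x i * ω.1)) ω.2 := by
  simp_rw [splice_eq_diagMap]
  have := (continuous_setCoord i).comp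
    (f := fun ω : ℝ × E d => (x, x i * ω.1)) (by fun_prop)
  simp only [Function.comp_def] at this
  fun_prop

theorem integral_mem_Icc {Ω : Type*} [MeasurableSpace Ω] {μ : Measure Ω} [IsProbabilityMeasure μ]
    {f : Ω → ℝ} (hf : Integrable f μ) {a b : ℝ} (h : ∀ᵐ ω ∂μ, f ω ∈ Icc a b) :
    ∫ ω, f ω ∂μ ∈ Icc a b := by
  constructor
  · simpa using integral_mono_ae (integrable_const a) hf (h.mono fun ω hω => hω.1)
  · simpa using integral_mono_ae hf (integrable_const b) (h.mono fun ω hω => hω.2)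

namespace IsGoodDensity

variable {d : ℕ} {L₁ L₂ : ℝ} {p : E d → ℝ}

theorem continuousOn (h : IsGoodDensity L₁ L₂ p) : ContinuousOn p (cube d) :=
  h.contDiffOn.continuousOn

theorem mem_Icc (h : IsGoodDensity L₁ L₂ p) {x : E d} (hx : x ∈ cube d) : p x ∈ Icc L₂ L₁ :=
  ⟨h.ge x hx, h.le x hx⟩

theorem le_const (h : IsGoodDensity L₁ L₂ p) : L₂ ≤ L₁ :=
  (h.ge 0 (zero_mem_cube d)).trans (h.le 0 (zero_mem_cube d))

theorem pos' (h : IsGoodDensity L₁ L₂ p) : 0 < L₁ := h.pos.trans_le h.le_const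

theorem marginal_mem_Icc (h : IsGoodDensity L₁ L₂ p) (k : ℕ) {x : E d} (hx : x ∈ cube d) :
    marginal p k x ∈ Icc L₂ L₁ := by
  have hm : ∀ᵐ t ∂volume.restrict (cube d), splice k x t ∈ cube d :=
    (ae_restrict_mem (measurableSet_cube d)).mono fun t ht => splice_mem_cube k hx ht
  exact integral_mem_Icc (integrable_comp_of_continuousOn_cube h.continuousOn
    (continuous_splice k x) hm) (hm.mono fun t ht => h.mem_Icc ht)

theorem contDiffOn_marginal (h : IsGoodDensity L₁ L₂ p) (k : ℕ) :
    ContDiffOn ℝ 1 (marginal p k) (cube d) ∧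
      ∀ x ∈ cube d, ‖fderivWithin ℝ (marginal p k) (cube d) x‖ ≤ L₁ := by
  have := contDiffOn_average (μ := volume.restrict (cube d)) h.contDiffOn h.norm_fderivWithin_le
    (A := fun _ => diagMap fun i => if (i : ℕ) < k then 1 else 0)
    (b := fun t => diagMap (fun i => if (i : ℕ) < k then 0 else 1) t) continuous_const
    (by fun_prop) (Filter.Eventually.of_forall fun _ => norm_diagMap_le fun i => by
      split_ifs <;> simp)
    ((ae_restrict_mem (measurableSet_cube d)).mono fun t ht x hx => by
      rw [← splice_eq_diagMap]
      exact splice_mem_cube k hx ht)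
  simp_rw [← splice_eq_diagMap] at this
  exact this

theorem innerMean_mem_Icc (h : IsGoodDensity L₁ L₂ p) (i : Fin d) {x : E d} (hx : x ∈ cube d) :
    innerMean p i x ∈ Icc L₂ L₁ := by
  have hm := (ae_mem_cylinder d).mono fun ω hω => splice_setCoord_mem_cube i hx hω.1 hω.2
  exact integral_mem_Icc (integrable_comp_of_continuousOn_cube h.continuousOn
    (continuous_splice_setCoord i x) hm) (hm.mono fun t ht => h.mem_Icc ht)

theorem contDiffOn_innerMean (h : IsGoodDensity L₁ L₂ p) (i : Fin d) :
    ContDiffOn ℝ 1 (innerMean p i) (cube d) ∧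
      ∀ x ∈ cube d, ‖fderivWithin ℝ (innerMean p i) (cube d) x‖ ≤ L₁ := by
  have := contDiffOn_average
    (μ := (volume.restrict (Icc (0 : ℝ) 1)).prod (volume.restrict (cube d)))
    h.contDiffOn h.norm_fderivWithin_le
    (A := fun ω => diagMap fun j => if (j : ℕ) < i then 1 else if j = i then ω.1 else 0)
    (b := fun ω => diagMap (fun j => if (j : ℕ) < i + 1 then 0 else 1) ω.2)
    (continuous_diagMap (continuous_pi fun j => by split_ifs <;> fun_prop))
    (by fun_prop)
    ((ae_mem_cylinder d).mono fun ω hω => norm_diagMap_le fun j => by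
      split_ifs
      · simp
      · rw [abs_of_nonneg hω.1.1]; exact hω.1.2
      · simp)
    ((ae_mem_cylinder d).mono fun ω hω x hx => by
      rw [← splice_setCoord_mul_eq]
      exact splice_setCoord_mem_cube i hx hω.1 hω.2)
  simp_rw [← splice_setCoord_mul_eq] at this
  exact this

theorem marginal_zero (h : IsGoodDensity L₁ L₂ p) (x : E d) : marginal p 0 x = 1 := by
  rw [← h.integral_eq, marginal]
  rfl

theorem marginal_self (x : E d) : marginal p d x = p x := by
  have h1 : ∀ t, splice d x t = x := fun t => by
    ext i
    rw [splice_apply, if_pos i.2]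
  simp [marginal, h1]

theorem continuousOn_marginal_setCoord (h : IsGoodDensity L₁ L₂ p) (k : ℕ) (i : Fin d) {x : E d}
    (hx : x ∈ cube d) : ContinuousOn (fun s => marginal p k (setCoord x i s)) (Icc 0 1) :=
  (h.contDiffOn_marginal k).1.continuousOn.comp
    (fun s _ => (hasDerivAt_setCoord x i s).continuousAt.continuousWithinAt)
    fun _ hs => setCoord_mem_cube hx i hs

theorem continuousOn_condDensity (h : IsGoodDensity L₁ L₂ p) (i : Fin d) {x : E d}
    (hx : x ∈ cube d) : ContinuousOn (condDensity p i x) (Icc 0 1) :=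
  (h.continuousOn_marginal_setCoord (i + 1) i hx).div_const _

/-- The substitution `τ = x_i u` moves the variable endpoint into the integrand, leaving an average
over a fixed domain. Joint `C¹` regularity up to the boundary is then a matter of products and
quotients. -/
theorem condCDF_eq (h : IsGoodDensity L₁ L₂ p) (i : Fin d) {x : E d} (hx : x ∈ cube d) :
    condCDF p i x (x i) = x i * innerMean p i x * (marginal p i x)⁻¹ := by
  have hm := (ae_mem_cylinder d).mono fun ω hω => splice_setCoord_mem_cube i hx hω.1 hω.2
  have h1 : innerMean p i x = ∫ u in (0 : ℝ)..1, marginal p (i + 1) (setCoord x i (x i * u)) := by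
    rw [intervalIntegral.integral_of_le zero_le_one, ← integral_Icc_eq_integral_Ioc, innerMean,
      integral_prod _ (integrable_comp_of_continuousOn_cube h.continuousOn
        (continuous_splice_setCoord i x) hm)]
    rfl
  simp only [condCDF, condDensity, intervalIntegral.integral_div]
  rw [h1, intervalIntegral.mul_integral_comp_mul_left
    (f := fun τ => marginal p (i + 1) (setCoord x i τ)), mul_zero, mul_one, div_eq_mul_inv]

/-- Fixing coordinate `i` before splicing is the same as resampling it in the integration variable,
so Fubini and `measurePreserving_setCoord` give the result. -/
theorem integral_marginal (h : IsGoodDensity L₁ L₂ p) (i : Fin d) {x : E d} (hx : x ∈ cube d) :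
    ∫ s in (0 : ℝ)..1, marginal p (i + 1) (setCoord x i s) = marginal p i x := by
  have hsp : ∀ (s : ℝ) (t : E d), splice (i + 1) (setCoord x i s) t =
      splice i x (setCoord t i s) := by
    intro s t
    ext j
    simp only [splice_apply, setCoord_apply]
    rcases lt_trichotomy j i with hj | hj | hj
    · have h1 : (j : ℕ) < i := hj
      rw [if_pos (by omega), if_neg hj.ne, if_pos h1]
    · subst hj
      simp
    · have h1 : (i : ℕ) < j := hj
      rw [if_neg (by omega), if_neg (by omega), if_neg hj.ne']
  have hm := (ae_mem_cylinder d).mono fun ω hω =>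
    splice_mem_cube i hx (setCoord_mem_cube hω.2 i hω.1)
  have hc : Continuous fun ω : ℝ × E d => splice i x (setCoord ω.2 i ω.1) :=
    (continuous_splice i x).comp ((continuous_setCoord i).comp continuous_swap)
  have hF : AEStronglyMeasurable (fun t => p (splice i x t)) (volume.restrict (cube d)) :=
    (integrable_comp_of_continuousOn_cube h.continuousOn (continuous_splice i x)
      ((ae_restrict_mem (measurableSet_cube d)).mono fun t ht =>
        splice_mem_cube i hx ht)).aestronglyMeasurable
  rw [intervalIntegral.integral_of_le zero_le_one, ← integral_Icc_eq_integral_Ioc]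
  simp only [marginal, hsp]
  rw [← (measurePreserving_setCoord i).map_eq] at hF
  rw [← integral_prod (fun ω : ℝ × E d => p (splice i x (setCoord ω.2 i ω.1)))
    (integrable_comp_of_continuousOn_cube h.continuousOn hc hm),
    ← integral_map (measurePreserving_setCoord i).aemeasurable hF,
    (measurePreserving_setCoord i).map_eq]

end IsGoodDensity

end KRFlow

namespace KRFlow

/-! ### The Rosenblatt transform -/

theorem abs_div_sub_div_le {a b a' b' l U : ℝ} (hl : 0 < l) (hb : l ≤ b) (hb' : l ≤ b')
    (hbU : b' ≤ U) (ha' : 0 ≤ a') (haU : a' ≤ U) :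
    |a / b - a' / b'| ≤ (|a - a'| + |b - b'|) * U / (l * l) := by
  have hb0 : 0 < b := hl.trans_le hb
  have hb0' : 0 < b' := hl.trans_le hb'
  have hU : 0 ≤ U := hb0'.le.trans hbU
  rw [div_sub_div _ _ hb0.ne' hb0'.ne', abs_div, abs_of_pos (mul_pos hb0 hb0')]
  refine div_le_div₀ (by positivity) ?_ (by positivity) (mul_le_mul hb hb' hl.le hb0.le)
  have e : a * b' - b * a' = (a - a') * b' - (b - b') * a' := by ring
  rw [e, add_mul]
  refine (abs_sub _ _).trans ?_
  rw [abs_mul, abs_mul, abs_of_pos hb0', abs_of_nonneg ha']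
  exact add_le_add (mul_le_mul_of_nonneg_left hbU (abs_nonneg _))
    (mul_le_mul_of_nonneg_left haU (abs_nonneg _))

/-- The Rosenblatt transform of a density: the map of the cube whose `i`-th component is the
conditional distribution function of the `i`-th coordinate. -/
noncomputable def rosenblatt {d : ℕ} (p : E d → ℝ) (x : E d) : E d :=
  WithLp.toLp 2 fun i => condCDF p i x (x i)

theorem rosenblatt_apply {d : ℕ} (p : E d → ℝ) (x : E d) (i : Fin d) :
    rosenblatt p x i = condCDF p i x (x i) := rfl

namespace IsGoodDensity

variable {d : ℕ} {L₁ L₂ : ℝ} {p : E d → ℝ}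

theorem condCDF_one (h : IsGoodDensity L₁ L₂ p) (i : Fin d) {x : E d} (hx : x ∈ cube d) :
    condCDF p i x 1 = 1 := by
  simp only [condCDF, condDensity, intervalIntegral.integral_div]
  rw [h.integral_marginal i hx, div_self]
  exact (h.pos.trans_le (h.marginal_mem_Icc i hx).1).ne'

theorem hasDerivWithinAt_condCDF (h : IsGoodDensity L₁ L₂ p) (i : Fin d) {x : E d}
    (hx : x ∈ cube d) {s : ℝ} (hs : s ∈ Icc (0 : ℝ) 1) :
    HasDerivWithinAt (condCDF p i x) (condDensity p i x s) (Icc 0 1) s := by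
  have : Fact (s ∈ Icc (0 : ℝ) 1) := ⟨hs⟩
  have hc := h.continuousOn_condDensity i hx
  refine intervalIntegral.integral_hasDerivWithinAt_right ?_
    (hc.stronglyMeasurableAtFilter_nhdsWithin measurableSet_Icc s) (hc s hs)
  exact (hc.mono (uIcc_subset_Icc (by simp) hs)).intervalIntegrable

/-- The diagonal derivative of the Rosenblatt transform. -/
noncomputable def _root_.KRFlow.diagDensity (p : E d → ℝ) (i : Fin d) (x : E d) : ℝ :=
  marginal p (i + 1) x / marginal p i x

theorem condDensity_self (i : Fin d) (x : E d) : condDensity p i x (x i) = diagDensity p i x := by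
  rw [condDensity, setCoord_eq, diagDensity]

theorem div_le_diagDensity (h : IsGoodDensity L₁ L₂ p) (i : Fin d) {x : E d} (hx : x ∈ cube d) :
    L₂ / L₁ ≤ diagDensity p i x :=
  div_le_div₀ (h.pos.le.trans (h.marginal_mem_Icc _ hx).1) (h.marginal_mem_Icc _ hx).1
    (h.pos.trans_le (h.marginal_mem_Icc _ hx).1) (h.marginal_mem_Icc _ hx).2

theorem diagDensity_le_div (h : IsGoodDensity L₁ L₂ p) (i : Fin d) {x : E d} (hx : x ∈ cube d) :
    diagDensity p i x ≤ L₁ / L₂ :=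
  div_le_div₀ h.pos'.le (h.marginal_mem_Icc _ hx).2 h.pos (h.marginal_mem_Icc _ hx).1

theorem diagDensity_pos (h : IsGoodDensity L₁ L₂ p) (i : Fin d) {x : E d} (hx : x ∈ cube d) :
    0 < diagDensity p i x :=
  (div_pos h.pos h.pos').trans_le (h.div_le_diagDensity i hx)

theorem abs_marginal_sub_le (h : IsGoodDensity L₁ L₂ p) (k : ℕ) {x y : E d} (hx : x ∈ cube d)
    (hy : y ∈ cube d) : |marginal p k x - marginal p k y| ≤ L₁ * ‖x - y‖ :=
  (convex_cube d).norm_image_sub_le_of_norm_fderivWithin_le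
    ((h.contDiffOn_marginal k).1.differentiableOn one_ne_zero)
    (h.contDiffOn_marginal k).2 hy hx

/-- The diagonal derivative of the Rosenblatt transform is a quotient of marginals, hence Lipschitz
by first-derivative bounds on `p` alone. -/
theorem abs_diagDensity_sub_le (h : IsGoodDensity L₁ L₂ p) (i : Fin d) {x y : E d}
    (hx : x ∈ cube d) (hy : y ∈ cube d) :
    |diagDensity p i x - diagDensity p i y| ≤ (L₁ * L₁ + L₁ * L₁) / (L₂ * L₂) * ‖x - y‖ := by
  have hpos := h.pos
  have hpos' := h.pos'
  refine (abs_div_sub_div_le hpos (h.marginal_mem_Icc i hx).1 (h.marginal_mem_Icc i hy).1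
    (h.marginal_mem_Icc i hy).2 (hpos.le.trans (h.marginal_mem_Icc _ hy).1)
    (h.marginal_mem_Icc _ hy).2).trans ?_
  rw [div_mul_eq_mul_div]
  refine div_le_div_of_nonneg_right ?_ (by positivity)
  have h1 := h.abs_marginal_sub_le (i + 1) hx hy
  have h2 := h.abs_marginal_sub_le i hx hy
  nlinarith

/-- The product telescopes from the total mass 1 to the full density: the Rosenblatt transform has
Jacobian determinant `p`. -/
theorem prod_diagDensity (h : IsGoodDensity L₁ L₂ p) {x : E d} (hx : x ∈ cube d) :
    ∏ i, diagDensity p i x = p x := by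
  have key : ∀ k : ℕ, ∏ i ∈ Finset.range k, (marginal p (i + 1) x / marginal p i x) =
      marginal p k x := by
    intro k
    induction k with
    | zero => rw [Finset.prod_range_zero, h.marginal_zero]
    | succ k ih =>
      rw [Finset.prod_range_succ, ih,
        mul_div_cancel₀ _ (h.pos.trans_le (h.marginal_mem_Icc k hx).1).ne']
  rw [← marginal_self (p := p) x, ← key d]
  exact Fin.prod_univ_eq_prod_range (fun i => marginal p (i + 1) x / marginal p i x) d

/-- Product rule for `x_i * innerMean * marginal⁻¹`: the three summands of the bound come from
differentiating these factors in this order. -/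
theorem contDiffOn_condCDF (h : IsGoodDensity L₁ L₂ p) (i : Fin d) :
    ContDiffOn ℝ 1 (fun x => condCDF p i x (x i)) (cube d) ∧ ∀ x ∈ cube d,
      ‖fderivWithin ℝ (fun x => condCDF p i x (x i)) (cube d) x‖ ≤
        L₁ / L₂ + (L₁ / L₂ + L₁ * (L₁ / L₂ ^ 2)) := by
  have hpos := h.pos
  have hpos' := h.pos'
  have hne : ∀ x ∈ cube d, marginal p i x ≠ 0 := fun x hx =>
    (hpos.trans_le (h.marginal_mem_Icc i hx).1).ne'
  have hproj : ContDiff ℝ 1 fun x : E d => x i := (EuclideanSpace.proj i : E d →L[ℝ] ℝ).contDiff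
  constructor
  · refine ContDiffOn.congr ?_ fun x hx => h.condCDF_eq i hx
    exact (hproj.contDiffOn.mul (h.contDiffOn_innerMean i).1).mul
      ((h.contDiffOn_marginal i).1.inv hne)
  · intro x hx
    have hM := ((h.contDiffOn_innerMean i).1.differentiableOn one_ne_zero x hx).hasFDerivWithinAt
    have hn := ((h.contDiffOn_marginal i).1.differentiableOn one_ne_zero x hx).hasFDerivWithinAt
    have hinv := (hasDerivAt_inv (hne x hx)).comp_hasFDerivWithinAt x hn
    have hx' : HasFDerivWithinAt (fun x : E d => x i) (EuclideanSpace.proj i : E d →L[ℝ] ℝ)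
        (cube d) x := (EuclideanSpace.proj i : E d →L[ℝ] ℝ).hasFDerivWithinAt
    have hder := (hx'.mul hM).mul hinv
    have hder' := hder.congr (f₁ := fun x => condCDF p i x (x i)) (fun y hy => h.condCDF_eq i hy)
      (h.condCDF_eq i hx)
    rw [hder'.fderivWithin (uniqueDiffOn_cube d x hx)]
    have hMb := h.innerMean_mem_Icc i hx
    have hnb := h.marginal_mem_Icc i hx
    have hM' := (h.contDiffOn_innerMean i).2 x hx
    have hn' := (h.contDiffOn_marginal i).2 x hx
    set M := innerMean p i x
    set n := marginal p i x
    set M' := fderivWithin ℝ (innerMean p i) (cube d) x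
    set n' := fderivWithin ℝ (marginal p i) (cube d) x
    have hn0 : 0 < n := hpos.trans_le hnb.1
    have hM0 : 0 < M := hpos.trans_le hMb.1
    have hni : n⁻¹ ≤ L₂⁻¹ := inv_anti₀ hpos hnb.1
    have hproj1 : ‖(EuclideanSpace.proj i : E d →L[ℝ] ℝ)‖ ≤ 1 :=
      ContinuousLinearMap.opNorm_le_bound _ zero_le_one fun v => by
        rw [one_mul]; exact abs_apply_le_norm v i
    have hxM : ‖x i * M‖ ≤ L₁ := by
      rw [norm_mul, Real.norm_of_nonneg (hx i).1, Real.norm_of_nonneg hM0.le]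
      exact (mul_le_of_le_one_left hM0.le (hx i).2).trans hMb.2
    refine (norm_add_le _ _).trans ?_
    rw [add_comm, ← add_assoc]
    refine add_le_add ?_ ?_
    · simp only [Function.comp_apply]
      rw [norm_smul, Real.norm_of_nonneg (inv_nonneg.2 hn0.le)]
      have h1 : ‖x i • M' + M • (EuclideanSpace.proj i : E d →L[ℝ] ℝ)‖ ≤ L₁ + L₁ := by
        refine (norm_add_le _ _).trans (add_le_add ?_ ?_)
        · rw [norm_smul, Real.norm_of_nonneg (hx i).1]
          exact (mul_le_of_le_one_left (norm_nonneg _) (hx i).2).trans hM'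
        · rw [norm_smul, Real.norm_of_nonneg hM0.le]
          exact (mul_le_of_le_one_right hM0.le hproj1).trans hMb.2
      refine (mul_le_mul hni h1 (norm_nonneg _) (inv_nonneg.2 hpos.le)).trans_eq ?_
      ring
    · rw [norm_smul]
      refine mul_le_mul hxM ?_ (norm_nonneg _) hpos'.le
      rw [norm_smul, norm_neg, Real.norm_of_nonneg (by positivity), div_eq_inv_mul]
      refine mul_le_mul (inv_anti₀ (by positivity) ?_) hn' (norm_nonneg _) (by positivity)
      exact pow_le_pow_left₀ hpos.le hnb.1 2

/-- The derivative of a conditional distribution function in its own variable is the conditional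
density, bounded below by `L₂ / L₁`. The factor `d` in the norm bound comes from estimating the
components separately. -/
theorem isTriangular_rosenblatt (h : IsGoodDensity L₁ L₂ p) :
    IsTriangular (L₂ / L₁) (d * (L₁ / L₂ + (L₁ / L₂ + L₁ * (L₁ / L₂ ^ 2)))) (rosenblatt p) ∧
      ∀ x ∈ cube d, ∀ i,
        jac (fderivWithin ℝ (rosenblatt p) (cube d) x) i i = diagDensity p i x := by
  have hC : ContDiffOn ℝ 1 (rosenblatt p) (cube d) :=
    contDiffOn_euclidean.2 fun i => (h.contDiffOn_condCDF i).1
  have hD := hC.differentiableOn one_ne_zero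
  have hdiag : ∀ x ∈ cube d, ∀ i,
      jac (fderivWithin ℝ (rosenblatt p) (cube d) x) i i = diagDensity p i x := by
    intro x hx i
    refine IsTriangular.jac_eq_of_hasDerivWithinAt hD hx i i ?_
    rw [← condDensity_self]
    refine (h.hasDerivWithinAt_condCDF i hx (hx i)).congr (fun s _ => ?_) ?_
    · rw [rosenblatt_apply, setCoord_self]
      exact condCDF_congr p (fun j hj => setCoord_of_ne x hj.ne s) s
    · rw [setCoord_eq, rosenblatt_apply]
  refine ⟨?_, hdiag⟩
  exact
    { pos := div_pos h.pos h.pos'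
      contDiffOn := hC
      norm_le := fun x hx => by
        have hpos := h.pos
        have hpos' := h.pos'
        refine ContinuousLinearMap.opNorm_le_bound _ (by positivity) fun v => ?_
        rw [mul_assoc]
        refine norm_le_of_abs_apply_le fun i => ?_
        have h1 := (EuclideanSpace.proj i : E d →L[ℝ] ℝ).hasFDerivAt.comp_hasFDerivWithinAt x
          (hD x hx).hasFDerivWithinAt
        have h2 := h1.fderivWithin (uniqueDiffOn_cube d x hx)
        have h3 : fderivWithin ℝ (rosenblatt p) (cube d) x v i =
            fderivWithin ℝ (fun x => condCDF p i x (x i)) (cube d) x v := by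
          exact (congrArg (fun B : E d →L[ℝ] ℝ => B v) h2).symm
        rw [h3]
        exact ContinuousLinearMap.le_of_opNorm_le _ ((h.contDiffOn_condCDF i).2 x hx) v
      congr := fun x _ y _ i hxy => by
        rw [rosenblatt_apply, rosenblatt_apply, hxy i le_rfl]
        exact condCDF_congr p (fun j hj => hxy j hj.le) _
      zero := fun x _ i hi => by
        rw [rosenblatt_apply, hi, condCDF, intervalIntegral.integral_same]
      one := fun x hx i hi => by rw [rosenblatt_apply, hi, h.condCDF_one i hx]
      le_diag := fun x hx i => by
        rw [hdiag x hx i]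
        exact h.div_le_diagDensity i hx }

end IsGoodDensity

theorem IsGoodDensity.injOn_condCDF {d : ℕ} {L₁ L₂ : ℝ} {q : E d → ℝ} (hq : IsGoodDensity L₁ L₂ q)
    (i : Fin d) {y : E d} (hy : y ∈ cube d) : InjOn (condCDF q i y) (Icc 0 1) := by
  intro s hs t ht hst
  have h1 : ∀ s, rosenblatt q (setCoord y i s) i = condCDF q i y s := fun s => by
    rw [rosenblatt_apply, setCoord_self]
    exact condCDF_congr q (fun j hj => setCoord_of_ne y hj.ne s) s
  have h2 := hq.isTriangular_rosenblatt.1.mul_abs_sub_le hy i hs ht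
  rw [h1, h1, hst, sub_self, abs_zero] at h2
  have h3 := nonpos_of_mul_nonpos_right h2 (div_pos hq.pos hq.pos')
  exact (sub_eq_zero.1 (abs_nonpos_iff.1 h3)).symm

namespace IsTriangular

theorem mono {d : ℕ} {c K K' : ℝ} {S : E d → E d} (h : IsTriangular c K S) (hK : K ≤ K') :
    IsTriangular c K' S :=
  { h with norm_le := fun x hx => (h.norm_le x hx).trans hK }

theorem congr_eqOn {d : ℕ} {c K : ℝ} {S S' : E d → E d} (h : IsTriangular c K S)
    (he : EqOn S' S (cube d)) : IsTriangular c K S' where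
  pos := h.pos
  contDiffOn := h.contDiffOn.congr he
  norm_le x hx := by rw [fderivWithin_congr he (he hx)]; exact h.norm_le x hx
  congr x hx y hy i hxy := by rw [he hx, he hy]; exact h.congr x hx y hy i hxy
  zero x hx i hi := by rw [he hx]; exact h.zero x hx i hi
  one x hx i hi := by rw [he hx]; exact h.one x hx i hi
  le_diag x hx i := by rw [fderivWithin_congr he (he hx)]; exact h.le_diag x hx i

end IsTriangular

/-! ### The Knothe–Rosenblatt map -/

section KnotheRosenblatt

variable {d : ℕ} {L₁ L₂ : ℝ} {p q : E d → ℝ}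

/-- The `k`-th conditional distribution function sees only earlier coordinates, where the recursion
already agrees with `y`; the zeros in the remaining places are invisible to it. Inverting it at its
own value returns `y_k`. -/
theorem krPartial_apply_of_eq (hq : IsGoodDensity L₁ L₂ q) {x y : E d} (hy : y ∈ cube d)
    (hxy : rosenblatt q y = rosenblatt p x) :
    ∀ (k : ℕ) (i : Fin d), (i : ℕ) < k → krPartial p q k x i = y i := by
  intro k
  induction k with
  | zero => exact fun i hi => absurd hi (Nat.not_lt_zero _)
  | succ k ih =>
    intro i hi
    by_cases hk : k < d
    · have hcdf : condCDF q ⟨k, hk⟩ (krPartial p q k x) = condCDF q ⟨k, hk⟩ y :=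
        funext fun s => condCDF_congr q (fun j hj => ih j hj) s
      have hval : condCDF p ⟨k, hk⟩ x (x ⟨k, hk⟩) = condCDF q ⟨k, hk⟩ y (y ⟨k, hk⟩) := by
        rw [← rosenblatt_apply, ← rosenblatt_apply, hxy]
      rw [krPartial, dif_pos hk, hcdf, hval,
        (hq.injOn_condCDF ⟨k, hk⟩ hy).leftInvOn_invFunOn (hy ⟨k, hk⟩), setCoord_apply]
      split_ifs with hik
      · rw [hik]
      · exact ih i (lt_of_le_of_ne (Nat.lt_succ_iff.1 hi) fun h => hik (Fin.ext h))
    · rw [krPartial, dif_neg hk]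
      exact ih i (i.2.trans_le (not_lt.1 hk))

theorem krMap_eq (hp : IsGoodDensity L₁ L₂ p) (hq : IsGoodDensity L₁ L₂ q) {x : E d}
    (hx : x ∈ cube d) :
    krMap p q x = Function.invFunOn (rosenblatt q) (cube d) (rosenblatt p x) := by
  have hm := hp.isTriangular_rosenblatt.1.mapsTo hx
  have hs := hq.isTriangular_rosenblatt.1.surjOn
  ext i
  exact krPartial_apply_of_eq hq (hs.mapsTo_invFunOn hm) (hs.rightInvOn_invFunOn hm) d i i.2

/-- The Knothe–Rosenblatt map is triangular, with constants depending only on the bounds on the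
densities. -/
theorem exists_isTriangular_krMap (d : ℕ) {L₁ L₂ : ℝ} (hL₁ : 0 < L₁) (hL₂ : 0 < L₂) :
    ∃ c K : ℝ, 0 < c ∧ 0 ≤ K ∧ ∀ p q : E d → ℝ, IsGoodDensity L₁ L₂ p → IsGoodDensity L₁ L₂ q →
      IsTriangular c K (krMap p q) := by
  obtain ⟨K', hK'⟩ := IsTriangular.exists_inverse d (div_pos hL₂ hL₁)
    (K := d * (L₁ / L₂ + (L₁ / L₂ + L₁ * (L₁ / L₂ ^ 2)))) (by positivity)
  set K := d * (L₁ / L₂ + (L₁ / L₂ + L₁ * (L₁ / L₂ ^ 2))) with hK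
  have hK0 : 0 ≤ K := by positivity
  -- Diagonal and norm constants of `R_q⁻¹` (here `1 / (K + 1)` and `K'`) times those of `R_p`; the
  -- maximum with 0 makes nonnegativity immediate.
  refine ⟨1 / (K + 1) * (L₂ / L₁), max 0 (K' * K), by positivity, le_max_left _ _,
    fun p q hp hq => ?_⟩
  exact (((hK' _ hq.isTriangular_rosenblatt.1).comp hp.isTriangular_rosenblatt.1).mono
    (le_max_right 0 _)).congr_eqOn fun x hx => krMap_eq hp hq hx

theorem rosenblatt_krMap (hp : IsGoodDensity L₁ L₂ p) (hq : IsGoodDensity L₁ L₂ q) {x : E d}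
    (hx : x ∈ cube d) : rosenblatt q (krMap p q x) = rosenblatt p x := by
  rw [krMap_eq hp hq hx]
  exact hq.isTriangular_rosenblatt.1.surjOn.rightInvOn_invFunOn
    (hp.isTriangular_rosenblatt.1.mapsTo hx)

/-- Differentiate `R_q ∘ T = R_p` and read off the diagonals, which multiply by triangularity. -/
theorem jac_krMap {c K : ℝ} (hp : IsGoodDensity L₁ L₂ p) (hq : IsGoodDensity L₁ L₂ q)
    (hT : IsTriangular c K (krMap p q)) {x : E d} (hx : x ∈ cube d) (i : Fin d) :
    jac (fderivWithin ℝ (krMap p q) (cube d) x) i i =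
      diagDensity p i x / diagDensity q i (krMap p q x) := by
  have hTx := hT.mapsTo hx
  have h1 := ((hq.isTriangular_rosenblatt.1.hasFDerivWithinAt hTx).comp x
    (hT.hasFDerivWithinAt hx) hT.mapsTo).congr (f₁ := rosenblatt p)
    (fun y hy => (rosenblatt_krMap hp hq hy).symm) (rosenblatt_krMap hp hq hx).symm
  have h2 := hp.isTriangular_rosenblatt.2 x hx i
  rw [h1.fderivWithin (uniqueDiffOn_cube d x hx), hT.diag_comp hx fun i j hij =>
    hq.isTriangular_rosenblatt.1.jac_eq_zero hTx hij,
    hq.isTriangular_rosenblatt.2 _ hTx i] at h2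
  rw [eq_div_iff (hq.diagDensity_pos i hTx).ne', mul_comm]
  exact h2

/-- The change of variables formula for the Knothe–Rosenblatt map. -/
theorem det_krMap {c K : ℝ} (hp : IsGoodDensity L₁ L₂ p) (hq : IsGoodDensity L₁ L₂ q)
    (hT : IsTriangular c K (krMap p q)) {x : E d} (hx : x ∈ cube d) :
    (∏ i, jac (fderivWithin ℝ (krMap p q) (cube d) x) i i) * q (krMap p q x) = p x := by
  have hTx := hT.mapsTo hx
  simp_rw [jac_krMap hp hq hT hx]
  rw [Finset.prod_div_distrib, hp.prod_diagDensity hx, hq.prod_diagDensity hTx,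
    div_mul_cancel₀ _ (hq.pos.trans_le (hq.ge _ hTx)).ne']

/-- The extra regularity on which the divergence comparison rests: the diagonal of `DT` is
Lipschitz, with a constant in `L₁, L₂, K`, without any bound on second derivatives of `T`. -/
theorem abs_jac_krMap_sub_le {c K : ℝ} (hp : IsGoodDensity L₁ L₂ p) (hq : IsGoodDensity L₁ L₂ q)
    (hT : IsTriangular c K (krMap p q)) {x y : E d} (hx : x ∈ cube d) (hy : y ∈ cube d)
    (i : Fin d) :
    |jac (fderivWithin ℝ (krMap p q) (cube d) x) i i -
      jac (fderivWithin ℝ (krMap p q) (cube d) y) i i| ≤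
      ((L₁ * L₁ + L₁ * L₁) / (L₂ * L₂) * (1 + K)) * (L₁ / L₂) / (L₂ / L₁ * (L₂ / L₁)) *
        ‖x - y‖ := by
  rw [jac_krMap hp hq hT hx, jac_krMap hp hq hT hy]
  have hTx := hT.mapsTo hx
  have hTy := hT.mapsTo hy
  have hpos := hp.pos
  have hpos' := hp.pos'
  refine (abs_div_sub_div_le (div_pos hpos hpos') (hq.div_le_diagDensity i hTx)
    (hq.div_le_diagDensity i hTy) (hq.diagDensity_le_div i hTy) (hp.diagDensity_pos i hy).le
    (hp.diagDensity_le_div i hy)).trans ?_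
  have h1 := hp.abs_diagDensity_sub_le i hx hy
  have h2 := (hq.abs_diagDensity_sub_le i hTx hTy).trans
    (mul_le_mul_of_nonneg_left (hT.norm_sub_le hx hy) (by positivity))
  have hU : 0 ≤ L₁ / L₂ := by positivity
  have hl : 0 ≤ L₂ / L₁ * (L₂ / L₁) := by positivity
  refine (div_le_div_of_nonneg_right
    (mul_le_mul_of_nonneg_right (add_le_add h1 h2) hU) hl).trans_eq ?_
  ring

end KnotheRosenblatt

end KRFlow

namespace KRFlow

/-! ### The straight-line velocity field of a triangular map -/

namespace IsTriangular

variable {d : ℕ} {c K : ℝ} {T : E d → E d}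

theorem invFunOn_mem (h : IsTriangular c K T) {y : E d} (hy : y ∈ cube d) :
    Function.invFunOn T (cube d) y ∈ cube d :=
  h.surjOn.mapsTo_invFunOn hy

theorem apply_invFunOn (h : IsTriangular c K T) {y : E d} (hy : y ∈ cube d) :
    T (Function.invFunOn T (cube d) y) = y :=
  h.surjOn.rightInvOn_invFunOn hy

theorem invFunOn_apply (h : IsTriangular c K T) {x : E d} (hx : x ∈ cube d) :
    Function.invFunOn T (cube d) (T x) = x :=
  h.injOn.leftInvOn_invFunOn hx

theorem straightVelocity_interp (h : IsTriangular c K T) {t : ℝ} (ht : t ∈ Icc (0 : ℝ) 1)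
    {x : E d} (hx : x ∈ cube d) : straightVelocity T (KRFlow.interp T t x) t = T x - x := by
  rw [straightVelocity, (h.interp ht).invFunOn_apply hx]

theorem norm_sub_le_two_mul (h : IsTriangular c K T) {x : E d} (hx : x ∈ cube d) :
    ‖T x - x‖ ≤ 2 * d := by
  have h1 := norm_le_of_mem_cube (h.mapsTo hx)
  have h2 := norm_le_of_mem_cube hx
  linarith [_root_.norm_sub_le (T x) x]

theorem isSolution_interp (h : IsTriangular c K T) {x : E d} (hx : x ∈ cube d) :
    IsSolution (straightVelocity T) x fun t => KRFlow.interp T t x where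
  initial := by simp [KRFlow.interp]
  mem_cube t ht := (h.interp ht).mapsTo hx
  hasDerivWithinAt t ht := by
    rw [h.straightVelocity_interp ht hx]
    have h1 := (((hasDerivAt_id t).const_sub 1).smul_const x).add
      ((hasDerivAt_id t).smul_const (T x))
    refine (h1.congr_deriv ?_).hasDerivWithinAt
    simp [sub_eq_neg_add]

/-- Uniform estimates for the inverses of the interpolants. -/
theorem exists_interp_inverse (d : ℕ) {c K : ℝ} (hc : 0 < c) (hK : 0 ≤ K) :
    ∃ A : ℝ, 0 ≤ A ∧ ∀ T : E d → E d, IsTriangular c K T → ∀ t ∈ Icc (0 : ℝ) 1,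
      IsTriangular (1 / (1 + K + 1)) A (Function.invFunOn (KRFlow.interp T t) (cube d)) := by
  obtain ⟨A, hA⟩ := exists_inverse d (lt_min zero_lt_one hc) (K := 1 + K) (by positivity)
  exact ⟨max 0 A, le_max_left _ _, fun T h t ht =>
    (hA _ (h.interp ht)).mono (le_max_right _ _)⟩

theorem hasFDerivWithinAt_straightVelocity {c' A : ℝ} (h : IsTriangular c K T) {t : ℝ}
    (hR : IsTriangular c' A (Function.invFunOn (KRFlow.interp T t) (cube d)))
    {y : E d} (hy : y ∈ cube d) :
    HasFDerivWithinAt (fun y => straightVelocity T y t)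
      ((fderivWithin ℝ T (cube d) (Function.invFunOn (KRFlow.interp T t) (cube d) y) -
        ContinuousLinearMap.id ℝ (E d)).comp
        (fderivWithin ℝ (Function.invFunOn (KRFlow.interp T t) (cube d)) (cube d) y))
      (cube d) y :=
  HasFDerivWithinAt.comp (g := fun x => T x - x) (t := cube d) y
    ((h.hasFDerivWithinAt (hR.mapsTo hy)).sub (hasFDerivWithinAt_id _ _))
    (hR.hasFDerivWithinAt hy) hR.mapsTo

theorem contDiffOn_straightVelocity {c' A : ℝ} (h : IsTriangular c K T) {t : ℝ}
    (hR : IsTriangular c' A (Function.invFunOn (KRFlow.interp T t) (cube d))) :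
    ContDiffOn ℝ 1 (fun y => straightVelocity T y t) (cube d) :=
  (h.contDiffOn.comp hR.contDiffOn hR.mapsTo).sub hR.contDiffOn

theorem norm_fderivWithin_straightVelocity_le {c' A : ℝ} (h : IsTriangular c K T) {t : ℝ}
    (hR : IsTriangular c' A (Function.invFunOn (KRFlow.interp T t) (cube d)))
    {y : E d} (hy : y ∈ cube d) :
    ‖fderivWithin ℝ (fun y => straightVelocity T y t) (cube d) y‖ ≤ (K + 1) * A := by
  rw [(h.hasFDerivWithinAt_straightVelocity hR hy).fderivWithin (uniqueDiffOn_cube d y hy)]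
  refine (ContinuousLinearMap.opNorm_comp_le _ _).trans
    (mul_le_mul ?_ (hR.norm_le y hy) (norm_nonneg _) (by linarith [h.nonneg]))
  exact (_root_.norm_sub_le _ _).trans (add_le_add (h.norm_le _ (hR.mapsTo hy))
    ContinuousLinearMap.norm_id_le)

theorem norm_straightVelocity_le (h : IsTriangular c K T) {t : ℝ} (ht : t ∈ Icc (0 : ℝ) 1)
    {y : E d} (hy : y ∈ cube d) : ‖straightVelocity T y t‖ ≤ 2 * d :=
  h.norm_sub_le_two_mul ((h.interp ht).invFunOn_mem hy)

theorem lipschitzOnWith_straightVelocity {c' A : ℝ} (h : IsTriangular c K T) {t : ℝ}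
    (hR : IsTriangular c' A (Function.invFunOn (KRFlow.interp T t) (cube d))) :
    LipschitzOnWith ((K + 1) * A).toNNReal (fun y => straightVelocity T y t) (cube d) :=
  (convex_cube d).lipschitzOnWith_of_nnnorm_fderivWithin_le
    ((h.contDiffOn_straightVelocity hR).differentiableOn one_ne_zero) fun _ hy =>
      NNReal.coe_le_coe.1 <| by
        rw [coe_nnnorm]
        exact (h.norm_fderivWithin_straightVelocity_le hR hy).trans (Real.le_coe_toNNReal _)

/-- The divergence of the straight-line velocity field. -/
theorem trace_straightVelocity {c' A : ℝ} (h : IsTriangular c K T) {t : ℝ}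
    (ht : t ∈ Icc (0 : ℝ) 1)
    (hR : IsTriangular c' A (Function.invFunOn (KRFlow.interp T t) (cube d)))
    {x : E d} (hx : x ∈ cube d) :
    (jac (fderivWithin ℝ (fun y => straightVelocity T y t) (cube d)
      (KRFlow.interp T t x))).trace =
      ∑ i, (jac (fderivWithin ℝ T (cube d) x) i i - 1) /
        (1 + t * (jac (fderivWithin ℝ T (cube d) x) i i - 1)) := by
  have hI := h.interp ht
  have hy := hI.mapsTo hx
  -- The field is `(T - id) ∘ T_t⁻¹`. Differentiating `T_t ∘ T_t⁻¹ = id` identifies the diagonal of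
  -- `D(T_t⁻¹)` as the reciprocals of `1 + t * (a_i - 1)`, where `a_i` is the diagonal of `DT`.
  have hid : (fderivWithin ℝ (KRFlow.interp T t) (cube d) x).comp
      (fderivWithin ℝ (Function.invFunOn (KRFlow.interp T t) (cube d)) (cube d)
        (KRFlow.interp T t x)) = ContinuousLinearMap.id ℝ (E d) := by
    have h0 := hI.hasFDerivWithinAt (hR.mapsTo hy)
    rw [hI.invFunOn_apply hx] at h0
    have h1 := HasFDerivWithinAt.comp (t := cube d)
      (f := Function.invFunOn (KRFlow.interp T t) (cube d)) (KRFlow.interp T t x)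
      (by rw [hI.invFunOn_apply hx]; exact h0) (hR.hasFDerivWithinAt hy) hR.mapsTo
    have h2 : HasFDerivWithinAt (KRFlow.interp T t ∘ Function.invFunOn (KRFlow.interp T t) (cube d))
        (ContinuousLinearMap.id ℝ (E d)) (cube d) (KRFlow.interp T t x) :=
      (hasFDerivWithinAt_id _ _).congr (fun z hz => hI.apply_invFunOn hz)
        (hI.apply_invFunOn hy)
    exact (uniqueDiffOn_cube d _ hy).eq h1 h2
  rw [(h.hasFDerivWithinAt_straightVelocity hR hy).fderivWithin (uniqueDiffOn_cube d _ hy),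
    hI.invFunOn_apply hx, Matrix.trace]
  refine Finset.sum_congr rfl fun i _ => ?_
  have h3 := congrArg (fun B => jac B i i) hid
  simp only [jac_id, Matrix.one_apply_eq] at h3
  rw [hR.diag_comp hy fun i j hij => hI.jac_eq_zero hx hij, h.jac_interp t hx] at h3
  have hne : 1 + t * (jac (fderivWithin ℝ T (cube d) x) i i - 1) ≠ 0 := fun h0 => by
    rw [h0, zero_mul] at h3
    exact zero_ne_one h3
  rw [Matrix.diag_apply, hR.diag_comp hy fun i j hij => ?_, eq_div_iff hne]
  · rw [jac_sub, jac_id, Matrix.sub_apply, Matrix.one_apply_eq, mul_assoc,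
      mul_comm _ (1 + t * _), h3, mul_one]
  · rw [jac_sub, jac_id, Matrix.sub_apply, h.jac_eq_zero hx hij, Matrix.one_apply_ne hij.ne,
      sub_zero]

/-- For fixed `z`, moving from time `s` to time `t` displaces `T_s z` by `(t - s) • (T z - z)`, of
norm at most `|s - t| * (2 * d)`. Combined with the Lipschitz bound for `T_t⁻¹`, this gives joint
continuity in space and time. -/
theorem norm_invFunOn_interp_sub_le {c' A : ℝ} (h : IsTriangular c K T) {s t : ℝ}
    (hs : s ∈ Icc (0 : ℝ) 1) (ht : t ∈ Icc (0 : ℝ) 1)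
    (hR : IsTriangular c' A (Function.invFunOn (KRFlow.interp T t) (cube d)))
    {x y : E d} (hx : x ∈ cube d) (hy : y ∈ cube d) :
    ‖Function.invFunOn (KRFlow.interp T t) (cube d) x -
      Function.invFunOn (KRFlow.interp T s) (cube d) y‖ ≤ A * (‖x - y‖ + |s - t| * (2 * d)) := by
  set z := Function.invFunOn (KRFlow.interp T s) (cube d) y with hz
  have hzm : z ∈ cube d := (h.interp hs).invFunOn_mem hy
  have hzy : KRFlow.interp T s z = y := (h.interp hs).apply_invFunOn hy
  have h1 := hR.norm_sub_le hx ((h.interp ht).mapsTo hzm)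
  rw [(h.interp ht).invFunOn_apply hzm] at h1
  refine h1.trans (mul_le_mul_of_nonneg_left ?_ hR.nonneg)
  have e : x - KRFlow.interp T t z = (x - y) + (s - t) • (T z - z) := by
    rw [← hzy, KRFlow.interp, KRFlow.interp]
    module
  rw [e]
  refine (norm_add_le _ _).trans (add_le_add le_rfl ?_)
  rw [norm_smul, Real.norm_eq_abs]
  exact mul_le_mul_of_nonneg_left (h.norm_sub_le_two_mul hzm) (abs_nonneg _)

theorem continuousOn_straightVelocity {c' A : ℝ} (h : IsTriangular c K T)
    (hR : ∀ t ∈ Icc (0 : ℝ) 1,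
      IsTriangular c' A (Function.invFunOn (KRFlow.interp T t) (cube d))) :
    ContinuousOn (fun z : E d × ℝ => straightVelocity T z.1 z.2) (cube d ×ˢ Icc 0 1) := by
  have h1 : LipschitzOnWith (A * (1 + 2 * d)).toNNReal
      (fun z : E d × ℝ => Function.invFunOn (KRFlow.interp T z.2) (cube d) z.1)
      (cube d ×ˢ Icc 0 1) := by
    refine LipschitzOnWith.of_dist_le_mul fun z hz w hw => ?_
    have h2 := h.norm_invFunOn_interp_sub_le hw.2 hz.2 (hR _ hz.2) hz.1 hw.1
    have hA : 0 ≤ A := (hR _ hz.2).nonneg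
    rw [dist_eq_norm]
    refine h2.trans (le_trans ?_
      (mul_le_mul_of_nonneg_right (Real.le_coe_toNNReal _) dist_nonneg))
    rw [mul_assoc]
    refine mul_le_mul_of_nonneg_left ?_ hA
    have h3 : ‖z.1 - w.1‖ ≤ dist z w := by
      rw [← dist_eq_norm, Prod.dist_eq]; exact le_max_left _ _
    have h4 : |w.2 - z.2| ≤ dist z w := by
      rw [abs_sub_comm, ← Real.dist_eq, Prod.dist_eq]; exact le_max_right _ _
    have h5 : |w.2 - z.2| * (2 * d) ≤ dist z w * (2 * d) :=
      mul_le_mul_of_nonneg_right h4 (by positivity)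
    linarith
  have hm : MapsTo (fun z : E d × ℝ => Function.invFunOn (KRFlow.interp T z.2) (cube d) z.1)
      (cube d ×ˢ Icc 0 1) (cube d) := fun z hz => (h.interp hz.2).invFunOn_mem hz.1
  exact (h.contDiffOn.continuousOn.comp h1.continuousOn hm).sub h1.continuousOn

theorem wellPosed_straightVelocity {c' A : ℝ} (h : IsTriangular c K T)
    (hR : ∀ t ∈ Icc (0 : ℝ) 1,
      IsTriangular c' A (Function.invFunOn (KRFlow.interp T t) (cube d))) :
    WellPosed (straightVelocity T) :=
  wellPosed_of_isSolution (h.continuousOn_straightVelocity hR)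
    (fun t ht => h.lipschitzOnWith_straightVelocity (hR t ht)) fun _ hx =>
      ⟨_, h.isSolution_interp hx⟩

theorem flowMap_straightVelocity {c' A : ℝ} (h : IsTriangular c K T)
    (hR : ∀ t ∈ Icc (0 : ℝ) 1,
      IsTriangular c' A (Function.invFunOn (KRFlow.interp T t) (cube d)))
    {x : E d} (hx : x ∈ cube d) : flowMap (straightVelocity T) x 1 = T x := by
  have h1 := ((h.wellPosed_straightVelocity hR).isTrajectory_flowMap hx).isSolution
    (h.continuousOn_straightVelocity hR)
  have h2 := h1.eqOn (fun t ht => h.lipschitzOnWith_straightVelocity (hR t ht))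
    (h.isSolution_interp hx) (show (1 : ℝ) ∈ Icc (0 : ℝ) 1 by simp)
  rw [h2]
  simp [KRFlow.interp]

end IsTriangular

end KRFlow

namespace KRFlow

/-! ### The Kullback–Leibler divergence of measures with comparable densities -/

/-- From `log x ≤ x - 1 ≤ x log x` one gets `klFun x ≤ (x + 1) (log x)²` for every positive `x`. No
smallness of `ε` is needed, so no a priori bound on the distance of the fields enters the constant.
-/
theorem klFun_le_of_abs_log_le {x ε : ℝ} (hx : 0 < x) (h : |Real.log x| ≤ ε) :
    InformationTheory.klFun x ≤ ε ^ 2 * (x + 1) := by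
  have h1 := Real.log_le_sub_one_of_pos hx
  have h2 := Real.one_sub_inv_le_log_of_pos hx
  rw [InformationTheory.klFun_apply]
  set l := Real.log x
  have h3 : x - 1 ≤ x * l := by
    have := mul_le_mul_of_nonneg_left h2 hx.le
    rwa [mul_sub, mul_one, mul_inv_cancel₀ hx.ne'] at this
  have h4 : l ^ 2 ≤ ε ^ 2 := by
    rw [← sq_abs]
    exact pow_le_pow_left₀ (abs_nonneg _) h 2
  have h5 : x * l + 1 - x ≤ (x + 1) * l ^ 2 := by
    rcases le_total 0 l with hl | hl
    · nlinarith [mul_le_mul_of_nonneg_right h3 hl, sq_nonneg l]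
    · nlinarith [mul_le_mul_of_nonpos_right h1 hl, mul_nonneg hx.le (sq_nonneg l)]
  nlinarith

/-- Comparison on all measurable sets puts the Radon–Nikodym derivative between `exp (-ε)` and `exp
ε` almost everywhere. Integrating `ε² (x + 1)` against `ν` gives `2 ε²`, both measures having mass
one. -/
theorem klDiv_le_of_le_mul {α : Type*} [MeasurableSpace α] {μ ν : Measure α}
    [IsProbabilityMeasure μ] [IsProbabilityMeasure ν] {ε : ℝ}
    (h₁ : ∀ s, MeasurableSet s → ν s ≤ ENNReal.ofReal (Real.exp ε) * μ s)
    (h₂ : ∀ s, MeasurableSet s → μ s ≤ ENNReal.ofReal (Real.exp ε) * ν s) :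
    InformationTheory.klDiv μ ν ≤ ENNReal.ofReal (2 * ε ^ 2) := by
  have hac : μ ≪ ν := Measure.AbsolutelyContinuous.mk fun s hs h0 => by
    have := h₂ s hs
    rwa [h0, mul_zero, nonpos_iff_eq_zero] at this
  have hup : μ.rnDeriv ν ≤ᵐ[ν] fun _ => ENNReal.ofReal (Real.exp ε) :=
    ae_le_of_forall_setLIntegral_le_of_sigmaFinite (Measure.measurable_rnDeriv _ _)
      fun s hs _ => by
        rw [Measure.setLIntegral_rnDeriv hac, setLIntegral_const]
        exact h₂ s hs
  have hlow : (fun _ => ENNReal.ofReal (Real.exp (-ε))) ≤ᵐ[ν] μ.rnDeriv ν :=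
    ae_le_of_forall_setLIntegral_le_of_sigmaFinite measurable_const fun s hs _ => by
      rw [Measure.setLIntegral_rnDeriv hac, setLIntegral_const]
      refine (mul_le_mul_right (h₁ s hs) _).trans_eq ?_
      rw [← mul_assoc, ← ENNReal.ofReal_mul (Real.exp_pos _).le, ← Real.exp_add]
      simp
  rw [InformationTheory.klDiv_eq_lintegral_klFun_of_ac hac]
  have hpt : ∀ᵐ x ∂ν, ENNReal.ofReal (InformationTheory.klFun (μ.rnDeriv ν x).toReal) ≤
      ENNReal.ofReal (ε ^ 2) * (μ.rnDeriv ν x + 1) := by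
    filter_upwards [hup, hlow] with x hx1 hx2
    have hfin : μ.rnDeriv ν x ≠ ⊤ := ne_top_of_le_ne_top ENNReal.ofReal_ne_top hx1
    have h1 : (μ.rnDeriv ν x).toReal ≤ Real.exp ε :=
      ENNReal.toReal_le_of_le_ofReal (Real.exp_pos _).le hx1
    have h2 : Real.exp (-ε) ≤ (μ.rnDeriv ν x).toReal := (ENNReal.ofReal_le_iff_le_toReal hfin).1 hx2
    have hpos : 0 < (μ.rnDeriv ν x).toReal := (Real.exp_pos _).trans_le h2
    have h3 : |Real.log (μ.rnDeriv ν x).toReal| ≤ ε :=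
      abs_le.2 ⟨(Real.le_log_iff_exp_le hpos).2 h2, (Real.log_le_iff_le_exp hpos).2 h1⟩
    have h4 : μ.rnDeriv ν x + 1 = ENNReal.ofReal ((μ.rnDeriv ν x).toReal + 1) := by
      rw [ENNReal.ofReal_add hpos.le zero_le_one, ENNReal.ofReal_toReal hfin, ENNReal.ofReal_one]
    rw [h4, ← ENNReal.ofReal_mul (sq_nonneg ε)]
    exact ENNReal.ofReal_le_ofReal (klFun_le_of_abs_log_le hpos h3)
  refine (lintegral_mono_ae hpt).trans_eq ?_
  rw [lintegral_const_mul _ ((Measure.measurable_rnDeriv _ _).add_const 1),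
    lintegral_add_right _ measurable_const, Measure.lintegral_rnDeriv hac, lintegral_one,
    measure_univ, measure_univ, mul_comm (2 : ℝ), ENNReal.ofReal_mul (sq_nonneg ε)]
  norm_num

/-! ### Change of variables on the cube -/

section ChangeOfVariables

variable {d : ℕ} {p q : E d → ℝ} {Φ : E d → E d} {Φ' : E d → E d →L[ℝ] E d}

theorem aemeasurable_withDensity_of_continuousOn (hΦ : ContinuousOn Φ (cube d)) {w : E d → ℝ≥0∞} :
    AEMeasurable Φ ((volume.restrict (cube d)).withDensity w) :=
  (hΦ.aemeasurable (measurableSet_cube d)).mono_ac (withDensity_absolutelyContinuous _ _)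

theorem map_withDensity_apply (hΦ : ContinuousOn Φ (cube d)) (w : E d → ℝ≥0∞) {B : Set (E d)}
    (hB : MeasurableSet B) :
    ((volume.restrict (cube d)).withDensity w).map Φ B = ∫⁻ x in Φ ⁻¹' B ∩ cube d, w x := by
  rw [Measure.map_apply_of_aemeasurable (aemeasurable_withDensity_of_continuousOn hΦ) hB,
    withDensity_apply', Measure.restrict_restrict' (measurableSet_cube d)]

theorem measurableSet_preimage_inter_cube (hΦ : ContinuousOn Φ (cube d)) {B : Set (E d)}
    (hB : MeasurableSet B) : MeasurableSet (Φ ⁻¹' B ∩ cube d) := by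
  have h1 : MeasurableSet ((cube d).domRestrict Φ ⁻¹' B) :=
    hΦ.domRestrict.measurable hB
  have h2 := (measurableSet_cube d).subtype_image h1
  have e : (Subtype.val '' ((cube d).domRestrict Φ ⁻¹' B) : Set (E d)) = Φ ⁻¹' B ∩ cube d := by
    ext x
    simp only [mem_image, mem_preimage, domRestrict_apply, Subtype.exists, mem_inter_iff]
    constructor
    · rintro ⟨a, ha, haB, rfl⟩
      exact ⟨haB, ha⟩
    · rintro ⟨hx1, hx2⟩
      exact ⟨x, hx2, hx1, rfl⟩
  rwa [e] at h2

theorem withDensity_apply_eq_lintegral_det (hb : BijOn Φ (cube d) (cube d))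
    (hΦ' : ∀ x ∈ cube d, HasFDerivWithinAt Φ (Φ' x) (cube d) x) (w : E d → ℝ≥0∞) {B : Set (E d)}
    (hB : MeasurableSet B) :
    (volume.restrict (cube d)).withDensity w B =
      ∫⁻ x in Φ ⁻¹' B ∩ cube d, ENNReal.ofReal |(Φ' x).det| * w (Φ x) := by
  have hc : ContinuousOn Φ (cube d) := fun x hx => (hΦ' x hx).continuousWithinAt
  have him : Φ '' (Φ ⁻¹' B ∩ cube d) = B ∩ cube d := by
    ext y
    constructor
    · rintro ⟨x, ⟨hx1, hx2⟩, rfl⟩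
      exact ⟨hx1, hb.mapsTo hx2⟩
    · rintro ⟨hy1, hy2⟩
      obtain ⟨x, hx, rfl⟩ := hb.surjOn hy2
      exact ⟨x, ⟨hy1, hx⟩, rfl⟩
  rw [withDensity_apply', Measure.restrict_restrict' (measurableSet_cube d), ← him]
  exact lintegral_image_eq_lintegral_abs_det_fderiv_mul volume
    (measurableSet_preimage_inter_cube hc hB)
    (fun x hx => (hΦ' x hx.2).mono inter_subset_right) (hb.injOn.mono inter_subset_right) w

/-- A pointwise comparison of the transported density of `p` with `q` gives a comparison of the
measures. -/
theorem map_withDensity_comparable (hb : BijOn Φ (cube d) (cube d))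
    (hΦ' : ∀ x ∈ cube d, HasFDerivWithinAt Φ (Φ' x) (cube d) x) {ε : ℝ}
    (h₁ : ∀ x ∈ cube d, |(Φ' x).det| * q (Φ x) ≤ Real.exp ε * p x)
    (h₂ : ∀ x ∈ cube d, p x ≤ Real.exp ε * (|(Φ' x).det| * q (Φ x))) {B : Set (E d)}
    (hB : MeasurableSet B) :
    (volume.restrict (cube d)).withDensity (fun x => ENNReal.ofReal (q x)) B ≤
        ENNReal.ofReal (Real.exp ε) *
          ((volume.restrict (cube d)).withDensity fun x => ENNReal.ofReal (p x)).map Φ B ∧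
      ((volume.restrict (cube d)).withDensity fun x => ENNReal.ofReal (p x)).map Φ B ≤
        ENNReal.ofReal (Real.exp ε) *
          (volume.restrict (cube d)).withDensity (fun x => ENNReal.ofReal (q x)) B := by
  have hc : ContinuousOn Φ (cube d) := fun x hx => (hΦ' x hx).continuousWithinAt
  have hA := measurableSet_preimage_inter_cube hc hB
  rw [map_withDensity_apply hc _ hB, withDensity_apply_eq_lintegral_det hb hΦ' _ hB,
    ← lintegral_const_mul' _ _ ENNReal.ofReal_ne_top, ← lintegral_const_mul' _ _ ENNReal.ofReal_ne_top]
  constructor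
  · refine setLIntegral_mono' hA fun x hx => ?_
    rw [← ENNReal.ofReal_mul (abs_nonneg _), ← ENNReal.ofReal_mul (Real.exp_pos _).le]
    exact ENNReal.ofReal_le_ofReal (h₁ x hx.2)
  · refine setLIntegral_mono' hA fun x hx => ?_
    rw [← ENNReal.ofReal_mul (abs_nonneg _), ← ENNReal.ofReal_mul (Real.exp_pos _).le]
    exact ENNReal.ofReal_le_ofReal (h₂ x hx.2)

end ChangeOfVariables

/-! ### The distance of velocity fields -/

theorem cNorm_one_le {X Y : Type*} [NormedAddCommGroup X] [NormedSpace ℝ X]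
    [NormedAddCommGroup Y] [NormedSpace ℝ Y] {S : Set X} (hS : UniqueDiffOn ℝ S) {f : X → Y}
    {C : ℝ} (h₀ : ∀ x ∈ S, ‖f x‖ ≤ C) (h₁ : ∀ x ∈ S, ‖fderivWithin ℝ f S x‖ ≤ C) :
    cNorm 1 S f ≤ ENNReal.ofReal C := by
  refine iSup₂_le fun n hn => iSup₂_le fun x hx => ?_
  rw [← ofReal_norm]
  refine ENNReal.ofReal_le_ofReal ?_
  interval_cases n
  · rw [norm_iteratedFDerivWithin_zero]; exact h₀ x hx
  · rw [norm_iteratedFDerivWithin_one f (hS x hx)]; exact h₁ x hx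

end KRFlow

namespace KRFlow

/-! ### Comparison of the flow of an ansatz field with the displacement interpolation -/

/-- Over the common denominator the numerator collapses to `a - b`, whatever `t` is. -/
theorem abs_log_derivative_sub_le {m t a b : ℝ} (hm : 0 < m) (ha : m ≤ 1 + t * (a - 1))
    (hb : m ≤ 1 + t * (b - 1)) :
    |(a - 1) / (1 + t * (a - 1)) - (b - 1) / (1 + t * (b - 1))| ≤ |a - b| / (m * m) := by
  have ha' := hm.trans_le ha
  have hb' := hm.trans_le hb
  have e : (a - 1) / (1 + t * (a - 1)) - (b - 1) / (1 + t * (b - 1)) =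
      (a - b) / ((1 + t * (a - 1)) * (1 + t * (b - 1))) := by
    rw [div_sub_div _ _ ha'.ne' hb'.ne']
    congr 1
    ring
  rw [e, abs_div, abs_of_pos (mul_pos ha' hb')]
  exact div_le_div_of_nonneg_left (abs_nonneg _) (mul_pos hm hm)
    (mul_le_mul ha hb hm.le ha'.le)

namespace IsTriangular

variable {d : ℕ} {c K c' A δ : ℝ} {T : E d → E d} {g : E d → ℝ → E d}

theorem min_le_interp_diag (h : IsTriangular c K T) {t : ℝ} (ht : t ∈ Icc (0 : ℝ) 1) {x : E d}
    (hx : x ∈ cube d) (i : Fin d) :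
    min 1 c ≤ 1 + t * (jac (fderivWithin ℝ T (cube d) x) i i - 1) := by
  rw [← h.jac_interp t hx]
  exact (h.interp ht).le_diag x hx i

/-- The trajectory of `g` is treated as an approximate solution for the straight-line field, so
Grönwall's exponent is the Lipschitz constant of the latter and nothing about `g` beyond `δ`
appears. -/
theorem norm_flowMap_sub_interp_le (h : IsTriangular c K T)
    (hR : ∀ t ∈ Icc (0 : ℝ) 1,
      IsTriangular c' A (Function.invFunOn (KRFlow.interp T t) (cube d)))
    (hg : IsTangentField g) (hδ : 0 ≤ δ)
    (h₀ : ∀ t ∈ Icc (0 : ℝ) 1, ∀ x ∈ cube d, ‖straightVelocity T x t - g x t‖ ≤ δ)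
    {x : E d} (hx : x ∈ cube d) {t : ℝ} (ht : t ∈ Icc (0 : ℝ) 1) :
    ‖flowMap g x t - KRFlow.interp T t x‖ ≤ δ * Real.exp ((K + 1) * A) := by
  have hf := h.isSolution_interp hx
  have hγ := hg.isSolution_flowMap hx
  have h1 := dist_le_of_approx_trajectories_ODE_of_mem (v := fun t x => straightVelocity T x t)
    (s := fun _ => cube d) (εf := δ) (εg := 0) (δ := 0)
    (fun t ht => h.lipschitzOnWith_straightVelocity (hR t (Ico_subset_Icc_self ht)))
    hγ.continuousOn
    (fun t ht => (hγ.hasDerivWithinAt t (Ico_subset_Icc_self ht)).Ici_of_Icc ht)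
    (fun t ht => by
      rw [dist_comm, dist_eq_norm]
      exact h₀ t (Ico_subset_Icc_self ht) _ (hγ.mem_cube t (Ico_subset_Icc_self ht)))
    (fun t ht => hγ.mem_cube t (Ico_subset_Icc_self ht)) hf.continuousOn
    (fun t ht => (hf.hasDerivWithinAt t (Ico_subset_Icc_self ht)).Ici_of_Icc ht)
    (fun t _ => (dist_self _).le)
    (fun t ht => hf.mem_cube t (Ico_subset_Icc_self ht))
    (by rw [hf.initial, hγ.initial, dist_self]) t ht
  have hA : 0 ≤ A := (hR t ht).nonneg
  rw [dist_eq_norm, sub_zero, add_zero,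
    Real.coe_toNNReal _ (mul_nonneg (by linarith [h.nonneg]) hA)] at h1
  exact h1.trans (gronwallBound_zero_le (mul_nonneg (by linarith [h.nonneg]) hA) hδ ht)

/-- The divergence of `g` along its trajectory is close to the one of the straight-line velocity
field along the corresponding straight line. -/
theorem abs_trace_sub_le {Lam : ℝ} (h : IsTriangular c K T)
    (hR : ∀ t ∈ Icc (0 : ℝ) 1,
      IsTriangular c' A (Function.invFunOn (KRFlow.interp T t) (cube d)))
    (hLam : 0 ≤ Lam)
    (hT : ∀ x ∈ cube d, ∀ y ∈ cube d, ∀ i, |jac (fderivWithin ℝ T (cube d) x) i i -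
      jac (fderivWithin ℝ T (cube d) y) i i| ≤ Lam * ‖x - y‖)
    (hg : IsTangentField g) (hδ : 0 ≤ δ)
    (h₀ : ∀ t ∈ Icc (0 : ℝ) 1, ∀ x ∈ cube d, ‖straightVelocity T x t - g x t‖ ≤ δ)
    (h₁ : ∀ t ∈ Icc (0 : ℝ) 1, ∀ x ∈ cube d,
      ‖fderivWithin ℝ (fun y => straightVelocity T y t - g y t) (cube d) x‖ ≤ δ)
    {x : E d} (hx : x ∈ cube d) {t : ℝ} (ht : t ∈ Icc (0 : ℝ) 1) :
    |(jac (fderivWithin ℝ (fun y => g y t) (cube d) (flowMap g x t))).trace -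
      ∑ i, (jac (fderivWithin ℝ T (cube d) x) i i - 1) /
        (1 + t * (jac (fderivWithin ℝ T (cube d) x) i i - 1))| ≤
      (d + d * (Lam * (A * Real.exp ((K + 1) * A)) / (min 1 c * min 1 c))) * δ := by
  set m := min 1 c with hm
  have hm0 : 0 < m := lt_min one_pos h.pos
  have hA : 0 ≤ A := (hR t ht).nonneg
  set y := flowMap g x t with hy_def
  have hy : y ∈ cube d := (hg.isSolution_flowMap hx).mem_cube t ht
  -- The straight line passing through `y` at time `t` starts at `z`. Below, `h3` compares the two
  -- divergences at `y`, and `h4` replaces `z` by `x` through the Lipschitz diagonal.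
  set z := Function.invFunOn (KRFlow.interp T t) (cube d) y with hz_def
  have hz : z ∈ cube d := (h.interp ht).invFunOn_mem hy
  have hzy : KRFlow.interp T t z = y := (h.interp ht).apply_invFunOn hy
  have hzx : ‖z - x‖ ≤ A * (δ * Real.exp ((K + 1) * A)) := by
    have h2 := (hR t ht).norm_sub_le hy ((h.interp ht).mapsTo hx)
    rw [(h.interp ht).invFunOn_apply hx] at h2
    exact h2.trans (mul_le_mul_of_nonneg_left
      (h.norm_flowMap_sub_interp_le hR hg hδ h₀ hx ht) hA)
  have htr := h.trace_straightVelocity ht (hR t ht) hz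
  rw [hzy] at htr
  have h3 : |(jac (fderivWithin ℝ (fun y => straightVelocity T y t) (cube d) y)).trace -
      (jac (fderivWithin ℝ (fun y => g y t) (cube d) y)).trace| ≤ d * δ := by
    rw [← Matrix.trace_sub, ← jac_sub, ← fderivWithin_fun_sub (uniqueDiffOn_cube d y hy)
      (((h.contDiffOn_straightVelocity (hR t ht)).differentiableOn one_ne_zero) y hy)
      (hg.differentiableOn ht y hy)]
    exact (abs_trace_jac_le _).trans (mul_le_mul_of_nonneg_left (h₁ t ht y hy) (by positivity))
  have h4 : |(jac (fderivWithin ℝ (fun y => straightVelocity T y t) (cube d) y)).trace -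
      ∑ i, (jac (fderivWithin ℝ T (cube d) x) i i - 1) /
        (1 + t * (jac (fderivWithin ℝ T (cube d) x) i i - 1))| ≤
      d * (Lam * (A * (δ * Real.exp ((K + 1) * A))) / (m * m)) := by
    rw [htr, ← Finset.sum_sub_distrib]
    refine (Finset.abs_sum_le_sum_abs _ _).trans ((Finset.sum_le_sum fun i _ => ?_).trans_eq
      (b := ∑ _i : Fin d, Lam * (A * (δ * Real.exp ((K + 1) * A))) / (m * m)) (by simp))
    refine (abs_log_derivative_sub_le hm0 (h.min_le_interp_diag ht hz i)
      (h.min_le_interp_diag ht hx i)).trans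
      (div_le_div_of_nonneg_right ?_ (mul_pos hm0 hm0).le)
    exact (hT z hz x hx i).trans (mul_le_mul_of_nonneg_left hzx hLam)
  have e : (d + d * (Lam * (A * Real.exp ((K + 1) * A)) / (m * m))) * δ =
      d * δ + d * (Lam * (A * (δ * Real.exp ((K + 1) * A))) / (m * m)) := by ring
  rw [e]
  rw [abs_sub_comm] at h3
  exact (abs_sub_le _ _ _).trans (add_le_add h3 h4)

/-- `log det D T_t(x)` as a function of time. -/
theorem hasDerivWithinAt_sum_log (h : IsTriangular c K T) {x : E d} (hx : x ∈ cube d) {t : ℝ}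
    (ht : t ∈ Icc (0 : ℝ) 1) :
    HasDerivWithinAt
      (fun t => ∑ i, Real.log (1 + t * (jac (fderivWithin ℝ T (cube d) x) i i - 1)))
      (∑ i, (jac (fderivWithin ℝ T (cube d) x) i i - 1) /
        (1 + t * (jac (fderivWithin ℝ T (cube d) x) i i - 1))) (Icc 0 1) t := by
  refine HasDerivWithinAt.fun_sum fun i _ => HasDerivAt.hasDerivWithinAt ?_
  have h1 := ((hasDerivAt_id t).mul_const
    (jac (fderivWithin ℝ T (cube d) x) i i - 1)).const_add 1
  rw [one_mul] at h1
  exact h1.log ((lt_min one_pos h.pos).trans_le (h.min_le_interp_diag ht hx i)).ne'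

/-- The Jacobian determinant of the flow of `g` is close to that of `T`. -/
theorem exists_det_flowMap_comparable {Lam : ℝ} (h : IsTriangular c K T)
    (hR : ∀ t ∈ Icc (0 : ℝ) 1,
      IsTriangular c' A (Function.invFunOn (KRFlow.interp T t) (cube d)))
    (hLam : 0 ≤ Lam)
    (hT : ∀ x ∈ cube d, ∀ y ∈ cube d, ∀ i, |jac (fderivWithin ℝ T (cube d) x) i i -
      jac (fderivWithin ℝ T (cube d) y) i i| ≤ Lam * ‖x - y‖)
    (hg : IsTangentField g) (hδ : 0 ≤ δ)
    (h₀ : ∀ t ∈ Icc (0 : ℝ) 1, ∀ x ∈ cube d, ‖straightVelocity T x t - g x t‖ ≤ δ)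
    (h₁ : ∀ t ∈ Icc (0 : ℝ) 1, ∀ x ∈ cube d,
      ‖fderivWithin ℝ (fun y => straightVelocity T y t - g y t) (cube d) x‖ ≤ δ)
    {x : E d} (hx : x ∈ cube d) :
    ∃ M, HasFDerivWithinAt (fun y => flowMap g y 1) M (cube d) x ∧
      |M.det| ≤ Real.exp
        ((d + d * (Lam * (A * Real.exp ((K + 1) * A)) / (min 1 c * min 1 c))) * δ) *
          ∏ i, jac (fderivWithin ℝ T (cube d) x) i i ∧
      ∏ i, jac (fderivWithin ℝ T (cube d) x) i i ≤ Real.exp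
        ((d + d * (Lam * (A * Real.exp ((K + 1) * A)) / (min 1 c * min 1 c))) * δ) * |M.det| := by
  obtain ⟨M, hM, hdet⟩ := hg.exists_hasFDerivWithinAt_flowMap hx
  refine ⟨M, hM, ?_⟩
  -- The reference function is `log det DT_t(x)`, zero at time 0 and equal to the logarithm of the
  -- product of the diagonal of `DT(x)` at time 1.
  have h2 := hdet _ _ _ (fun t ht => h.hasDerivWithinAt_sum_log hx ht)
    fun t ht => h.abs_trace_sub_le hR hLam hT hg hδ h₀ h₁ hx ht
  set η := (d + d * (Lam * (A * Real.exp ((K + 1) * A)) / (min 1 c * min 1 c))) * δ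
  simp only [one_mul, add_sub_cancel, zero_mul, add_zero, Real.log_one, Finset.sum_const_zero,
    sub_zero] at h2
  have hprod : Real.exp (∑ i, Real.log (jac (fderivWithin ℝ T (cube d) x) i i)) =
      ∏ i, jac (fderivWithin ℝ T (cube d) x) i i := by
    rw [Real.exp_sum]
    exact Finset.prod_congr rfl fun i _ => Real.exp_log (h.pos.trans_le (h.le_diag x hx i))
  rw [Real.exp_sub, Real.exp_add, hprod, div_le_iff₀ (Real.exp_pos _), mul_comm _ (Real.exp _),
    mul_comm _ (Real.exp η)] at h2
  exact ⟨h2.2, h2.1⟩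

end IsTriangular

/-- The lower bound `q ≥ L₂` turns the additive Lipschitz estimate into a multiplicative one, via `1
+ u ≤ exp u`. -/
theorem IsGoodDensity.le_exp_mul {d : ℕ} {L₁ L₂ : ℝ} {q : E d → ℝ} (h : IsGoodDensity L₁ L₂ q)
    {x y : E d} (hx : x ∈ cube d) (hy : y ∈ cube d) {a : ℝ} (hxy : ‖x - y‖ ≤ a) :
    q x ≤ Real.exp (L₁ * a / L₂) * q y := by
  have h1 := (convex_cube d).norm_image_sub_le_of_norm_fderivWithin_le
    (h.contDiffOn.differentiableOn two_ne_zero) h.norm_fderivWithin_le hy hx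
  have hL := h.pos'
  have hpos := h.pos
  rw [Real.norm_eq_abs] at h1
  have h2 : q x - q y ≤ L₁ * a :=
    (le_abs_self _).trans (h1.trans (mul_le_mul_of_nonneg_left hxy hL.le))
  have ha : 0 ≤ a := (norm_nonneg _).trans hxy
  have h3 : L₁ * a ≤ L₁ * a / L₂ * q y := by
    rw [div_mul_eq_mul_div, le_div_iff₀ hpos]
    exact mul_le_mul_of_nonneg_left (h.ge y hy) (mul_nonneg hL.le ha)
  have h4 := mul_le_mul_of_nonneg_right (Real.add_one_le_exp (L₁ * a / L₂))
    (hpos.le.trans (h.ge y hy))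
  linarith

/-! ### The distance `c1Dist` -/

section Distance

variable {d : ℕ} {f g : E d → ℝ → E d}

theorem cNorm_le_c1Dist {t : ℝ} (ht : t ∈ Icc (0 : ℝ) 1) :
    cNorm 1 (cube d) (fun x => f x t - g x t) ≤ c1Dist f g :=
  le_iSup₂ (f := fun t (_ : t ∈ Icc (0 : ℝ) 1) => cNorm 1 (cube d) fun x => f x t - g x t) t ht

theorem norm_sub_le_c1Dist (h : c1Dist f g ≠ ⊤) {t : ℝ} (ht : t ∈ Icc (0 : ℝ) 1) {x : E d}
    (hx : x ∈ cube d) : ‖f x t - g x t‖ ≤ (c1Dist f g).toReal :=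
  norm_le_of_cNorm_le (f := fun x => f x t - g x t) ENNReal.toReal_nonneg
    ((cNorm_le_c1Dist ht).trans (ENNReal.ofReal_toReal h).ge) hx

theorem norm_fderivWithin_sub_le_c1Dist (h : c1Dist f g ≠ ⊤) {t : ℝ} (ht : t ∈ Icc (0 : ℝ) 1)
    {x : E d} (hx : x ∈ cube d) :
    ‖fderivWithin ℝ (fun y => f y t - g y t) (cube d) x‖ ≤ (c1Dist f g).toReal :=
  norm_fderivWithin_le_of_cNorm_le le_rfl (uniqueDiffOn_cube d) ENNReal.toReal_nonneg
    ((cNorm_le_c1Dist ht).trans (ENNReal.ofReal_toReal h).ge) hx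

theorem IsTriangular.c1Dist_ne_top {c K c' A : ℝ} {T : E d → E d} (h : IsTriangular c K T)
    (hR : ∀ t ∈ Icc (0 : ℝ) 1,
      IsTriangular c' A (Function.invFunOn (KRFlow.interp T t) (cube d)))
    (hg : IsTangentField g) : c1Dist (straightVelocity T) g ≠ ⊤ := by
  obtain ⟨B, hB⟩ := (isCompact_cylinder d).exists_bound_of_continuousOn hg.continuousOn
  obtain ⟨B', hB'⟩ := hg.exists_norm_fderivWithin_le
  refine ne_top_of_le_ne_top (b := ENNReal.ofReal (max (2 * d + B) ((K + 1) * A + B')))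
    ENNReal.ofReal_ne_top (iSup₂_le fun t ht => cNorm_one_le (uniqueDiffOn_cube d)
      (fun x hx => ?_) fun x hx => ?_)
  · exact ((_root_.norm_sub_le _ _).trans (add_le_add (h.norm_straightVelocity_le ht hx)
      (hB (x, t) ⟨hx, ht⟩))).trans (le_max_left _ _)
  · rw [fderivWithin_fun_sub (uniqueDiffOn_cube d x hx)
      (((h.contDiffOn_straightVelocity (hR t ht)).differentiableOn one_ne_zero) x hx)
      (hg.differentiableOn ht x hx)]
    exact ((_root_.norm_sub_le _ _).trans (add_le_add
      (h.norm_fderivWithin_straightVelocity_le (hR t ht) hx) (hB' t ht x hx))).trans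
      (le_max_right _ _)

end Distance

/-! ### The estimate -/

section Estimate

variable {d k : ℕ} {L₁ L₂ c K c' A : ℝ} {p q : E d → ℝ} {π ρ : Measure (E d)}
  {g : E d → ℝ → E d}

/-- The time-one flow is `T`, whose determinant satisfies `det DT * (q ∘ T) = p`; the two-sided
comparison with `ε = 0` is then an equality. -/
theorem pushforward_krVelocity (hπ : RegularDensity k L₁ L₂ π p) (hρ : RegularDensity k L₁ L₂ ρ q)
    (hp : IsGoodDensity L₁ L₂ p) (hq : IsGoodDensity L₁ L₂ q)
    (hT : IsTriangular c K (krMap p q))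
    (hR : ∀ t ∈ Icc (0 : ℝ) 1,
      IsTriangular c' A (Function.invFunOn (KRFlow.interp (krMap p q) t) (cube d))) :
    pushforward (krVelocity p q) π = ρ := by
  have hflow : ∀ x ∈ cube d, flowMap (krVelocity p q) x 1 = krMap p q x := fun x hx =>
    hT.flowMap_straightVelocity hR hx
  have hdet : ∀ x ∈ cube d, |(fderivWithin ℝ (krMap p q) (cube d) x).det| *
      q (flowMap (krVelocity p q) x 1) = p x := fun x hx => by
    rw [abs_of_pos (hT.det_pos hx), hT.det_eq hx, hflow x hx, det_krMap hp hq hT hx]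
  rw [pushforward, hπ.eq_withDensity, hρ.eq_withDensity]
  ext B hB
  have h1 := map_withDensity_comparable (p := p) (q := q) (ε := 0)
    (Φ := fun x => flowMap (krVelocity p q) x 1)
    (Φ' := fderivWithin ℝ (krMap p q) (cube d))
    (hT.bijOn.congr fun x hx => (hflow x hx).symm)
    (fun x hx => (hT.hasFDerivWithinAt hx).congr hflow (hflow x hx))
    (fun x hx => by rw [Real.exp_zero, one_mul]; exact (hdet x hx).le)
    (fun x hx => by rw [Real.exp_zero, one_mul]; exact (hdet x hx).ge) hB
  simp only [Real.exp_zero, ENNReal.ofReal_one, one_mul] at h1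
  exact le_antisymm h1.2 h1.1

theorem isProbabilityMeasure_pushforward (hπ : RegularDensity k L₁ L₂ π p)
    (hg : IsTangentField g) : IsProbabilityMeasure (pushforward g π) := by
  have := hπ.isProbabilityMeasure
  refine Measure.isProbabilityMeasure_map ?_
  rw [hπ.eq_withDensity]
  refine aemeasurable_withDensity_of_continuousOn fun x hx => ?_
  obtain ⟨M, hM, -⟩ := hg.exists_hasFDerivWithinAt_flowMap hx
  exact hM.continuousWithinAt

/-- The constant in the comparison of the two pushforwards. -/
noncomputable def comparisonConst (d : ℕ) (L₁ L₂ c K A : ℝ) : ℝ :=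
  d + d * (((L₁ * L₁ + L₁ * L₁) / (L₂ * L₂) * (1 + K)) * (L₁ / L₂) / (L₂ / L₁ * (L₂ / L₁)) *
    (A * Real.exp ((K + 1) * A)) / (min 1 c * min 1 c)) +
  L₁ * Real.exp ((K + 1) * A) / L₂

theorem klDiv_pushforward_le (hπ : RegularDensity k L₁ L₂ π p) (hρ : RegularDensity k L₁ L₂ ρ q)
    (hp : IsGoodDensity L₁ L₂ p) (hq : IsGoodDensity L₁ L₂ q)
    (hT : IsTriangular c K (krMap p q))
    (hR : ∀ t ∈ Icc (0 : ℝ) 1,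
      IsTriangular c' A (Function.invFunOn (KRFlow.interp (krMap p q) t) (cube d)))
    (hg : IsTangentField g) :
    InformationTheory.klDiv (pushforward g π) (pushforward (krVelocity p q) π) ≤
      ((2 * comparisonConst d L₁ L₂ c K A ^ 2).toNNReal : ℝ≥0∞) *
        c1Dist (krVelocity p q) g ^ 2 := by
  rw [pushforward_krVelocity hπ hρ hp hq hT hR]
  have hπ1 := isProbabilityMeasure_pushforward hπ hg
  have hρ1 := hρ.isProbabilityMeasure
  have htop : c1Dist (krVelocity p q) g ≠ ⊤ := hT.c1Dist_ne_top hR hg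
  have hL₁ := hp.pos'
  have hL₂ := hp.pos
  have hK := hT.nonneg
  set δ := (c1Dist (krVelocity p q) g).toReal with hδ_def
  have hδ : 0 ≤ δ := ENNReal.toReal_nonneg
  have h₀ : ∀ t ∈ Icc (0 : ℝ) 1, ∀ x ∈ cube d,
      ‖straightVelocity (krMap p q) x t - g x t‖ ≤ δ :=
    fun t ht x hx => norm_sub_le_c1Dist htop ht hx
  have h₁ : ∀ t ∈ Icc (0 : ℝ) 1, ∀ x ∈ cube d,
      ‖fderivWithin ℝ (fun y => straightVelocity (krMap p q) y t - g y t) (cube d) x‖ ≤ δ :=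
    fun t ht x hx => norm_fderivWithin_sub_le_c1Dist htop ht hx
  have hLip : 0 ≤ ((L₁ * L₁ + L₁ * L₁) / (L₂ * L₂) * (1 + K)) * (L₁ / L₂) /
    (L₂ / L₁ * (L₂ / L₁)) := by positivity
  have hM := fun (x : E d) (hx : x ∈ cube d) => hT.exists_det_flowMap_comparable hR hLip
    (fun x hx y hy i => abs_jac_krMap_sub_le hp hq hT hx hy i) hg hδ h₀ h₁ hx
  choose! Φ' hΦ' hdet₁ hdet₂ using hM
  set ε := comparisonConst d L₁ L₂ c K A * δ with hε
  -- The determinant error and the displacement error in `q` multiply as exponentials; the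
  -- definition of `comparisonConst` is the sum of the two rates.
  have hsplit : ∀ a b : ℝ, Real.exp ((d + d * (((L₁ * L₁ + L₁ * L₁) / (L₂ * L₂) * (1 + K)) *
      (L₁ / L₂) / (L₂ / L₁ * (L₂ / L₁)) * (A * Real.exp ((K + 1) * A)) / (min 1 c * min 1 c))) *
      δ) * a * (Real.exp (L₁ * (δ * Real.exp ((K + 1) * A)) / L₂) * b) =
      Real.exp ε * (a * b) := fun a b => by
    rw [mul_mul_mul_comm, ← Real.exp_add, hε, comparisonConst]
    congr 2
    ring
  have hflow : ∀ x ∈ cube d, ‖flowMap g x 1 - krMap p q x‖ ≤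
      δ * Real.exp ((K + 1) * A) := fun x hx => by
    have := hT.norm_flowMap_sub_interp_le hR hg hδ h₀ hx (t := 1) (by simp)
    simpa [KRFlow.interp] using this
  have hX : ∀ x ∈ cube d, flowMap g x 1 ∈ cube d := fun x hx => hg.bijOn_flowMap.mapsTo hx
  have hJ : ∀ x ∈ cube d, 0 ≤ ∏ i, jac (fderivWithin ℝ (krMap p q) (cube d) x) i i :=
    fun x hx => by rw [← hT.det_eq hx]; exact (hT.det_pos hx).le
  have hcomp := fun (B : Set (E d)) (hB : MeasurableSet B) =>
    map_withDensity_comparable (p := p) (q := q) (ε := ε) hg.bijOn_flowMap hΦ'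
      (fun x hx => by
        rw [← det_krMap hp hq hT hx, ← hsplit]
        exact mul_le_mul (hdet₁ x hx) (hq.le_exp_mul (hX x hx) (hT.mapsTo hx) (hflow x hx))
          (hL₂.le.trans (hq.ge _ (hX x hx)))
          (mul_nonneg (Real.exp_pos _).le (hJ x hx)))
      (fun x hx => by
        rw [← det_krMap hp hq hT hx, ← hsplit]
        exact mul_le_mul (hdet₂ x hx) (hq.le_exp_mul (hT.mapsTo hx) (hX x hx)
            (by rw [norm_sub_rev]; exact hflow x hx))
          (hL₂.le.trans (hq.ge _ (hT.mapsTo hx)))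
          (mul_nonneg (Real.exp_pos _).le (abs_nonneg _))) hB
  have hkl : InformationTheory.klDiv (pushforward g π) ρ ≤ ENNReal.ofReal (2 * ε ^ 2) :=
    klDiv_le_of_le_mul
      (fun B hB => by
        rw [pushforward, hρ.eq_withDensity, hπ.eq_withDensity]; exact (hcomp B hB).1)
      (fun B hB => by
        rw [pushforward, hρ.eq_withDensity, hπ.eq_withDensity]; exact (hcomp B hB).2)
  refine hkl.trans_eq ?_
  rw [hε, mul_pow, ← mul_assoc, ENNReal.ofReal_mul (by positivity), ENNReal.ofReal_pow hδ,
    hδ_def, ENNReal.ofReal_toReal htop]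
  rfl

end Estimate

end KRFlow

/-! ### The theorem. -/

theorem mainTheorem9 (d : ℕ) (L₁ L₂ : ℝ) (hL₁ : 1 < L₁) (hL₂ : 0 < L₂) :
    ∃ C : ℝ≥0, ∀ (k : ℕ) (π ρ : Measure (KRFlow.E d)) (p q : KRFlow.E d → ℝ) (r : ℝ)
      (g : KRFlow.E d → ℝ → KRFlow.E d),
      2 ≤ k →
      KRFlow.RegularDensity k L₁ L₂ π p →
      KRFlow.RegularDensity k L₁ L₂ ρ q →
      KRFlow.InAnsatz 2 r g →
      -- the objects in the estimate are well defined
      (∀ t ∈ Icc (0 : ℝ) 1,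
        ContDiffOn ℝ 1 (fun x => KRFlow.krVelocity p q x t) (KRFlow.cube d)) ∧
      KRFlow.c1Dist (KRFlow.krVelocity p q) g ≠ ⊤ ∧
      KRFlow.WellPosed (KRFlow.krVelocity p q) ∧
      KRFlow.WellPosed g ∧
      IsProbabilityMeasure (KRFlow.pushforward (KRFlow.krVelocity p q) π) ∧
      IsProbabilityMeasure (KRFlow.pushforward g π) ∧
      -- the estimate
      InformationTheory.klDiv (KRFlow.pushforward g π)
          (KRFlow.pushforward (KRFlow.krVelocity p q) π)
        ≤ (C : ℝ≥0∞) * KRFlow.c1Dist (KRFlow.krVelocity p q) g ^ 2 := by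
  have hL : 0 < L₁ := zero_lt_one.trans hL₁
  obtain ⟨c, K, hc, hK, hT⟩ := KRFlow.exists_isTriangular_krMap d hL hL₂
  obtain ⟨A, -, hA⟩ := KRFlow.IsTriangular.exists_interp_inverse d hc hK
  -- The numbers `c`, `K`, `A` were obtained from `d`, `L₁`, `L₂` alone, before any density or field
  -- is introduced.
  refine ⟨(2 * KRFlow.comparisonConst d L₁ L₂ c K A ^ 2).toNNReal,
    fun k π ρ p q r g hk hπ hρ hg => ?_⟩
  have hp := hπ.isGoodDensity hk hL.le hL₂
  have hq := hρ.isGoodDensity hk hL.le hL₂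
  have hTpq := hT p q hp hq
  have hR := hA _ hTpq
  have hg' := hg.isTangentField
  refine ⟨fun t ht => hTpq.contDiffOn_straightVelocity (hR t ht), hTpq.c1Dist_ne_top hR hg',
    hTpq.wellPosed_straightVelocity hR, hg'.wellPosed, ?_,
    KRFlow.isProbabilityMeasure_pushforward hπ hg',
    KRFlow.klDiv_pushforward_le hπ hρ hp hq hTpq hR hg'⟩
  rw [KRFlow.pushforward_krVelocity hπ hρ hp hq hTpq hR]
  exact hρ.isProbabilityMeasure
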